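/- **Proposition (maximum likelihood in the generalized Pareto model).** For $\theta=(\xi,\beta)$ with $\xi>-\tfrac12$, $\beta>0$, let $P_\theta$ be the generalized Pareto distribution with location $0$, i.e. with density $f_\theta(x)=\frac1\beta\big(1+\xi\frac x\beta\big)^{-1/\xi-1}$ on $\{x\ge 0,\ 1+\xi x/\beta\ge 0\}$ (and $f_\theta(x)=\frac1\beta e^{-x/\beta}$ on $x\ge0$ for $\xi=0$). With $z=x/\beta$, let $$\Lambda_\theta(x)=\Big(\tfrac1{\xi^2}\log(1+\xi z)-\tfrac{\xi+1}{\xi}\tfrac{z}{1+\xi z},\ -\tfrac1\beta+\tfrac{\xi+1}{\beta}\tfrac{z}{1+\xi z}\Big)^{\tau}$$ be the scores (for $\xi=0$ the first component is $z^2/2-z$) and $\mathcal I_\theta=E_\theta\Lambda_\theta\Lambda_\theta^\tau$ the Fisher information. An estimator $S=(S_n)$ (measurable for each $n$) is asymptotically linear (an ALE) at $\theta$ with influence function (IF) $\psi$ if $\psi\in L_2(P_\theta;\mathbb R^2)$, $E_\theta\psi=0$, $E_\theta\psi\Lambda_\theta^\tau=\mathbb I_2$ and $\sqrt n\,\big|S_n-\theta-\frac1n\sum_{i=1}^n\psi(X_i)\big|\to0$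 in $P_\theta^n$-probability. Its asymptotic covariance $\mathrm{asVar}(S)$ is the matrix $V$ such that $\sqrt n(S_n-\theta)\to\mathcal N(0,V)$ weakly under $P_\theta^n$. A maximum likelihood estimator (MLE) is an estimator that, at every sample at which the likelihood $\prod_i f_\theta(x_i)$ attains its maximum over $\Theta=(-\frac12,\infty)\times(0,\infty)$, takes a maximizing value (and is arbitrary otherwise). Then for every MLE and every $\theta=(\xi,\beta)\in\Theta$: 1. **IF.** The MLE is an ALE at $\theta$ with influence function $\psi_\theta=\mathcal I_\theta^{-1}\Lambda_\theta$. If $\xi\neq0$, then for all $x\ge0$ with $1+\xi x/\beta>0$, $\psi_\theta(x)=\big(\tilde\psi_1(v),\beta\,\tilde\psi_2(v)\big)^\tau$, where $v=(1+\xi x/\beta)^{-1/\xi}$ and $$\tilde\psi(v)=\frac{\xi+1}{\xi^2}\begin{pmatrix}-(\xi^2+\xi)\log v+(2\xi^2+3\xi+1)v^\xi-(\xi^2+3\xi+1)\\ \xi\log v-(2\xi^2+3\xi+1)v^\xi+(3\xi+1)\end{pmatrix}.$$ 2. **asVar.** $\mathcal I_\theta$ is invertible and $$\mathrm{asVar}(\mathrm{MLE})=\mathcal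 I_\theta^{-1}=(1+\xi)\begin{pmatrix}\xi+1&-\beta\\-\beta&2\beta^2\end{pmatrix}.$$ This is the smallest asymptotic variance among all ALEs: every ALE $S$ at $\theta$, with IF $\psi$ say, has $\mathrm{asVar}(S)=\int\psi\psi^\tau\,dP_\theta$, and $\mathrm{asVar}(S)-\mathcal I_\theta^{-1}$ is positive semidefinite. 3. **Unbounded IF.** Both components of $\psi_\theta$ are unbounded on $\{x\ge0,\ 1+\xi x/\beta>0\}$; if $\xi>0$, the absolute value of each of them is of exact order $\log x$ as $x\to\infty$. 4. **Breakdown point.** For every $n\ge2$ and every sample $x_1,\dots,x_n>0$, the finite sample breakdown point of the MLE, i.e. the smallest fraction $m/n$ such that $|\mathrm{MLE}|$ becomes unbounded when $m$ suitably chosen points of the sample are replaced by arbitrary real values, is minimal, namely $1/n$ (equivalently, the largest number of replaced points that never leads to breakdown is $0$). -/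

import Mathlib

open MeasureTheory ProbabilityTheory Filter Topology Asymptotics
open scoped ENNReal BoundedContinuousFunction

noncomputable section

/-- Parameter vectors `θ = (ξ, β)` (shape, scale), with the Euclidean norm. -/
abbrev GPDParam : Type := EuclideanSpace ℝ (Fin 2)

/-- The density of the generalized Pareto distribution with location `0`, shape `ξ` and scale `β`;
`ξ = 0` is the exponential distribution. The support is `[0, ∞)` for `0 ≤ ξ` and `[0, -β/ξ]` for
`ξ < 0`. -/
def gpdDensity (ξ β x : ℝ) : ℝ :=
  if 0 ≤ x ∧ 0 ≤ 1 + ξ * (x / β) then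
    if ξ = 0 then β⁻¹ * Real.exp (-(x / β)) else β⁻¹ * (1 + ξ * (x / β)) ^ (-1 / ξ - 1)
  else 0

/-- The generalized Pareto distribution `P_θ`, `θ = (ξ, β)`. -/
def gpd (ξ β : ℝ) : Measure ℝ :=
  volume.withDensity fun x => ENNReal.ofReal (gpdDensity ξ β x)

/-- The law `P_θⁿ` of a sample of `n` independent observations. -/
def gpdSample (ξ β : ℝ) (n : ℕ) : Measure (Fin n → ℝ) :=
  Measure.pi fun _ => gpd ξ β

/-- The scores `Λ_θ(x) = ∂ log f_θ(x) / ∂(ξ, β)`; for `ξ = 0` the first component is the limit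
`ξ → 0` of the general expression. -/
def gpdScore (ξ β x : ℝ) : Fin 2 → ℝ :=
  let z := x / β
  ![if ξ = 0 then z ^ 2 / 2 - z
    else 1 / ξ ^ 2 * Real.log (1 + ξ * z) - (ξ + 1) / ξ * (z / (1 + ξ * z)),
    -(1 / β) + (ξ + 1) / β * (z / (1 + ξ * z))]

/-- The Fisher information matrix `I_θ = E_θ Λ_θ Λ_θᵀ`. -/
def fisherInfo (ξ β : ℝ) : Matrix (Fin 2) (Fin 2) ℝ :=
  Matrix.of fun i j => ∫ x, gpdScore ξ β x i * gpdScore ξ β x j ∂(gpd ξ β)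

/-- An estimator (more precisely, an estimator for every sample size) of `θ = (ξ, β)`. -/
structure GPDEstimator where
  /-- the value at a sample of size `n` -/
  toFun : ∀ n : ℕ, (Fin n → ℝ) → GPDParam
  measurable : ∀ n, Measurable (toFun n)

/-- The parameters over which the likelihood is maximized: those with finite Fisher information,
`ξ > -1/2` and `β > 0`. -/
def gpdParamSet : Set GPDParam := {θ | -(1 / 2) < θ 0 ∧ 0 < θ 1}

/-- The likelihood of the parameter `θ` at the sample `x`. It is used in product form, so that a
sample outside the support gets likelihood `0`, i.e. log-likelihood `-∞`. -/
def gpdLikelihood {n : ℕ} (x : Fin n → ℝ) (θ : GPDParam) : ℝ :=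
  ∏ i, gpdDensity (θ 0) (θ 1) (x i)

/-- `T` is a maximum likelihood estimator: at every sample at which the likelihood has a maximizer,
the value of `T` is a maximizer. -/
def IsMLE (T : GPDEstimator) : Prop :=
  ∀ (n : ℕ) (x : Fin n → ℝ),
    (∃ θ ∈ gpdParamSet, IsMaxOn (gpdLikelihood x) gpdParamSet θ) →
      T.toFun n x ∈ gpdParamSet ∧ IsMaxOn (gpdLikelihood x) gpdParamSet (T.toFun n x)

/-- `S` is an asymptotically linear estimator (ALE) at `θ = (ξ, β)` with influence function `ψ`:
`ψ ∈ L₂(P_θ)`, `E_θ ψ = 0`, `E_θ ψ Λ_θᵀ = 1`, and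
`S_n = θ + (1/n) ∑ ψ(X_i) + R_n` with `√n |R_n| → 0` in `P_θⁿ`-probability. -/
structure IsALE (ξ β : ℝ) (S : GPDEstimator) (ψ : ℝ → GPDParam) : Prop where
  memLp : MemLp ψ 2 (gpd ξ β)
  centered : ∀ i, ∫ x, ψ x i ∂(gpd ξ β) = 0
  score : ∀ i j, ∫ x, ψ x i * gpdScore ξ β x j ∂(gpd ξ β) = (1 : Matrix (Fin 2) (Fin 2) ℝ) i j
  remainder : ∀ ε : ℝ, 0 < ε → Tendsto
    (fun n : ℕ => gpdSample ξ β n {x | ε ≤ √(n : ℝ) *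
      ‖S.toFun n x - !₂[ξ, β] - (n : ℝ)⁻¹ • ∑ i, ψ (x i)‖}) atTop (𝓝 0)

/-- `V` is the asymptotic covariance matrix of `S` at `θ = (ξ, β)`: under `P_θⁿ`, the laws of
`√n (S_n - θ)` converge weakly to the centered normal distribution with covariance matrix `V`. -/
def HasAsVar (ξ β : ℝ) (S : GPDEstimator) (V : Matrix (Fin 2) (Fin 2) ℝ) : Prop :=
  V.PosSemidef ∧ ∀ g : GPDParam →ᵇ ℝ, Tendsto
    (fun n : ℕ => ∫ x, g (√(n : ℝ) • (S.toFun n x - !₂[ξ, β])) ∂(gpdSample ξ β n)) atTop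
    (𝓝 (∫ y, g y ∂(multivariateGaussian 0 V)))

/-- The matrix `∫ ψ ψᵀ dP_θ`. -/
def ifCov (ξ β : ℝ) (ψ : ℝ → GPDParam) : Matrix (Fin 2) (Fin 2) ℝ :=
  Matrix.of fun i j => ∫ x, ψ x i * ψ x j ∂(gpd ξ β)

/-- The function `I_θ⁻¹ Λ_θ`. -/
def mleIF (ξ β x : ℝ) : GPDParam :=
  WithLp.toLp 2 ((fisherInfo ξ β)⁻¹.mulVec (gpdScore ξ β x))

/-- The quantile-type transformation `v(z) = (1 + ξ z)^(-1/ξ)`. -/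
def gpdQuantileArg (ξ z : ℝ) : ℝ := (1 + ξ * z) ^ (-1 / ξ)

/-- The function `ψ̃(v)` of the quantile-type representation. -/
def gpdPsiTilde (ξ v : ℝ) : Fin 2 → ℝ :=
  ![(ξ + 1) / ξ ^ 2 * (-(ξ ^ 2 + ξ) * Real.log v + (2 * ξ ^ 2 + 3 * ξ + 1) * v ^ ξ
      - (ξ ^ 2 + 3 * ξ + 1)),
    (ξ + 1) / ξ ^ 2 * (ξ * Real.log v - (2 * ξ ^ 2 + 3 * ξ + 1) * v ^ ξ + (3 * ξ + 1))]

/-- The samples obtained from `x` by replacing `m` of its points by arbitrary values. -/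
def replacedSamples {n : ℕ} (x : Fin n → ℝ) (m : ℕ) : Set (Fin n → ℝ) :=
  {z | ∃ J : Finset (Fin n), J.card = m ∧ ∀ i, i ∉ J → z i = x i}

/-- Replacing `m` points of the sample `x` can make `|S|` arbitrarily large. -/
def BreaksDown {n : ℕ} (S : (Fin n → ℝ) → GPDParam) (x : Fin n → ℝ) (m : ℕ) : Prop :=
  ¬ BddAbove ((fun z => ‖S z‖) '' replacedSamples x m)

/-- The finite sample (replacement) breakdown point of `S` at the sample `x`: the smallest fraction
`m / n` of replaced points which makes breakdown possible (`∞` if there is none). -/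
def fsbp {n : ℕ} (S : (Fin n → ℝ) → GPDParam) (x : Fin n → ℝ) : ℝ≥0∞ :=
  ⨅ (m : ℕ) (_ : BreaksDown S x m), (m : ℝ≥0∞) / (n : ℝ≥0∞)

end

/-! In the coordinates `τ = ξ / β`, `σ = 1 / β` the log-density on the support is `log σ - (σ + τ)
H`, where `H = hazard τ x` is the integral of `1 / (1 + τ s)`. This form passes smoothly through `ξ
= 0`. The condition `ξ > -1/2` reads `σ + 2 τ > 0`, which gives `σ + τ ≥ σ / 2`. Moments come from
writing an observation as the image of a standard exponential variable `e`: for `ξ ≠ 0` the hazard,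
its `τ`-derivatives at the true parameter and the scores become polynomials in `e` and `exp (-ξ e)`
(`integral_gpd_of_eq`), and for `ξ = 0` polynomials in `e`. This yields the Fisher information, its
inverse and the explicit influence function.

The hard point is asymptotic linearity: for `ξ < 0` the support depends on the parameter, so the
likelihood is not smooth near the true parameter uniformly in the sample. Consistency is proved in
Wald's manner (`ae_eventually_mem_ball`): the Gibbs inequality, with its equality case and
identifiability, is made locally uniform by truncating the hazard, and compactness finishes after
the far regions of `(τ, σ)` are excluded.

For the rate, `hazard_add` is an exact second order expansion in `τ`. Its remainder enters the
likelihood with a favourable sign, so the quadratic upper bound `ae_eventually_avgLogLik_le` holds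
at every admissible parameter of a fixed neighbourhood. The matching lower bound
`ae_eventually_le_avgLogLik` needs `|a| max (x / (1 + τ x))` to be small, but it is used only at the
maximizer `(a', b')` of the quadratic approximation. There it is available, because `a'` is of order
`1 / √n` while the maximum is `o(√n)` by square integrability, which is again `ξ > -1/2`. Since the
estimator does at least as well as `(a', b')`, comparing the two bounds
(`sq_dist_le_of_quadratic_approx`) shows that it lies within `o(|a'| + |b'|)` of that point. Going
back to `(ξ, β)` and bounding the linear term by Chebyshev gives `isALE_of_isMLE`.

The limit law of any asymptotically linear estimator follows from the central limit theorem and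
Slutsky's lemma. Every influence function has the same covariance `I⁻¹` with `I⁻¹ Λ`, so the excess
covariance is the second moment matrix of a difference.

For breakdown, one observation is sent to a large `t`. At `(2R, 2R)` the density at `t` has a
heavier tail than at any parameter with `|ξ| ≤ R` and `β ≤ R`, so the maximizer leaves every bounded
set. Parameters near `ξ = -1/2` lose because admissibility forces `β > t / 4`. Thus a maximizer
exists and the estimator must take it (`exists_update_isMaxOn`). -/

/-! ### The cumulative hazard function -/

/-- The cumulative hazard function `∫₀ˣ ds / (1 + τ s)` at unit scale, so that the generalized
Pareto distribution with `τ = ξ / β`, `σ = 1 / β` has density `σ exp (-(σ + τ) hazard τ x)`. -/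
noncomputable def hazard (τ x : ℝ) : ℝ := ∫ s in (0 : ℝ)..x, (1 + τ * s)⁻¹

/-- The derivative of `hazard` with respect to `τ`. -/
noncomputable def hazardDeriv (τ x : ℝ) : ℝ := ∫ s in (0 : ℝ)..x, -(s / (1 + τ * s) ^ 2)

/-- The coefficient of the quadratic remainder in the expansion of `hazard (τ + a)` at `τ`. -/
noncomputable def hazardRem (τ a x : ℝ) : ℝ :=
  ∫ s in (0 : ℝ)..x, s ^ 2 / ((1 + τ * s) ^ 2 * (1 + (τ + a) * s))

lemma one_add_mul_pos_of_le {τ s x : ℝ} (hs : 0 ≤ s) (hsx : s ≤ x) (hx : 0 < 1 + τ * x) :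
    0 < 1 + τ * s := by
  rcases le_total 0 τ with h | h
  · positivity
  · nlinarith

lemma one_add_mul_pos_of_le_left {τ τ' x : ℝ} (hx : 0 ≤ x) (h : τ ≤ τ') (hτ : 0 < 1 + τ * x) :
    0 < 1 + τ' * x := by nlinarith

lemma intervalIntegrable_of_forall_continuousAt {f : ℝ → ℝ} {x : ℝ} (hx : 0 ≤ x)
    (h : ∀ s, 0 ≤ s → s ≤ x → ContinuousAt f s) : IntervalIntegrable f volume 0 x := by
  refine ContinuousOn.intervalIntegrable fun s hs => ?_
  rw [Set.uIcc_of_le hx] at hs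
  exact (h s hs.1 hs.2).continuousWithinAt

lemma continuousAt_one_add_mul_inv {τ s : ℝ} (h : 0 < 1 + τ * s) :
    ContinuousAt (fun s : ℝ => (1 + τ * s)⁻¹) s := by
  have := h.ne'
  fun_prop (disch := assumption)

lemma intervalIntegrable_hazard {τ x : ℝ} (hx : 0 ≤ x) (h : 0 < 1 + τ * x) :
    IntervalIntegrable (fun s : ℝ => (1 + τ * s)⁻¹) volume 0 x :=
  intervalIntegrable_of_forall_continuousAt hx fun _ h0 h1 =>
    continuousAt_one_add_mul_inv (one_add_mul_pos_of_le h0 h1 h)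

lemma intervalIntegrable_hazardDeriv {τ x : ℝ} (hx : 0 ≤ x) (h : 0 < 1 + τ * x) :
    IntervalIntegrable (fun s : ℝ => -(s / (1 + τ * s) ^ 2)) volume 0 x := by
  refine intervalIntegrable_of_forall_continuousAt hx fun s h0 h1 => ?_
  have : (1 + τ * s) ^ 2 ≠ 0 := (pow_pos (one_add_mul_pos_of_le h0 h1 h) 2).ne'
  fun_prop (disch := assumption)

lemma intervalIntegrable_hazardRem {τ a x : ℝ} (hx : 0 ≤ x) (h : 0 < 1 + τ * x)
    (ha : 0 < 1 + (τ + a) * x) :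
    IntervalIntegrable (fun s : ℝ => s ^ 2 / ((1 + τ * s) ^ 2 * (1 + (τ + a) * s)))
      volume 0 x := by
  refine intervalIntegrable_of_forall_continuousAt hx fun s h0 h1 => ?_
  have : (1 + τ * s) ^ 2 * (1 + (τ + a) * s) ≠ 0 :=
    (mul_pos (pow_pos (one_add_mul_pos_of_le h0 h1 h) 2) (one_add_mul_pos_of_le h0 h1 ha)).ne'
  fun_prop (disch := assumption)

/-- An algebraic identity between the integrands, so the expansion is exact and needs no smallness
of `a`, only admissibility of both parameters. -/
lemma hazard_add {τ a x : ℝ} (hx : 0 ≤ x) (h : 0 < 1 + τ * x) (ha : 0 < 1 + (τ + a) * x) :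
    hazard (τ + a) x = hazard τ x + a * hazardDeriv τ x + a ^ 2 * hazardRem τ a x := by
  unfold hazard hazardDeriv hazardRem
  rw [← intervalIntegral.integral_const_mul, ← intervalIntegral.integral_const_mul,
    ← intervalIntegral.integral_add (intervalIntegrable_hazard hx h)
      ((intervalIntegrable_hazardDeriv hx h).const_mul a),
    ← intervalIntegral.integral_add ((intervalIntegrable_hazard hx h).add
      ((intervalIntegrable_hazardDeriv hx h).const_mul a))
      ((intervalIntegrable_hazardRem hx h ha).const_mul _)]
  refine intervalIntegral.integral_congr fun s hs => ?_
  rw [Set.uIcc_of_le hx] at hs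
  have h1 := (one_add_mul_pos_of_le hs.1 hs.2 h).ne'
  have h2 := (one_add_mul_pos_of_le hs.1 hs.2 ha).ne'
  field_simp
  ring

lemma hazard_nonneg {τ x : ℝ} (hx : 0 ≤ x) (h : 0 < 1 + τ * x) : 0 ≤ hazard τ x :=
  intervalIntegral.integral_nonneg hx fun _ hs =>
    (inv_pos.2 (one_add_mul_pos_of_le hs.1 hs.2 h)).le

lemma hazard_pos {τ x : ℝ} (hx : 0 < x) (h : 0 < 1 + τ * x) : 0 < hazard τ x :=
  intervalIntegral.intervalIntegral_pos_of_pos_on (intervalIntegrable_hazard hx.le h)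
    (fun _ hs => inv_pos.2 (one_add_mul_pos_of_le hs.1.le hs.2.le h)) hx

lemma hazard_anti {τ τ' x : ℝ} (hx : 0 ≤ x) (h : 0 < 1 + τ * x) (hle : τ ≤ τ') :
    hazard τ' x ≤ hazard τ x := by
  refine intervalIntegral.integral_mono_on hx
    (intervalIntegrable_hazard hx (one_add_mul_pos_of_le_left hx hle h))
    (intervalIntegrable_hazard hx h) fun s hs => ?_
  have := one_add_mul_pos_of_le hs.1 hs.2 h
  have := hs.1
  gcongr

lemma hasDerivAt_hazard {τ x : ℝ} (hx : 0 ≤ x) (h : 0 < 1 + τ * x) :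
    HasDerivAt (hazard τ) (1 + τ * x)⁻¹ x := by
  refine intervalIntegral.integral_hasDerivAt_right (intervalIntegrable_hazard hx h) ?_
    (continuousAt_one_add_mul_inv h)
  exact (by fun_prop : Measurable fun s : ℝ => (1 + τ * s)⁻¹).stronglyMeasurable
    |>.stronglyMeasurableAtFilter

lemma mul_hazard {τ x : ℝ} (hx : 0 ≤ x) (h : 0 < 1 + τ * x) :
    τ * hazard τ x = Real.log (1 + τ * x) := by
  have : ∫ s in (0 : ℝ)..x, τ * (1 + τ * s)⁻¹ = Real.log (1 + τ * x) - Real.log (1 + τ * 0) := by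
    refine intervalIntegral.integral_eq_sub_of_hasDerivAt (f := fun s => Real.log (1 + τ * s))
      (fun s hs => ?_) ((intervalIntegrable_hazard hx h).const_mul _)
    rw [Set.uIcc_of_le hx] at hs
    have h1 := one_add_mul_pos_of_le hs.1 hs.2 h
    have h2 : HasDerivAt (fun s : ℝ => 1 + τ * s) τ s := by
      simpa using ((hasDerivAt_id s).const_mul τ).const_add 1
    simpa [div_eq_mul_inv] using h2.log h1.ne'
  simpa [hazard] using this

/-- The combined integrand is the derivative of `s / (1 + τ s)`. Stated without division by `τ`, it
determines `hazardDeriv` for `τ ≠ 0` and stays valid at `τ = 0`. -/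
lemma hazard_add_mul_hazardDeriv {τ x : ℝ} (hx : 0 ≤ x) (h : 0 < 1 + τ * x) :
    hazard τ x + τ * hazardDeriv τ x = x / (1 + τ * x) := by
  have : ∫ s in (0 : ℝ)..x, ((1 + τ * s)⁻¹ + τ * -(s / (1 + τ * s) ^ 2)) =
      x / (1 + τ * x) - 0 / (1 + τ * 0) := by
    refine intervalIntegral.integral_eq_sub_of_hasDerivAt (f := fun s => s / (1 + τ * s))
      (fun s hs => ?_) ((intervalIntegrable_hazard hx h).add
        ((intervalIntegrable_hazardDeriv hx h).const_mul _))
    rw [Set.uIcc_of_le hx] at hs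
    have h1 := one_add_mul_pos_of_le hs.1 hs.2 h
    have h2 : HasDerivAt (fun s : ℝ => 1 + τ * s) τ s := by
      simpa using ((hasDerivAt_id s).const_mul τ).const_add 1
    refine ((hasDerivAt_id' s).div h2 h1.ne').congr_deriv ?_
    have := h1.ne'
    field_simp
    ring
  rw [intervalIntegral.integral_add (intervalIntegrable_hazard hx h)
    ((intervalIntegrable_hazardDeriv hx h).const_mul _),
    intervalIntegral.integral_const_mul] at this
  simpa [hazard, hazardDeriv] using this

/-- The same device one order higher, with the antiderivative `(s / (1 + τ s)) ^ 2`; it yields the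
closed form of `hazardRem τ 0`. -/
lemma sq_add_hazardDeriv_add_hazardRem {τ x : ℝ} (hx : 0 ≤ x) (h : 0 < 1 + τ * x) :
    (x / (1 + τ * x)) ^ 2 + 2 * hazardDeriv τ x + 2 * τ * hazardRem τ 0 x = 0 := by
  have h0 : 0 < 1 + (τ + 0) * x := by simpa using h
  have : ∫ s in (0 : ℝ)..x, ((-2) * -(s / (1 + τ * s) ^ 2) +
      (-2 * τ) * (s ^ 2 / ((1 + τ * s) ^ 2 * (1 + (τ + 0) * s)))) =
      (x / (1 + τ * x)) ^ 2 - (0 / (1 + τ * 0)) ^ 2 := by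
    refine intervalIntegral.integral_eq_sub_of_hasDerivAt (f := fun s => (s / (1 + τ * s)) ^ 2)
      (fun s hs => ?_) (((intervalIntegrable_hazardDeriv hx h).const_mul _).add
        ((intervalIntegrable_hazardRem hx h h0).const_mul _))
    rw [Set.uIcc_of_le hx] at hs
    have h1 := one_add_mul_pos_of_le hs.1 hs.2 h
    have h2 : HasDerivAt (fun s : ℝ => 1 + τ * s) τ s := by
      simpa using ((hasDerivAt_id s).const_mul τ).const_add 1
    refine (((hasDerivAt_id' s).div h2 h1.ne').pow 2).congr_deriv ?_
    have := h1.ne'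
    simp only [add_zero, Pi.div_apply, Nat.cast_ofNat, Nat.add_one_sub_one, pow_one]
    field_simp
    ring
  rw [intervalIntegral.integral_add ((intervalIntegrable_hazardDeriv hx h).const_mul _)
    ((intervalIntegrable_hazardRem hx h h0).const_mul _),
    intervalIntegral.integral_const_mul, intervalIntegral.integral_const_mul] at this
  unfold hazardDeriv hazardRem
  norm_num at this ⊢
  linarith

lemma hazard_zero_left (x : ℝ) : hazard 0 x = x := by simp [hazard]

lemma hazardDeriv_zero_left (x : ℝ) : hazardDeriv 0 x = -(x ^ 2 / 2) := by
  simp only [hazardDeriv, zero_mul, add_zero, one_pow, div_one]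
  rw [intervalIntegral.integral_neg]; simp

lemma hazardRem_zero_left (x : ℝ) : hazardRem 0 0 x = x ^ 3 / 3 := by
  simp [hazardRem]; norm_num

lemma div_one_add_mul_le {τ s x : ℝ} (hs : 0 ≤ s) (hsx : s ≤ x) (h : 0 < 1 + τ * x) :
    s / (1 + τ * s) ≤ x / (1 + τ * x) := by
  rw [div_le_div_iff₀ (one_add_mul_pos_of_le hs hsx h) h]
  nlinarith

lemma hazardRem_nonneg {τ a x : ℝ} (hx : 0 ≤ x) (h : 0 < 1 + τ * x)
    (ha : 0 < 1 + (τ + a) * x) : 0 ≤ hazardRem τ a x := by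
  refine intervalIntegral.integral_nonneg hx fun s hs => ?_
  have := one_add_mul_pos_of_le hs.1 hs.2 h
  have := one_add_mul_pos_of_le hs.1 hs.2 ha
  positivity

/-- With `w(s) = s / (1 + τ s)` increasing, `1 + (τ + a) s ≤ (1 + τ s) (1 + δ w(x))`. Only an upper
bound on `a` enters, so the estimate survives up to the edge of admissibility. -/
lemma hazardRem_div_le {τ a δ x : ℝ} (hx : 0 ≤ x) (h : 0 < 1 + τ * x)
    (ha : 0 < 1 + (τ + a) * x) (hδ : 0 ≤ δ) (haδ : a ≤ δ) :
    hazardRem τ 0 x / (1 + δ * (x / (1 + τ * x))) ≤ hazardRem τ a x := by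
  have h0 : 0 < 1 + (τ + 0) * x := by simpa using h
  unfold hazardRem
  rw [← intervalIntegral.integral_div]
  refine intervalIntegral.integral_mono_on hx
    ((intervalIntegrable_hazardRem hx h h0).div_const _)
    (intervalIntegrable_hazardRem hx h ha) fun s hs => ?_
  have h1 := one_add_mul_pos_of_le hs.1 hs.2 h
  have h2 := one_add_mul_pos_of_le hs.1 hs.2 ha
  have h3 := div_one_add_mul_le hs.1 hs.2 h
  have hs0 := hs.1
  have h4 : 0 ≤ x / (1 + τ * x) := by positivity
  rw [add_zero, div_div]
  refine div_le_div_of_nonneg_left (by positivity) (by positivity) ?_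
  rw [mul_assoc]
  refine mul_le_mul_of_nonneg_left ?_ (by positivity)
  have h5 : s ≤ (1 + τ * s) * (x / (1 + τ * x)) := by
    rw [div_le_iff₀ h1] at h3; linarith
  nlinarith [mul_le_mul_of_nonneg_left h5 hδ]

/-- The hypothesis gives `1 + (τ + a) s ≥ (1 - η) (1 + τ s)` on `[0, x]`, hence both admissibility
of `τ + a` and control of the remainder. -/
lemma hazardRem_le_div {τ a η x : ℝ} (hx : 0 ≤ x) (h : 0 < 1 + τ * x) (hη : η < 1)
    (haη : |a| * (x / (1 + τ * x)) ≤ η) :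
    0 < 1 + (τ + a) * x ∧ hazardRem τ a x ≤ hazardRem τ 0 x / (1 - η) := by
  have h0 : 0 < 1 + (τ + 0) * x := by simpa using h
  have key : ∀ s, 0 ≤ s → s ≤ x → (1 + τ * s) * (1 - η) ≤ 1 + (τ + a) * s := by
    intro s hs hsx
    have h1 := one_add_mul_pos_of_le hs hsx h
    have h2 : |a| * (s / (1 + τ * s)) ≤ η :=
      (mul_le_mul_of_nonneg_left (div_one_add_mul_le hs hsx h) (abs_nonneg a)).trans haη
    rw [← mul_div_assoc, div_le_iff₀ h1] at h2
    nlinarith [neg_abs_le a, mul_le_mul_of_nonneg_right (neg_abs_le a) hs]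
  have hη' : 0 < 1 - η := by linarith
  have ha : 0 < 1 + (τ + a) * x := lt_of_lt_of_le (by positivity) (key x hx le_rfl)
  refine ⟨ha, ?_⟩
  unfold hazardRem
  rw [← intervalIntegral.integral_div]
  refine intervalIntegral.integral_mono_on hx (intervalIntegrable_hazardRem hx h ha)
    ((intervalIntegrable_hazardRem hx h h0).div_const _) fun s hs => ?_
  have h1 := one_add_mul_pos_of_le hs.1 hs.2 h
  have h2 := key s hs.1 hs.2
  rw [add_zero, div_div]
  refine div_le_div_of_nonneg_left (by positivity) (by positivity) ?_
  rw [mul_assoc]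
  exact mul_le_mul_of_nonneg_left h2 (by positivity)

lemma continuousAt_hazard_left {τ x : ℝ} (hx : 0 ≤ x) (h : 0 < 1 + τ * x) :
    ContinuousAt (fun τ' => hazard τ' x) τ := by
  have hlim : Tendsto (fun a : ℝ => hazard τ x + a * hazardDeriv τ x +
      a ^ 2 * hazardRem τ a x) (𝓝 0) (𝓝 (hazard τ x)) := by
    have hR : Tendsto (fun a : ℝ => a ^ 2 * hazardRem τ a x) (𝓝 0) (𝓝 0) := by
      have hev : ∀ᶠ a : ℝ in 𝓝 0, |a| * (x / (1 + τ * x)) ≤ 1 / 2 := by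
        have : Tendsto (fun a : ℝ => |a| * (x / (1 + τ * x))) (𝓝 0)
            (𝓝 (|0| * (x / (1 + τ * x)))) :=
          (Continuous.tendsto (by fun_prop) _)
        rw [abs_zero, zero_mul] at this
        exact this.eventually_le_const (by norm_num)
      have hlim2 : Tendsto (fun a : ℝ => a ^ 2 * (hazardRem τ 0 x / (1 - 1 / 2))) (𝓝 0)
          (𝓝 0) := by
        have := Continuous.tendsto
          (by fun_prop : Continuous fun a : ℝ => a ^ 2 * (hazardRem τ 0 x / (1 - 1 / 2))) 0
        simpa using this
      refine tendsto_of_tendsto_of_tendsto_of_le_of_le' tendsto_const_nhds hlim2 ?_ ?_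
      · filter_upwards [hev] with a ha
        have := hazardRem_le_div hx h (by norm_num) ha
        exact mul_nonneg (sq_nonneg _) (hazardRem_nonneg hx h this.1)
      · filter_upwards [hev] with a ha
        exact mul_le_mul_of_nonneg_left (hazardRem_le_div hx h (by norm_num) ha).2 (sq_nonneg _)
    have h1 : Tendsto (fun a : ℝ => hazard τ x + a * hazardDeriv τ x) (𝓝 0)
        (𝓝 (hazard τ x + 0 * hazardDeriv τ x)) := (Continuous.tendsto (by fun_prop) _)
    simpa using h1.add hR
  have h2 : Tendsto (fun τ' : ℝ => τ' - τ) (𝓝 τ) (𝓝 0) := by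
    have := Continuous.tendsto (by fun_prop : Continuous fun τ' : ℝ => τ' - τ) τ
    simpa using this
  refine (hlim.comp h2).congr' ?_
  have hev : ∀ᶠ τ' in 𝓝 τ, 0 < 1 + τ' * x :=
    (Continuous.continuousAt (by fun_prop)).eventually_const_lt h
  filter_upwards [hev] with τ' hτ'
  have := hazard_add (τ := τ) (a := τ' - τ) hx h (by simpa using hτ')
  simp only [Function.comp]
  rw [← this]; simp

/-- No integrability of `g` is available, since the hazard integrand may have a pole. The integral
is therefore read as a section integral of a jointly measurable function, which is measurable in any
case. -/
lemma measurable_intervalIntegral_right {g : ℝ → ℝ} (hg : Measurable g) :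
    Measurable fun x : ℝ => ∫ s in (0 : ℝ)..x, g s := by
  have key : ∀ A : ℝ → Set ℝ, MeasurableSet {p : ℝ × ℝ | p.2 ∈ A p.1} →
      Measurable fun x : ℝ => ∫ s in A x, g s := by
    intro A hA
    have hA' : ∀ x, MeasurableSet (A x) := fun x => measurable_prodMk_left hA
    have : (fun x : ℝ => ∫ s in A x, g s) =
        fun x => ∫ s, ({p : ℝ × ℝ | p.2 ∈ A p.1}.indicator (fun p => g p.2)) (x, s) := by
      ext x
      rw [← integral_indicator (hA' x)]
      rfl
    rw [this]
    exact (StronglyMeasurable.integral_prod_right'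
      (((hg.comp measurable_snd).indicator hA).stronglyMeasurable)).measurable
  unfold intervalIntegral
  refine (key _ ?_).sub (key _ ?_)
  · exact (measurableSet_lt measurable_const measurable_snd).inter
      (measurableSet_le measurable_snd measurable_fst)
  · exact (measurableSet_lt measurable_fst measurable_snd).inter
      (measurableSet_le measurable_snd measurable_const)

@[fun_prop] lemma measurable_hazard (τ : ℝ) : Measurable (hazard τ) :=
  measurable_intervalIntegral_right (by fun_prop)

@[fun_prop] lemma measurable_hazardDeriv (τ : ℝ) : Measurable (hazardDeriv τ) :=
  measurable_intervalIntegral_right (by fun_prop)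

@[fun_prop] lemma measurable_hazardRem (τ a : ℝ) : Measurable (hazardRem τ a) :=
  measurable_intervalIntegral_right (by fun_prop)

/-! ### The generalized Pareto distribution as the law of a transformed exponential variable -/

/-- The function `e ↦ β (exp (ξ e) - 1) / ξ` which maps the standard exponential distribution to
the generalized Pareto distribution. -/
noncomputable def gpdExpTransform (ξ β e : ℝ) : ℝ :=
  if ξ = 0 then β * e else β * ((Real.exp (ξ * e) - 1) / ξ)

/-- The standard exponential distribution. -/
noncomputable def stdExp : Measure ℝ :=
  (volume.restrict (Set.Ioi 0)).withDensity fun e => ENNReal.ofReal (Real.exp (-e))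

lemma one_add_mul_gpdExpTransform {ξ β : ℝ} (hβ : 0 < β) (e : ℝ) :
    1 + ξ * (gpdExpTransform ξ β e / β) = Real.exp (ξ * e) := by
  unfold gpdExpTransform
  split_ifs with h
  · simp [h]
  · field_simp; ring

lemma hasDerivAt_gpdExpTransform (ξ β e : ℝ) :
    HasDerivAt (gpdExpTransform ξ β) (β * Real.exp (ξ * e)) e := by
  unfold gpdExpTransform
  by_cases h : ξ = 0
  · simpa [h] using (hasDerivAt_id' e).const_mul β
  · simp only [h, if_false]
    have := (((((hasDerivAt_id' e).const_mul ξ).exp).sub_const 1).div_const ξ).const_mul β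
    refine this.congr_deriv ?_
    field_simp

@[fun_prop] lemma continuous_gpdExpTransform (ξ β : ℝ) : Continuous (gpdExpTransform ξ β) :=
  continuous_iff_continuousAt.2 fun e => (hasDerivAt_gpdExpTransform ξ β e).continuousAt

@[fun_prop] lemma measurable_gpdExpTransform (ξ β : ℝ) : Measurable (gpdExpTransform ξ β) :=
  (continuous_gpdExpTransform ξ β).measurable

lemma strictMono_gpdExpTransform {ξ β : ℝ} (hβ : 0 < β) : StrictMono (gpdExpTransform ξ β) :=
  strictMono_of_hasDerivAt_pos (fun e => hasDerivAt_gpdExpTransform ξ β e) fun e => by positivity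

@[simp] lemma gpdExpTransform_zero (ξ β : ℝ) : gpdExpTransform ξ β 0 = 0 := by
  simp [gpdExpTransform]

lemma gpdExpTransform_pos {ξ β e : ℝ} (hβ : 0 < β) (he : 0 < e) : 0 < gpdExpTransform ξ β e := by
  simpa using strictMono_gpdExpTransform (ξ := ξ) hβ he

lemma image_gpdExpTransform {ξ β : ℝ} (hβ : 0 < β) :
    gpdExpTransform ξ β '' Set.Ioi 0 = {x | 0 < x ∧ 0 < 1 + ξ * (x / β)} := by
  ext x
  constructor
  · rintro ⟨e, he, rfl⟩
    exact ⟨gpdExpTransform_pos hβ he, by rw [one_add_mul_gpdExpTransform hβ]; positivity⟩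
  · rintro ⟨hx, hx'⟩
    by_cases h : ξ = 0
    · exact ⟨x / β, div_pos hx hβ, by simp [gpdExpTransform, h]; field_simp⟩
    · have hval : gpdExpTransform ξ β (Real.log (1 + ξ * (x / β)) / ξ) = x := by
        simp only [gpdExpTransform, h, if_false]
        rw [mul_div_cancel₀ _ h, Real.exp_log hx']
        field_simp
        ring
      refine ⟨_, ?_, hval⟩
      rw [← hval, ← gpdExpTransform_zero ξ β] at hx
      exact (strictMono_gpdExpTransform hβ).lt_iff_lt.1 hx

lemma measurableSet_gpdSupport (ξ β : ℝ) :
    MeasurableSet {x : ℝ | 0 < x ∧ 0 < 1 + ξ * (x / β)} :=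
  (measurableSet_lt measurable_const measurable_id).inter
    (measurableSet_lt measurable_const (g := fun x => 1 + ξ * (x / β)) (by fun_prop))

@[fun_prop] lemma measurable_gpdDensity (ξ β : ℝ) : Measurable (gpdDensity ξ β) := by
  unfold gpdDensity
  have h : MeasurableSet {x : ℝ | 0 ≤ x ∧ 0 ≤ 1 + ξ * (x / β)} :=
    (measurableSet_le measurable_const measurable_id).inter
      (measurableSet_le measurable_const (g := fun x => 1 + ξ * (x / β)) (by fun_prop))
  refine Measurable.ite h ?_ measurable_const
  split_ifs
  · fun_prop
  · fun_prop

lemma gpdDensity_nonneg {ξ β : ℝ} (hβ : 0 < β) (x : ℝ) : 0 ≤ gpdDensity ξ β x := by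
  unfold gpdDensity
  split_ifs with h
  · positivity
  · have := h.2
    positivity
  · rfl

lemma gpdDensity_gpdExpTransform {ξ β e : ℝ} (hβ : 0 < β) (he : 0 < e) :
    gpdDensity ξ β (gpdExpTransform ξ β e) = β⁻¹ * Real.exp (-((1 + ξ) * e)) := by
  have h1 := one_add_mul_gpdExpTransform (ξ := ξ) hβ e
  have h2 := gpdExpTransform_pos (ξ := ξ) hβ he
  unfold gpdDensity
  rw [h1, if_pos ⟨h2.le, by positivity⟩]
  split_ifs with h
  · simp only [gpdExpTransform, h, if_true]
    field_simp
    simp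
  · rw [← Real.exp_mul]
    congr 2
    field_simp
    ring

lemma gpdDensity_eq_zero {ξ β x : ℝ} (hξ : -1 < ξ) (h : 1 + ξ * (x / β) ≤ 0) :
    gpdDensity ξ β x = 0 := by
  unfold gpdDensity
  split_ifs with h1 h2
  · norm_num [h2] at h
  -- At an endpoint of the support the power of `0` vanishes unless its exponent is `0`, which would
  -- mean `ξ = -1`.
  · rw [le_antisymm h h1.2, Real.zero_rpow, mul_zero]
    intro h3
    have : -1 / ξ = 1 := by linarith
    rw [div_eq_iff h2] at this
    linarith
  · rfl

/-- Change of variables: the Jacobian `β exp (ξ e)` times the density `β⁻¹ exp (-(1 + ξ) e)` is `exp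
(-e)`. -/
lemma lintegral_gpd {ξ β : ℝ} (hξ : -1 < ξ) (hβ : 0 < β) {g : ℝ → ℝ≥0∞} (hg : Measurable g) :
    ∫⁻ x, g x ∂(gpd ξ β) =
      ∫⁻ e in Set.Ioi 0, ENNReal.ofReal (Real.exp (-e)) * g (gpdExpTransform ξ β e) := by
  have hm := measurableSet_gpdSupport ξ β
  have h1 : ∫⁻ x, g x ∂(gpd ξ β) = ∫⁻ x in {x : ℝ | 0 < x ∧ 0 < 1 + ξ * (x / β)},
      ENNReal.ofReal (gpdDensity ξ β x) * g x := by
    rw [gpd, lintegral_withDensity_eq_lintegral_mul _ (by fun_prop) hg, ← lintegral_indicator hm]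
    refine lintegral_congr_ae ?_
    filter_upwards [Measure.ae_ne volume (0 : ℝ)] with x hx
    by_cases h : x ∈ {x : ℝ | 0 < x ∧ 0 < 1 + ξ * (x / β)}
    · simp [Set.indicator_of_mem h]
    · rw [Set.indicator_of_notMem h]
      have : gpdDensity ξ β x = 0 := by
        by_cases h0 : 0 ≤ x
        · refine gpdDensity_eq_zero hξ ?_
          by_contra h3
          exact h ⟨lt_of_le_of_ne h0 (Ne.symm hx), not_le.1 h3⟩
        · simp [gpdDensity, h0]
      simp [this]
  rw [h1, ← image_gpdExpTransform hβ, lintegral_image_eq_lintegral_abs_deriv_mul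
    measurableSet_Ioi (fun e _ => (hasDerivAt_gpdExpTransform ξ β e).hasDerivWithinAt)
    (strictMono_gpdExpTransform hβ).injective.injOn]
  refine setLIntegral_congr_fun measurableSet_Ioi fun e he => ?_
  rw [gpdDensity_gpdExpTransform hβ he, ← mul_assoc, ← ENNReal.ofReal_mul (abs_nonneg _),
    abs_of_pos (by positivity)]
  congr 2
  rw [show -e = ξ * e + -((1 + ξ) * e) by ring, Real.exp_add]
  field_simp

lemma gpd_eq_map {ξ β : ℝ} (hξ : -1 < ξ) (hβ : 0 < β) :
    gpd ξ β = stdExp.map (gpdExpTransform ξ β) := by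
  ext s hs
  rw [← lintegral_indicator_one hs, lintegral_gpd hξ hβ (measurable_one.indicator hs),
    Measure.map_apply (by fun_prop) hs, stdExp,
    withDensity_apply _ (measurable_gpdExpTransform ξ β hs), Measure.restrict_restrict
      (measurable_gpdExpTransform ξ β hs), ← setLIntegral_indicator
      (measurable_gpdExpTransform ξ β hs)]
  refine lintegral_congr fun e => ?_
  by_cases h : gpdExpTransform ξ β e ∈ s
  · simp [Set.indicator, h]
  · simp [Set.indicator, h]

lemma integral_pow_mul_exp_neg {c : ℝ} (hc : 0 < c) (k : ℕ) :
    IntegrableOn (fun e : ℝ => e ^ k * Real.exp (-(c * e))) (Set.Ioi 0) ∧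
      ∫ e in Set.Ioi (0 : ℝ), e ^ k * Real.exp (-(c * e)) = k.factorial / c ^ (k + 1) := by
  constructor
  · have := integrableOn_rpow_mul_exp_neg_mul_rpow (p := 1) (s := k) (b := c)
      (by have := k.cast_nonneg (α := ℝ); linarith) one_pos hc
    simpa using this
  · have := Real.integral_rpow_mul_exp_neg_mul_Ioi (a := k + 1) (r := c) (by positivity) hc
    rw [Real.Gamma_nat_eq_factorial, one_div, Real.inv_rpow hc.le] at this
    rw [div_eq_inv_mul]
    simp only [add_sub_cancel_right, Real.rpow_natCast] at this
    rw [this, ← Real.rpow_natCast c (k + 1)]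
    push_cast
    rfl

lemma integrable_stdExp_iff {f : ℝ → ℝ} :
    Integrable f stdExp ↔ IntegrableOn (fun e => Real.exp (-e) * f e) (Set.Ioi 0) := by
  rw [stdExp, integrable_withDensity_iff_integrable_smul' (by fun_prop) (by simp)]
  simp [IntegrableOn, ENNReal.toReal_ofReal (Real.exp_pos _).le]

lemma integral_stdExp (f : ℝ → ℝ) :
    ∫ e, f e ∂stdExp = ∫ e in Set.Ioi 0, Real.exp (-e) * f e := by
  rw [stdExp, integral_withDensity_eq_integral_toReal_smul (by fun_prop) (by simp)]
  simp [ENNReal.toReal_ofReal (Real.exp_pos _).le]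

lemma stdExp_moment {c : ℝ} (hc : 0 < 1 + c) (k : ℕ) (b : ℝ) :
    Integrable (fun e => b * (e ^ k * Real.exp (-(c * e)))) stdExp ∧
      ∫ e, b * (e ^ k * Real.exp (-(c * e))) ∂stdExp = b * (k.factorial / (1 + c) ^ (k + 1)) := by
  have h := integral_pow_mul_exp_neg hc k
  have heq : (fun e : ℝ => Real.exp (-e) * (b * (e ^ k * Real.exp (-(c * e))))) =
      fun e => b * (e ^ k * Real.exp (-((1 + c) * e))) := by
    ext e
    rw [show -((1 + c) * e) = -e + -(c * e) by ring, Real.exp_add]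
    ring
  rw [integrable_stdExp_iff, integral_stdExp, heq]
  exact ⟨h.1.const_mul b, by rw [integral_const_mul, h.2]⟩

instance : IsProbabilityMeasure stdExp := by
  constructor
  have h := integral_pow_mul_exp_neg one_pos 0
  simp only [pow_zero, one_mul, Nat.factorial_zero, Nat.cast_one, one_pow, div_one] at h
  rw [stdExp, withDensity_apply _ MeasurableSet.univ, Measure.restrict_univ,
    ← ofReal_integral_eq_lintegral_ofReal h.1 (ae_of_all _ fun _ => (Real.exp_pos _).le), h.2]
  simp

lemma isProbabilityMeasure_gpd {ξ β : ℝ} (hξ : -1 < ξ) (hβ : 0 < β) :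
    IsProbabilityMeasure (gpd ξ β) := by
  rw [gpd_eq_map hξ hβ]
  exact Measure.isProbabilityMeasure_map (by fun_prop)

lemma ae_gpd_pos {ξ β : ℝ} (hξ : -1 < ξ) (hβ : 0 < β) :
    ∀ᵐ x ∂(gpd ξ β), 0 < x ∧ 0 < 1 + ξ * (x / β) := by
  rw [gpd_eq_map hξ hβ, ae_map_iff (by fun_prop) (measurableSet_gpdSupport ξ β)]
  have : ∀ᵐ e ∂stdExp, e ∈ Set.Ioi (0 : ℝ) :=
    (withDensity_absolutelyContinuous _ _).ae_le (ae_restrict_mem measurableSet_Ioi)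
  filter_upwards [this] with e he
  exact (image_gpdExpTransform hβ).subset ⟨e, he, rfl⟩

lemma ae_stdExp_pos : ∀ᵐ e ∂stdExp, 0 < e :=
  (withDensity_absolutelyContinuous _ _).ae_le (ae_restrict_mem measurableSet_Ioi)

/-- Moments of functions which are polynomials in the underlying exponential variable `e` and in
`exp (-ξ e)`. -/
lemma integral_gpd_of_eq {ξ β : ℝ} (hξ : -(1 / 2) < ξ) (hβ : 0 < β) {f : ℝ → ℝ}
    (hf : Measurable f) (a₀ a₁ a₂ a₃ a₄ b₀ b₁ c : ℝ)
    (h : ∀ e, 0 < e → f (gpdExpTransform ξ β e) = a₀ + a₁ * e + a₂ * e ^ 2 + a₃ * e ^ 3 +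
      a₄ * e ^ 4 + (b₀ + b₁ * e) * Real.exp (-(ξ * e)) + c * Real.exp (-(ξ * e)) ^ 2) :
    Integrable f (gpd ξ β) ∧ ∫ x, f x ∂(gpd ξ β) = a₀ + a₁ + 2 * a₂ + 6 * a₃ + 24 * a₄ +
      b₀ / (1 + ξ) + b₁ / (1 + ξ) ^ 2 + c / (1 + 2 * ξ) := by
  have hadd : ∀ {f g : ℝ → ℝ} {u v : ℝ}, (Integrable f stdExp ∧ ∫ e, f e ∂stdExp = u) →
      (Integrable g stdExp ∧ ∫ e, g e ∂stdExp = v) →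
      (Integrable (fun e => f e + g e) stdExp ∧ ∫ e, (f e + g e) ∂stdExp = u + v) :=
    fun hf hg => ⟨hf.1.add hg.1, by rw [integral_add hf.1 hg.1, hf.2, hg.2]⟩
  have m0 : (0 : ℝ) < 1 + 0 := by norm_num
  have m1 : (0 : ℝ) < 1 + ξ := by linarith
  -- This is where `ξ > -1/2` is essential: `exp (-ξ e)` must be square integrable.
  have m2 : (0 : ℝ) < 1 + 2 * ξ := by linarith
  have key := hadd (hadd (hadd (hadd (hadd (hadd (hadd (stdExp_moment m0 0 a₀)
    (stdExp_moment m0 1 a₁)) (stdExp_moment m0 2 a₂)) (stdExp_moment m0 3 a₃))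
    (stdExp_moment m0 4 a₄)) (stdExp_moment m1 0 b₀)) (stdExp_moment m1 1 b₁))
    (stdExp_moment m2 0 c)
  have hcongr : ∀ {g : ℝ → ℝ} {v : ℝ}, (Integrable g stdExp ∧ ∫ e, g e ∂stdExp = v) →
      (∀ e, 0 < e → g e = f (gpdExpTransform ξ β e)) →
      Integrable f (gpd ξ β) ∧ ∫ x, f x ∂(gpd ξ β) = v := by
    intro g v hg hgf
    have hae : g =ᵐ[stdExp] fun e => f (gpdExpTransform ξ β e) := by
      filter_upwards [ae_stdExp_pos] with e he using hgf e he
    rw [gpd_eq_map (by linarith) hβ, integrable_map_measure hf.aestronglyMeasurable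
      (by fun_prop), integral_map (by fun_prop) hf.aestronglyMeasurable]
    exact ⟨hg.1.congr hae, (integral_congr_ae hae).symm.trans hg.2⟩
  obtain ⟨hint, hval⟩ := hcongr key fun e he => by
    rw [h e he, ← Real.exp_nat_mul,
      show ((2 : ℕ) : ℝ) * -(ξ * e) = -(2 * ξ * e) by push_cast; ring]
    simp
    ring
  refine ⟨hint, hval.trans ?_⟩
  norm_num [Nat.factorial]
  ring

/-! ### Moments of the scores -/

section Moments

variable {ξ β : ℝ}

lemma shape_div_mul (ξ β x : ℝ) : ξ / β * x = ξ * (x / β) := by ring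

lemma one_add_div_mul_pos_iff {ξ β x : ℝ} : 0 < 1 + ξ / β * x ↔ 0 < 1 + ξ * (x / β) := by
  rw [shape_div_mul]

lemma hazard_gpdExpTransform (hβ : 0 < β) {e : ℝ} (he : 0 < e) :
    hazard (ξ / β) (gpdExpTransform ξ β e) = β * e := by
  by_cases h : ξ = 0
  · simp [h, hazard_zero_left, gpdExpTransform]
  · have h1 := one_add_mul_gpdExpTransform (ξ := ξ) hβ e
    have h2 := mul_hazard (τ := ξ / β) (gpdExpTransform_pos (ξ := ξ) hβ he).le
      (by rw [one_add_div_mul_pos_iff, h1]; positivity)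
    rw [shape_div_mul ξ β (gpdExpTransform ξ β e), h1, Real.log_exp] at h2
    field_simp at h2
    linarith

lemma one_add_div_mul_gpdExpTransform (hβ : 0 < β) (e : ℝ) :
    1 + ξ / β * gpdExpTransform ξ β e = Real.exp (ξ * e) := by
  rw [shape_div_mul, one_add_mul_gpdExpTransform hβ]

lemma one_add_div_mul_gpdExpTransform_pos (hβ : 0 < β) (e : ℝ) :
    0 < 1 + ξ / β * gpdExpTransform ξ β e := by
  rw [one_add_div_mul_gpdExpTransform hβ]; positivity

lemma gpdExpTransform_div (hβ : 0 < β) (h : ξ ≠ 0) (e : ℝ) :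
    gpdExpTransform ξ β e / (1 + ξ / β * gpdExpTransform ξ β e) =
      β * ((1 - Real.exp (-(ξ * e))) / ξ) := by
  rw [one_add_div_mul_gpdExpTransform hβ, Real.exp_neg]
  have := (Real.exp_pos (ξ * e)).ne'
  simp only [gpdExpTransform, h, if_false]
  field_simp

lemma hazardDeriv_gpdExpTransform (hβ : 0 < β) (h : ξ ≠ 0) {e : ℝ} (he : 0 < e) :
    hazardDeriv (ξ / β) (gpdExpTransform ξ β e) =
      β ^ 2 * ((1 - Real.exp (-(ξ * e))) / ξ ^ 2 - e / ξ) := by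
  have h1 := hazard_add_mul_hazardDeriv (gpdExpTransform_pos (ξ := ξ) hβ he).le
    (one_add_div_mul_gpdExpTransform_pos hβ e)
  rw [gpdExpTransform_div hβ h, hazard_gpdExpTransform hβ he] at h1
  field_simp at h1 ⊢
  linarith

lemma hazardRem_gpdExpTransform (hβ : 0 < β) (h : ξ ≠ 0) {e : ℝ} (he : 0 < e) :
    hazardRem (ξ / β) 0 (gpdExpTransform ξ β e) =
      -(β ^ 3 / (2 * ξ) * ((1 - Real.exp (-(ξ * e))) ^ 2 / ξ ^ 2 +
        2 * ((1 - Real.exp (-(ξ * e))) / ξ ^ 2 - e / ξ))) := by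
  have h1 := sq_add_hazardDeriv_add_hazardRem (gpdExpTransform_pos (ξ := ξ) hβ he).le
    (one_add_div_mul_gpdExpTransform_pos hβ e)
  rw [gpdExpTransform_div hβ h, hazardDeriv_gpdExpTransform hβ h he] at h1
  field_simp at h1 ⊢
  linarith

lemma integral_hazard (hξ : -(1 / 2) < ξ) (hβ : 0 < β) :
    Integrable (hazard (ξ / β)) (gpd ξ β) ∧ ∫ x, hazard (ξ / β) x ∂(gpd ξ β) = β := by
  have := integral_gpd_of_eq hξ hβ (measurable_hazard (ξ / β)) 0 β 0 0 0 0 0 0 fun e he => by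
    rw [hazard_gpdExpTransform hβ he]; ring
  simpa using this

lemma integral_hazardDeriv (hξ : -(1 / 2) < ξ) (hβ : 0 < β) :
    Integrable (hazardDeriv (ξ / β)) (gpd ξ β) ∧
      ∫ x, hazardDeriv (ξ / β) x ∂(gpd ξ β) = -(β ^ 2 / (1 + ξ)) := by
  by_cases h : ξ = 0
  · have := integral_gpd_of_eq hξ hβ (measurable_hazardDeriv (ξ / β)) 0 0 (-(β ^ 2 / 2))
      0 0 0 0 0 fun e he => by
        simp only [h, zero_div, hazardDeriv_zero_left, gpdExpTransform, if_true]; ring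
    refine ⟨this.1, this.2.trans ?_⟩
    simp [h]; ring
  · have := integral_gpd_of_eq hξ hβ (measurable_hazardDeriv (ξ / β)) (β ^ 2 / ξ ^ 2)
      (-(β ^ 2 / ξ)) 0 0 0 (-(β ^ 2 / ξ ^ 2)) 0 0 fun e he => by
        rw [hazardDeriv_gpdExpTransform hβ h he]; ring
    refine ⟨this.1, this.2.trans ?_⟩
    have : 1 + ξ ≠ 0 := by linarith
    field_simp
    ring

lemma integral_hazardRem (hξ : -(1 / 2) < ξ) (hβ : 0 < β) :
    Integrable (hazardRem (ξ / β) 0) (gpd ξ β) ∧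
      ∫ x, hazardRem (ξ / β) 0 x ∂(gpd ξ β) = 2 * β ^ 3 / ((1 + ξ) * (1 + 2 * ξ)) := by
  by_cases h : ξ = 0
  · have := integral_gpd_of_eq hξ hβ (measurable_hazardRem (ξ / β) 0) 0 0 0 (β ^ 3 / 3)
      0 0 0 0 fun e he => by
        simp only [h, zero_div, hazardRem_zero_left, gpdExpTransform, if_true]; ring
    refine ⟨this.1, this.2.trans ?_⟩
    simp [h]; ring
  · have := integral_gpd_of_eq hξ hβ (measurable_hazardRem (ξ / β) 0)
      (-(β ^ 3 / (2 * ξ)) * (3 / ξ ^ 2)) (β ^ 3 / ξ ^ 2) 0 0 0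
      (-(β ^ 3 / (2 * ξ)) * (-4 / ξ ^ 2)) 0 (-(β ^ 3 / (2 * ξ)) * (1 / ξ ^ 2)) fun e he => by
        rw [hazardRem_gpdExpTransform hβ h he]; field_simp; ring
    refine ⟨this.1, this.2.trans ?_⟩
    have : 1 + ξ ≠ 0 := by linarith
    have : 1 + 2 * ξ ≠ 0 := by linarith
    field_simp
    ring

/-- Needed to know that the largest of the `x / (1 + τ x)` in a sample of size `n` is `o(√n)`. -/
lemma integrable_div_one_add_sq (hξ : -(1 / 2) < ξ) (hβ : 0 < β) :
    Integrable (fun x => (x / (1 + ξ / β * x)) ^ 2) (gpd ξ β) := by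
  by_cases h : ξ = 0
  · exact (integral_gpd_of_eq hξ hβ (by fun_prop) 0 0 (β ^ 2) 0 0 0 0 0 fun e he => by
      simp only [h, zero_div, gpdExpTransform, if_true]; simp; ring).1
  · exact (integral_gpd_of_eq hξ hβ (by fun_prop) (β ^ 2 / ξ ^ 2) 0 0 0 0 (-2 * β ^ 2 / ξ ^ 2) 0
      (β ^ 2 / ξ ^ 2) fun e he => by
        rw [gpdExpTransform_div hβ h]; ring).1

/-- The score of the `τ = ξ / β` coordinate. -/
noncomputable def scoreTau (τ σ x : ℝ) : ℝ := -hazard τ x - (σ + τ) * hazardDeriv τ x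

/-- The score of the `σ = 1 / β` coordinate. -/
noncomputable def scoreSigma (τ σ x : ℝ) : ℝ := σ⁻¹ - hazard τ x

@[fun_prop] lemma measurable_gpdScore (ξ β : ℝ) (i : Fin 2) :
    Measurable fun x => gpdScore ξ β x i := by
  fin_cases i
  · by_cases h : ξ = 0
    · simp only [gpdScore, h]; simp; fun_prop
    · simp only [gpdScore, h]; simp; fun_prop
  · simp only [gpdScore]; simp; fun_prop

/-- The chain rule for `(ξ, β) ↦ (ξ / β, 1 / β)`: `∂_ξ = β⁻¹ ∂_τ` and `∂_β = -β⁻² (∂_σ + ξ ∂_τ)`. -/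
lemma gpdScore_eq (hβ : 0 < β) {x : ℝ} (hx : 0 ≤ x) (hx' : 0 < 1 + ξ * (x / β)) :
    gpdScore ξ β x 0 = β⁻¹ * scoreTau (ξ / β) β⁻¹ x ∧
      gpdScore ξ β x 1 =
        -(β⁻¹) ^ 2 * (scoreSigma (ξ / β) β⁻¹ x + ξ * scoreTau (ξ / β) β⁻¹ x) := by
  have h' := one_add_div_mul_pos_iff.2 hx'
  have h1 := hazard_add_mul_hazardDeriv hx h'
  have h3 : x / (1 + ξ / β * x) = β * (x / β / (1 + ξ * (x / β))) := by
    rw [shape_div_mul]; field_simp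
  rw [h3] at h1
  have h4 : scoreSigma (ξ / β) β⁻¹ x + ξ * scoreTau (ξ / β) β⁻¹ x =
      β - (1 + ξ) * (hazard (ξ / β) x + ξ / β * hazardDeriv (ξ / β) x) := by
    unfold scoreSigma scoreTau
    field_simp
    ring
  constructor
  · by_cases h : ξ = 0
    · subst h
      simp [gpdScore, scoreTau, hazard_zero_left, hazardDeriv_zero_left]
      field_simp
      ring
    · have h2 := mul_hazard hx h'
      rw [shape_div_mul ξ β x] at h2
      have h5 : hazardDeriv (ξ / β) x =
          β / ξ * (β * (x / β / (1 + ξ * (x / β))) - hazard (ξ / β) x) := by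
        rw [← h1]; field_simp; ring
      have h6 : hazard (ξ / β) x = β / ξ * Real.log (1 + ξ * (x / β)) := by
        rw [← h2]; field_simp
      simp only [gpdScore, h, if_false, Matrix.cons_val_zero, scoreTau]
      rw [h5, h6]
      generalize x / β / (1 + ξ * (x / β)) = w
      generalize Real.log (1 + ξ * (x / β)) = L
      field_simp
      ring
  · rw [h4, h1]
    simp only [gpdScore, Matrix.cons_val_one]
    simp
    field_simp
    ring

lemma gpdScore_gpdExpTransform_of_ne (hβ : 0 < β) (h : ξ ≠ 0) (e : ℝ) :
    gpdScore ξ β (gpdExpTransform ξ β e) 0 =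
        e / ξ - (ξ + 1) / ξ ^ 2 * (1 - Real.exp (-(ξ * e))) ∧
      gpdScore ξ β (gpdExpTransform ξ β e) 1 =
        -(1 / β) + (ξ + 1) / β * ((1 - Real.exp (-(ξ * e))) / ξ) := by
  have h1 : gpdExpTransform ξ β e / β / (1 + ξ * (gpdExpTransform ξ β e / β)) =
      (1 - Real.exp (-(ξ * e))) / ξ := by
    have := gpdExpTransform_div hβ h e
    rw [shape_div_mul] at this
    rw [div_right_comm, this]; field_simp
  simp only [gpdScore, h, if_false, Matrix.cons_val_zero, Matrix.cons_val_one]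
  rw [h1, one_add_mul_gpdExpTransform hβ, Real.log_exp]
  constructor
  · field_simp
  · trivial

lemma gpdScore_gpdExpTransform_zero (hβ : 0 < β) (e : ℝ) :
    gpdScore 0 β (gpdExpTransform 0 β e) 0 = e ^ 2 / 2 - e ∧
      gpdScore 0 β (gpdExpTransform 0 β e) 1 = -(1 / β) + 1 / β * e := by
  simp [gpdScore, gpdExpTransform, hβ.ne']

lemma integral_gpdScore (hξ : -(1 / 2) < ξ) (hβ : 0 < β) (i : Fin 2) :
    Integrable (fun x => gpdScore ξ β x i) (gpd ξ β) ∧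
      ∫ x, gpdScore ξ β x i ∂(gpd ξ β) = 0 := by
  have hξ1 : 1 + ξ ≠ 0 := by linarith
  by_cases h : ξ = 0
  · subst h
    fin_cases i
    · have := integral_gpd_of_eq hξ hβ (measurable_gpdScore 0 β 0) 0 (-1) (1 / 2) 0 0 0 0 0
        fun e he => by rw [(gpdScore_gpdExpTransform_zero hβ e).1]; ring
      refine ⟨this.1, this.2.trans (by norm_num)⟩
    · have := integral_gpd_of_eq hξ hβ (measurable_gpdScore 0 β 1) (-(1 / β)) (1 / β) 0 0 0 0 0 0
        fun e he => by rw [(gpdScore_gpdExpTransform_zero hβ e).2]; ring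
      refine ⟨this.1, this.2.trans (by simp)⟩
  · fin_cases i
    · have := integral_gpd_of_eq hξ hβ (measurable_gpdScore ξ β 0) (-((ξ + 1) / ξ ^ 2)) (1 / ξ) 0
        0 0 ((ξ + 1) / ξ ^ 2) 0 0
        fun e he => by rw [(gpdScore_gpdExpTransform_of_ne hβ h e).1]; ring
      refine ⟨this.1, this.2.trans ?_⟩
      field_simp
      ring
    · have := integral_gpd_of_eq hξ hβ (measurable_gpdScore ξ β 1)
        (-(1 / β) + (ξ + 1) / β / ξ) 0 0 0 0 (-((ξ + 1) / β / ξ)) 0 0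
        fun e he => by rw [(gpdScore_gpdExpTransform_of_ne hβ h e).2]; ring
      refine ⟨this.1, this.2.trans ?_⟩
      field_simp
      ring

/-- The coefficient lists below are those of the products of the scores, expanded in `e` and `exp
(-ξ e)`. At `ξ = 0` these degenerate to polynomials in `e`, hence the separate case. -/
lemma integral_gpdScore_mul (hξ : -(1 / 2) < ξ) (hβ : 0 < β) (i j : Fin 2) :
    Integrable (fun x => gpdScore ξ β x i * gpdScore ξ β x j) (gpd ξ β) ∧
      ∫ x, gpdScore ξ β x i * gpdScore ξ β x j ∂(gpd ξ β) =
        ((1 + ξ) * (1 + 2 * ξ))⁻¹ * (!![2, β⁻¹; β⁻¹, (1 + ξ) / β ^ 2] : Matrix _ _ ℝ) i j := by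
  have hξ1 : 1 + ξ ≠ 0 := by linarith
  have hξ2 : 1 + 2 * ξ ≠ 0 := by linarith
  have h01 : Integrable (fun x => gpdScore ξ β x 0 * gpdScore ξ β x 1) (gpd ξ β) ∧
      ∫ x, gpdScore ξ β x 0 * gpdScore ξ β x 1 ∂(gpd ξ β) =
        ((1 + ξ) * (1 + 2 * ξ))⁻¹ * β⁻¹ := by
    by_cases h : ξ = 0
    · subst h
      have := integral_gpd_of_eq hξ hβ
        ((measurable_gpdScore 0 β 0).mul (measurable_gpdScore 0 β 1))
        0 (1 / β) (-(3 / 2) / β) (1 / 2 / β) 0 0 0 0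
        fun e he => by
          simp only [Pi.mul_apply, (gpdScore_gpdExpTransform_zero hβ e).1,
            (gpdScore_gpdExpTransform_zero hβ e).2]
          ring
      refine ⟨this.1, this.2.trans ?_⟩
      norm_num
      ring
    · have := integral_gpd_of_eq hξ hβ
        ((measurable_gpdScore ξ β 0).mul (measurable_gpdScore ξ β 1))
        ((ξ + 1) / ξ ^ 2 / β - (ξ + 1) ^ 2 / ξ ^ 3 / β) (-(1 / (ξ * β)) + (ξ + 1) / ξ ^ 2 / β)
        0 0 0 (-((ξ + 1) / ξ ^ 2 / β) + 2 * (ξ + 1) ^ 2 / ξ ^ 3 / β) (-((ξ + 1) / ξ ^ 2 / β))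
        (-((ξ + 1) ^ 2 / ξ ^ 3 / β))
        fun e he => by
          simp only [Pi.mul_apply, (gpdScore_gpdExpTransform_of_ne hβ h e).1,
            (gpdScore_gpdExpTransform_of_ne hβ h e).2]
          field_simp
          ring
      refine ⟨this.1, this.2.trans ?_⟩
      have hξ3 : 1 + ξ * 2 ≠ 0 := by linarith
      have hξ4 : ξ * 2 + 1 ≠ 0 := by linarith
      have hξ5 : 2 * ξ + 1 ≠ 0 := by linarith
      field_simp
      ring
  have h00 : Integrable (fun x => gpdScore ξ β x 0 * gpdScore ξ β x 0) (gpd ξ β) ∧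
      ∫ x, gpdScore ξ β x 0 * gpdScore ξ β x 0 ∂(gpd ξ β) =
        ((1 + ξ) * (1 + 2 * ξ))⁻¹ * 2 := by
    by_cases h : ξ = 0
    · subst h
      have := integral_gpd_of_eq hξ hβ
        ((measurable_gpdScore 0 β 0).mul (measurable_gpdScore 0 β 0))
        0 0 1 (-1) (1 / 4) 0 0 0
        fun e he => by
          simp only [Pi.mul_apply, (gpdScore_gpdExpTransform_zero hβ e).1]
          ring
      refine ⟨this.1, this.2.trans ?_⟩
      norm_num
    · have := integral_gpd_of_eq hξ hβ
        ((measurable_gpdScore ξ β 0).mul (measurable_gpdScore ξ β 0))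
        ((ξ + 1) ^ 2 / ξ ^ 4) (-(2 * (ξ + 1) / ξ ^ 3)) (1 / ξ ^ 2)
        0 0 (-(2 * (ξ + 1) ^ 2 / ξ ^ 4)) (2 * (ξ + 1) / ξ ^ 3) ((ξ + 1) ^ 2 / ξ ^ 4)
        fun e he => by
          simp only [Pi.mul_apply, (gpdScore_gpdExpTransform_of_ne hβ h e).1]
          field_simp
          ring
      refine ⟨this.1, this.2.trans ?_⟩
      have hξ3 : 1 + ξ * 2 ≠ 0 := by linarith
      have hξ4 : ξ * 2 + 1 ≠ 0 := by linarith
      have hξ5 : 2 * ξ + 1 ≠ 0 := by linarith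
      field_simp
      ring
  have h11 : Integrable (fun x => gpdScore ξ β x 1 * gpdScore ξ β x 1) (gpd ξ β) ∧
      ∫ x, gpdScore ξ β x 1 * gpdScore ξ β x 1 ∂(gpd ξ β) =
        ((1 + ξ) * (1 + 2 * ξ))⁻¹ * ((1 + ξ) / β ^ 2) := by
    by_cases h : ξ = 0
    · subst h
      have := integral_gpd_of_eq hξ hβ
        ((measurable_gpdScore 0 β 1).mul (measurable_gpdScore 0 β 1))
        (1 / β ^ 2) (-2 / β ^ 2) (1 / β ^ 2) 0 0 0 0 0
        fun e he => by
          simp only [Pi.mul_apply, (gpdScore_gpdExpTransform_zero hβ e).2]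
          ring
      refine ⟨this.1, this.2.trans ?_⟩
      norm_num
      ring
    · have := integral_gpd_of_eq hξ hβ
        ((measurable_gpdScore ξ β 1).mul (measurable_gpdScore ξ β 1))
        (1 / (β ^ 2 * ξ ^ 2)) 0 0 0 0 (-(2 * (ξ + 1) / (β ^ 2 * ξ ^ 2))) 0
        ((ξ + 1) ^ 2 / (β ^ 2 * ξ ^ 2))
        fun e he => by
          simp only [Pi.mul_apply, (gpdScore_gpdExpTransform_of_ne hβ h e).2]
          field_simp
          ring
      refine ⟨this.1, this.2.trans ?_⟩
      have hξ3 : 1 + ξ * 2 ≠ 0 := by linarith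
      have hξ4 : ξ * 2 + 1 ≠ 0 := by linarith
      have hξ5 : 2 * ξ + 1 ≠ 0 := by linarith
      field_simp
      ring
  have h10 : Integrable (fun x => gpdScore ξ β x 1 * gpdScore ξ β x 0) (gpd ξ β) ∧
      ∫ x, gpdScore ξ β x 1 * gpdScore ξ β x 0 ∂(gpd ξ β) =
        ((1 + ξ) * (1 + 2 * ξ))⁻¹ * β⁻¹ := by
    simpa only [mul_comm] using h01
  fin_cases i <;> fin_cases j
  exacts [h00, h01, h10, h11]

lemma fisherInfo_eq (hξ : -(1 / 2) < ξ) (hβ : 0 < β) :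
    fisherInfo ξ β = ((1 + ξ) * (1 + 2 * ξ))⁻¹ • !![2, β⁻¹; β⁻¹, (1 + ξ) / β ^ 2] := by
  ext i j
  exact (integral_gpdScore_mul hξ hβ i j).2

lemma fisherInfo_mul (hξ : -(1 / 2) < ξ) (hβ : 0 < β) :
    fisherInfo ξ β * ((1 + ξ) • !![ξ + 1, -β; -β, 2 * β ^ 2]) = 1 := by
  have hξ1 : 1 + ξ ≠ 0 := by linarith
  have hξ2 : 1 + 2 * ξ ≠ 0 := by linarith
  rw [fisherInfo_eq hξ hβ]
  ext i j
  fin_cases i <;> fin_cases j <;> simp [Matrix.mul_apply, Fin.sum_univ_two] <;> field_simp <;> ring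

lemma isUnit_det_fisherInfo (hξ : -(1 / 2) < ξ) (hβ : 0 < β) : IsUnit (fisherInfo ξ β).det :=
  Matrix.isUnit_det_of_right_inverse (fisherInfo_mul hξ hβ)

lemma fisherInfo_inv (hξ : -(1 / 2) < ξ) (hβ : 0 < β) :
    (fisherInfo ξ β)⁻¹ = (1 + ξ) • !![ξ + 1, -β; -β, 2 * β ^ 2] :=
  Matrix.inv_eq_right_inv (fisherInfo_mul hξ hβ)

lemma mleIF_apply (hξ : -(1 / 2) < ξ) (hβ : 0 < β) (x : ℝ) :
    mleIF ξ β x 0 = (1 + ξ) * ((ξ + 1) * gpdScore ξ β x 0 - β * gpdScore ξ β x 1) ∧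
      mleIF ξ β x 1 = (1 + ξ) * (-β * gpdScore ξ β x 0 + 2 * β ^ 2 * gpdScore ξ β x 1) := by
  simp only [mleIF, fisherInfo_inv hξ hβ, Matrix.mulVec, dotProduct, Fin.sum_univ_two]
  constructor <;> simp <;> ring

/-- The influence function in terms of the scores in the coordinates `(ξ / β, 1 / β)`. -/
lemma mleIF_eq_score (hξ : -(1 / 2) < ξ) (hβ : 0 < β) {x : ℝ} (hx : 0 ≤ x)
    (hx' : 0 < 1 + ξ * (x / β)) :
    mleIF ξ β x 0 = (1 + ξ) / β *
        ((1 + 2 * ξ) * scoreTau (ξ / β) β⁻¹ x + scoreSigma (ξ / β) β⁻¹ x) ∧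
      mleIF ξ β x 1 =
        -((1 + ξ) * ((1 + 2 * ξ) * scoreTau (ξ / β) β⁻¹ x + 2 * scoreSigma (ξ / β) β⁻¹ x)) := by
  rw [(mleIF_apply hξ hβ x).1, (mleIF_apply hξ hβ x).2, (gpdScore_eq hβ hx hx').1,
    (gpdScore_eq hβ hx hx').2]
  constructor <;> field_simp <;> ring

lemma mleIF_eq_gpdPsiTilde (hξ : -(1 / 2) < ξ) (hβ : 0 < β) (h : ξ ≠ 0) {x : ℝ}
    (hx' : 0 < 1 + ξ * (x / β)) :
    mleIF ξ β x = !₂[gpdPsiTilde ξ (gpdQuantileArg ξ (x / β)) 0,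
      β * gpdPsiTilde ξ (gpdQuantileArg ξ (x / β)) 1] := by
  have hlog : Real.log (gpdQuantileArg ξ (x / β)) = -(Real.log (1 + ξ * (x / β)) / ξ) := by
    rw [gpdQuantileArg, Real.log_rpow hx']; ring
  have hpow : gpdQuantileArg ξ (x / β) ^ ξ = (1 + ξ * (x / β))⁻¹ := by
    rw [gpdQuantileArg, ← Real.rpow_mul hx'.le, div_mul_cancel₀ _ h, Real.rpow_neg_one]
  have hw : x / β / (1 + ξ * (x / β)) = (1 - (1 + ξ * (x / β))⁻¹) / ξ := by
    rw [eq_div_iff h, eq_sub_iff_add_eq, ← one_div, div_mul_eq_mul_div, ← add_div,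
      div_eq_one_iff_eq hx'.ne']
    ring
  ext i
  fin_cases i
  · refine (mleIF_apply hξ hβ x).1.trans ?_
    simp only [gpdScore, h, if_false, gpdPsiTilde]
    simp only [Fin.zero_eta, Fin.isValue, Matrix.cons_val_zero, Matrix.cons_val_one, hw, hlog, hpow]
    generalize (1 + ξ * (x / β))⁻¹ = p
    generalize Real.log (1 + ξ * (x / β)) = L
    field_simp
    ring
  · refine (mleIF_apply hξ hβ x).2.trans ?_
    simp only [gpdScore, h, if_false, gpdPsiTilde]
    simp only [Fin.mk_one, Fin.isValue, Matrix.cons_val_zero, Matrix.cons_val_one, hw, hlog, hpow]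
    generalize (1 + ξ * (x / β))⁻¹ = p
    generalize Real.log (1 + ξ * (x / β)) = L
    field_simp
    ring

end Moments

/-! ### Growth of the influence function -/

section Growth

variable {ξ β : ℝ}

/-- Each component is affine in `log u` and `u⁻¹` with `u = 1 + ξ x / β`. For `ξ > 0` one has `u →
∞` and the logarithm dominates; for `ξ < 0` the finite endpoint has `u → 0` and `u⁻¹` dominates. -/
lemma mleIF_eq_log (hξ : -(1 / 2) < ξ) (hβ : 0 < β) (h : ξ ≠ 0) {x : ℝ}
    (hx' : 0 < 1 + ξ * (x / β)) (i : Fin 2) :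
    mleIF ξ β x i = ![1, β] i * ((ξ + 1) / ξ ^ 2) *
      (![ξ + 1, -1] i * Real.log (1 + ξ * (x / β)) +
        ![1, -1] i * ((2 * ξ + 1) * (ξ + 1)) * (1 + ξ * (x / β))⁻¹ +
        ![-(ξ ^ 2 + 3 * ξ + 1), 3 * ξ + 1] i) := by
  have hlog : Real.log (gpdQuantileArg ξ (x / β)) = -(Real.log (1 + ξ * (x / β)) / ξ) := by
    rw [gpdQuantileArg, Real.log_rpow hx']; ring
  have hpow : gpdQuantileArg ξ (x / β) ^ ξ = (1 + ξ * (x / β))⁻¹ := by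
    rw [gpdQuantileArg, ← Real.rpow_mul hx'.le, div_mul_cancel₀ _ h, Real.rpow_neg_one]
  rw [mleIF_eq_gpdPsiTilde hξ hβ h hx']
  fin_cases i
  · simp [gpdPsiTilde, hlog, hpow]
    generalize (1 + ξ * (x / β))⁻¹ = p
    generalize Real.log (1 + ξ * (x / β)) = L
    field_simp
    ring_nf
    simp
  · simp [gpdPsiTilde, hlog, hpow]
    generalize (1 + ξ * (x / β))⁻¹ = p
    generalize Real.log (1 + ξ * (x / β)) = L
    field_simp
    ring

/-- Since `log (1 + κ x) = log x + log (κ + x⁻¹)`, everything except `A a log x` converges. -/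
lemma isTheta_log_of_affine {κ A a b c : ℝ} (hκ : 0 < κ) (hA : A ≠ 0) (ha : a ≠ 0) :
    (fun x : ℝ => |A * (a * Real.log (1 + κ * x) + b * (1 + κ * x)⁻¹ + c)|) =Θ[atTop]
      Real.log := by
  have h1 : Tendsto (fun x : ℝ => A * (a * Real.log (κ + x⁻¹) + b * (1 + κ * x)⁻¹ + c)) atTop
      (𝓝 (A * (a * Real.log (κ + 0) + b * 0 + c))) := by
    have hinv : Tendsto (fun x : ℝ => x⁻¹) atTop (𝓝 0) := tendsto_inv_atTop_zero
    have hlog : Tendsto (fun x : ℝ => Real.log (κ + x⁻¹)) atTop (𝓝 (Real.log (κ + 0))) :=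
      (hinv.const_add κ).log (by simpa using hκ.ne')
    have hdiv : Tendsto (fun x : ℝ => (1 + κ * x)⁻¹) atTop (𝓝 0) :=
      tendsto_inv_atTop_zero.comp
        (tendsto_const_nhds.add_atTop (tendsto_id.const_mul_atTop hκ))
    exact (((hlog.const_mul a).add (hdiv.const_mul b)).add_const c).const_mul A
  have h2 : (fun x : ℝ => A * (a * Real.log (κ + x⁻¹) + b * (1 + κ * x)⁻¹ + c))
      =o[atTop] Real.log := by
    refine (h1.isBigO_one ℝ).trans_isLittleO ?_
    rw [isLittleO_one_left_iff]
    exact tendsto_norm_atTop_atTop.comp Real.tendsto_log_atTop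
  have h3 : (fun x : ℝ => A * a * Real.log x +
      A * (a * Real.log (κ + x⁻¹) + b * (1 + κ * x)⁻¹ + c)) =Θ[atTop] Real.log := by
    have h4 : (fun x : ℝ => A * a * Real.log x) =Θ[atTop] Real.log :=
      (isTheta_refl Real.log atTop).const_mul_left (mul_ne_zero hA ha)
    exact h4.add_isLittleO h2
  have h5 : (fun x : ℝ => A * (a * Real.log (1 + κ * x) + b * (1 + κ * x)⁻¹ + c)) =ᶠ[atTop]
      fun x : ℝ => A * a * Real.log x +
        A * (a * Real.log (κ + x⁻¹) + b * (1 + κ * x)⁻¹ + c) := by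
    filter_upwards [eventually_gt_atTop 0] with x hx
    have : 1 + κ * x = x * (κ + x⁻¹) := by field_simp; ring
    have h6 : Real.log (1 + κ * x) = Real.log x + Real.log (κ + x⁻¹) := by
      rw [this, Real.log_mul hx.ne' (by positivity)]
    rw [h6]
    ring
  have h7 := (h5.isTheta).trans h3
  exact isTheta_norm_left.2 h7

lemma not_bddAbove_image_of_tendsto {α : Type*} {l : Filter α} [l.NeBot] {g : α → ℝ}
    {f : ℝ → ℝ} {s : Set ℝ} (hs : ∀ᶠ u in l, g u ∈ s)
    (h : Tendsto (fun u => f (g u)) l atTop) : ¬ BddAbove (f '' s) := by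
  rintro ⟨M, hM⟩
  obtain ⟨u, hu, hu'⟩ := (hs.and (h.eventually_gt_atTop M)).exists
  exact absurd (hM ⟨_, hu, rfl⟩) (not_le.2 hu')

lemma mleIF_isTheta_log (hξ : 0 < ξ) (hβ : 0 < β) (i : Fin 2) :
    (fun x => |mleIF ξ β x i|) =Θ[atTop] Real.log := by
  have hξ' : -(1 / 2) < ξ := by linarith
  have hA : ![1, β] i * ((ξ + 1) / ξ ^ 2) ≠ 0 := by
    fin_cases i
    · simp; exact ⟨by linarith, hξ.ne'⟩
    · simp; exact ⟨hβ.ne', by linarith, hξ.ne'⟩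
  have ha : ![ξ + 1, -1] i ≠ 0 := by
    fin_cases i
    · simp; linarith
    · simp
  refine EventuallyEq.trans_isTheta ?_ (isTheta_log_of_affine (κ := ξ / β)
    (b := ![1, -1] i * ((2 * ξ + 1) * (ξ + 1))) (c := ![-(ξ ^ 2 + 3 * ξ + 1), 3 * ξ + 1] i)
    (by positivity) hA ha)
  filter_upwards [eventually_ge_atTop 0] with x hx
  rw [mleIF_eq_log hξ' hβ hξ.ne' (by positivity), shape_div_mul]

lemma tendsto_abs_affine_atTop {A a b c : ℝ} (hA : A ≠ 0) (hb : b ≠ 0) :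
    Tendsto (fun p : ℝ => |A * (a * Real.log p⁻¹ + b * p + c)|) atTop atTop := by
  have h1 : (fun p : ℝ => A * (a * Real.log p⁻¹ + b * p + c)) =Θ[atTop] fun p : ℝ => p := by
    have h2 : (fun p : ℝ => A * b * p) =Θ[atTop] fun p : ℝ => p :=
      (isTheta_refl (fun p : ℝ => p) atTop).const_mul_left (mul_ne_zero hA hb)
    have h3 : (fun p : ℝ => -A * a * Real.log p + A * c) =o[atTop] fun p : ℝ => p := by
      refine (Real.isLittleO_log_id_atTop.const_mul_left _).add ?_
      exact isLittleO_const_left.2 (Or.inr tendsto_norm_atTop_atTop)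
    refine EventuallyEq.trans_isTheta (.of_eq ?_)
      (h2.add_isLittleO h3)
    ext p
    simp only [Real.log_inv, Pi.add_apply]
    ring
  have := h1.tendsto_norm_atTop_iff.2 tendsto_norm_atTop_atTop
  exact this

lemma not_bddAbove_mleIF (hξ : -(1 / 2) < ξ) (hβ : 0 < β) (i : Fin 2) :
    ¬ BddAbove ((fun x => |mleIF ξ β x i|) '' {x | 0 ≤ x ∧ 0 < 1 + ξ * (x / β)}) := by
  rcases lt_trichotomy ξ 0 with h | h | h
  · have hA : ![1, β] i * ((ξ + 1) / ξ ^ 2) ≠ 0 := by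
      fin_cases i
      · simp; exact ⟨by linarith, h.ne⟩
      · simp; exact ⟨hβ.ne', by linarith, h.ne⟩
    have hb : ![1, -1] i * ((2 * ξ + 1) * (ξ + 1)) ≠ 0 := by
      fin_cases i
      · simp; exact ⟨by linarith, by linarith⟩
      · simp; exact ⟨by linarith, by linarith⟩
    have hval : ∀ p : ℝ, 1 + ξ * (β * ((p⁻¹ - 1) / ξ) / β) = p⁻¹ := by
      intro p
      have := h.ne
      field_simp
      ring
    -- The observation at which `1 + ξ x / β = p⁻¹`; as `p → ∞` it approaches the right endpoint of
    -- the support.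
    refine not_bddAbove_image_of_tendsto (l := atTop) (g := fun p : ℝ => β * ((p⁻¹ - 1) / ξ))
      ?_ ?_
    · filter_upwards [eventually_ge_atTop 1] with p hp
      refine ⟨mul_nonneg hβ.le (div_nonneg_of_nonpos ?_ h.le), ?_⟩
      · have := inv_le_one_of_one_le₀ hp
        linarith
      · rw [hval]; positivity
    · refine (tendsto_abs_affine_atTop (a := ![ξ + 1, -1] i)
        (c := ![-(ξ ^ 2 + 3 * ξ + 1), 3 * ξ + 1] i) hA hb).congr' ?_
      filter_upwards [eventually_ge_atTop 1] with p hp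
      rw [mleIF_eq_log hξ hβ h.ne (by rw [hval]; positivity), hval, inv_inv]
  · subst h
    refine not_bddAbove_image_of_tendsto (l := atTop) (g := fun z : ℝ => β * z) ?_ ?_
    · filter_upwards [eventually_ge_atTop 0] with z hz
      exact ⟨by positivity, by simp⟩
    · have hz : ∀ z, gpdScore 0 β (β * z) 0 = z ^ 2 / 2 - z ∧
          gpdScore 0 β (β * z) 1 = -(1 / β) + 1 / β * z := by
        intro z
        simp [gpdScore, hβ.ne']
      have key : ∀ A B C : ℝ, 0 < A → Tendsto (fun z : ℝ => A * z ^ 2 + B * z + C) atTop atTop := by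
        intro A B C hA
        have h1 : Tendsto (fun z : ℝ => z * (A * z + B)) atTop atTop :=
          tendsto_id.atTop_mul_atTop₀
            (tendsto_atTop_add_const_right _ _ (tendsto_id.const_mul_atTop hA))
        refine (tendsto_atTop_add_const_right _ C h1).congr fun z => by ring
      fin_cases i
      · refine tendsto_abs_atTop_atTop.comp ((key (1 / 2) (-2) 1 (by norm_num)).congr fun z => ?_)
        simp only [Fin.zero_eta]
        rw [(mleIF_apply hξ hβ _).1, (hz z).1, (hz z).2]
        field_simp
        ring
      · refine tendsto_abs_atBot_atTop.comp ((tendsto_neg_atTop_atBot.comp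
          (key (β / 2) (-3 * β) (2 * β) (by positivity))).congr fun z => ?_)
        simp only [Fin.mk_one, Function.comp]
        rw [(mleIF_apply hξ hβ _).2, (hz z).1, (hz z).2]
        field_simp
        ring
  · refine not_bddAbove_image_of_tendsto (l := atTop) (g := fun x : ℝ => x) ?_ ?_
    · filter_upwards [eventually_ge_atTop 0] with x hx
      exact ⟨hx, by positivity⟩
    · have := (mleIF_isTheta_log h hβ i).tendsto_norm_atTop_iff.2
        (tendsto_norm_atTop_atTop.comp Real.tendsto_log_atTop)
      simpa [Function.comp_def] using this

end Growth

/-! ### The likelihood in the coordinates `τ = ξ / β`, `σ = 1 / β` -/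

/-- The log-density of the generalized Pareto distribution on its support in the coordinates
`τ = ξ / β`, `σ = 1 / β`. -/
noncomputable def logDensity (τ σ x : ℝ) : ℝ := Real.log σ - (σ + τ) * hazard τ x

/-- The average of `hazard τ` over a sample. -/
noncomputable def avgHazard {n : ℕ} (x : Fin n → ℝ) (τ : ℝ) : ℝ :=
  (n : ℝ)⁻¹ * ∑ i, hazard τ (x i)

/-- The average log-likelihood in the coordinates `τ = ξ / β`, `σ = 1 / β`. -/
noncomputable def avgLogLik {n : ℕ} (x : Fin n → ℝ) (τ σ : ℝ) : ℝ :=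
  Real.log σ - (σ + τ) * avgHazard x τ

lemma gpdDensity_eq_exp {ξ β x : ℝ} (hβ : 0 < β) (hx : 0 < x) (h : 0 < 1 + ξ * (x / β)) :
    gpdDensity ξ β x = Real.exp (logDensity (ξ / β) β⁻¹ x) := by
  obtain ⟨e, he, rfl⟩ := (image_gpdExpTransform hβ).superset ⟨hx, h⟩
  have he' : 0 < e := he
  rw [gpdDensity_gpdExpTransform hβ he', logDensity, hazard_gpdExpTransform hβ he', Real.exp_sub,
    Real.exp_log (inv_pos.2 hβ), Real.exp_neg, div_eq_mul_inv]
  congr 3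
  field_simp

section Bounds

variable {n : ℕ} {x : Fin n → ℝ} {τ σ : ℝ}

lemma avgLogLik_eq (hn : 0 < n) : (n : ℝ) * avgLogLik x τ σ = ∑ i, logDensity τ σ (x i) := by
  have : (n : ℝ) ≠ 0 := by positivity
  simp only [avgLogLik, avgHazard, logDensity, Finset.sum_sub_distrib, ← Finset.mul_sum]
  simp
  field_simp

lemma gpdLikelihood_eq_exp {θ : GPDParam} (hn : 0 < n) (hβ : 0 < θ 1) (hx : ∀ i, 0 < x i)
    (h : ∀ i, 0 < 1 + θ 0 / θ 1 * x i) :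
    gpdLikelihood x θ = Real.exp (n * avgLogLik x (θ 0 / θ 1) (θ 1)⁻¹) := by
  rw [avgLogLik_eq hn, Real.exp_sum, gpdLikelihood]
  exact Finset.prod_congr rfl fun i _ =>
    gpdDensity_eq_exp hβ (hx i) (by have := h i; rwa [one_add_div_mul_pos_iff] at this)

lemma gpdLikelihood_eq_zero {θ : GPDParam} (hξ : -1 < θ 0)
    (h : ¬ ∀ i, 0 < 1 + θ 0 / θ 1 * x i) : gpdLikelihood x θ = 0 := by
  push Not at h
  obtain ⟨i, hi⟩ := h
  rw [gpdLikelihood]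
  refine Finset.prod_eq_zero (Finset.mem_univ i) (gpdDensity_eq_zero hξ ?_)
  rwa [shape_div_mul] at hi

lemma avgHazard_nonneg (hx : ∀ i, 0 ≤ x i) (h : ∀ i, 0 < 1 + τ * x i) : 0 ≤ avgHazard x τ :=
  mul_nonneg (by positivity) (Finset.sum_nonneg fun i _ => hazard_nonneg (hx i) (h i))

lemma avgHazard_pos (hn : 0 < n) (hx : ∀ i, 0 < x i) (h : ∀ i, 0 < 1 + τ * x i) :
    0 < avgHazard x τ :=
  mul_pos (by positivity) (Finset.sum_pos (fun i _ => hazard_pos (hx i) (h i))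
    ⟨⟨0, hn⟩, Finset.mem_univ _⟩)

lemma avgHazard_anti {τ' : ℝ} (hx : ∀ i, 0 ≤ x i) (h : ∀ i, 0 < 1 + τ * x i) (hle : τ ≤ τ') :
    avgHazard x τ' ≤ avgHazard x τ :=
  mul_le_mul_of_nonneg_left (Finset.sum_le_sum fun i _ => hazard_anti (hx i) (h i) hle)
    (by positivity)

/-- Maximizing over `σ` bounds the log-likelihood for large `τ`. -/
lemma avgLogLik_le_of_log {m : ℝ} (hn : 0 < n) (hx : ∀ i, 0 < x i) (hτ : 0 < τ) (hσ : 0 < σ)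
    (hm : m ≤ (n : ℝ)⁻¹ * ∑ i, Real.log (x i)) (hpos : 0 < Real.log τ + m) :
    avgLogLik x τ σ ≤ -m - 1 - Real.log (Real.log τ + m) := by
  have hadm : ∀ i, 0 < 1 + τ * x i := fun i => by have := hx i; positivity
  have hn' : (0 : ℝ) < n := by exact_mod_cast hn
  -- `τ` times the average hazard is the mean of `log (1 + τ x_i)`, which dominates the mean of `log
  -- (τ x_i)`.
  have hk : Real.log τ + m ≤ τ * avgHazard x τ := by
    have h1 : τ * avgHazard x τ = (n : ℝ)⁻¹ * ∑ i, Real.log (1 + τ * x i) := by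
      rw [avgHazard, mul_left_comm, Finset.mul_sum]
      congr 1
      exact Finset.sum_congr rfl fun i _ => mul_hazard (hx i).le (hadm i)
    have h2 : Real.log τ + (n : ℝ)⁻¹ * ∑ i, Real.log (x i) =
        (n : ℝ)⁻¹ * ∑ i, Real.log (τ * x i) := by
      rw [Finset.sum_congr rfl fun i _ => Real.log_mul hτ.ne' (hx i).ne', Finset.sum_add_distrib]
      simp
      field_simp
    have h3 : (n : ℝ)⁻¹ * ∑ i, Real.log (τ * x i) ≤ (n : ℝ)⁻¹ * ∑ i, Real.log (1 + τ * x i) := by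
      refine mul_le_mul_of_nonneg_left (Finset.sum_le_sum fun i _ => ?_) (by positivity)
      have := hx i
      exact Real.log_le_log (by positivity) (by linarith)
    linarith
  have hg : 0 < avgHazard x τ := avgHazard_pos hn hx hadm
  -- With `g` the average hazard, `log σ - σ g ≤ -1 - log g` eliminates `σ`.
  have h1 := Real.log_le_sub_one_of_pos (mul_pos hσ hg)
  rw [Real.log_mul hσ.ne' hg.ne'] at h1
  have h2 : Real.log (Real.log τ + m) ≤ Real.log τ + Real.log (avgHazard x τ) := by
    rw [← Real.log_mul hτ.ne' hg.ne']
    exact Real.log_le_log hpos hk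
  unfold avgLogLik
  nlinarith

/-- Two monotonicity facts: `σ + τ ≥ σ / 2`, and the hazard decreases in `τ`, so its value at `T`
bounds it from below. -/
lemma avgLogLik_le_of_le {T : ℝ} (hx : ∀ i, 0 ≤ x i) (h : ∀ i, 0 < 1 + τ * x i) (hτ : τ ≤ T)
    (hσ : 0 < σ) (hστ : 0 ≤ σ + 2 * τ) :
    avgLogLik x τ σ ≤ Real.log σ - σ / 2 * avgHazard x T := by
  have h1 := avgHazard_anti hx h hτ
  have h2 := avgHazard_nonneg hx fun i => one_add_mul_pos_of_le_left (hx i) hτ (h i)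
  unfold avgLogLik
  have : σ / 2 * avgHazard x T ≤ (σ + τ) * avgHazard x τ := by
    apply mul_le_mul <;> linarith
  linarith

lemma avgLogLik_le_log (hx : ∀ i, 0 ≤ x i) (h : ∀ i, 0 < 1 + τ * x i)
    (hσ : 0 < σ) (hστ : 0 ≤ σ + 2 * τ) : avgLogLik x τ σ ≤ Real.log σ := by
  have h2 := avgHazard_nonneg hx h
  have : 0 ≤ (σ + τ) * avgHazard x τ := mul_nonneg (by linarith) h2
  unfold avgLogLik
  linarith

lemma exists_forall_le_log_sub_lt {g : ℝ} (hg : 0 < g) (m : ℝ) :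
    ∃ S : ℝ, 0 < S ∧ ∀ σ, S ≤ σ → Real.log σ - σ * g < m := by
  have h : Tendsto (fun σ : ℝ => Real.log σ - σ * g) atTop atBot := by
    have h1 : (fun σ : ℝ => Real.log σ - σ * g) ~[atTop] fun σ => -(σ * g) := by
      have : (fun σ : ℝ => Real.log σ) =o[atTop] fun σ => -(σ * g) := by
        refine IsLittleO.neg_right ?_
        simp_rw [mul_comm _ g]
        exact Real.isLittleO_log_id_atTop.const_mul_right hg.ne'
      have h2 := this.add_isEquivalent (IsEquivalent.refl (u := fun σ : ℝ => -(σ * g)))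
      exact h2
    exact h1.symm.tendsto_atBot (tendsto_neg_atTop_atBot.comp (tendsto_id.atTop_mul_const hg))
  obtain ⟨S, hS⟩ := eventually_atTop.1 (h.eventually_lt_atBot m)
  exact ⟨max S 1, by positivity, fun σ hσ => hS σ ((le_max_left _ _).trans hσ)⟩

lemma exists_forall_ge_log_log_lt (k m : ℝ) :
    ∃ T : ℝ, 0 < T ∧ ∀ τ, T ≤ τ → 0 < Real.log τ + k ∧
      -k - 1 - Real.log (Real.log τ + k) < m := by
  have h1 : Tendsto (fun τ : ℝ => Real.log τ + k) atTop atTop :=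
    tendsto_atTop_add_const_right _ _ Real.tendsto_log_atTop
  have h2 := Real.tendsto_log_atTop.comp h1
  obtain ⟨T, hT⟩ := eventually_atTop.1
    ((h1.eventually_gt_atTop 0).and (h2.eventually_gt_atTop (-k - 1 - m)))
  refine ⟨max T 1, by positivity, fun τ hτ => ?_⟩
  have := hT τ ((le_max_left _ _).trans hτ)
  refine ⟨this.1, ?_⟩
  have := this.2
  simp only [Function.comp] at this
  linarith

/-- The likelihood at a fixed sample is small outside a bounded set of parameters which is
bounded away from `σ = 0`. -/
lemma exists_forall_avgLogLik_lt (hn : 0 < n) (hx : ∀ i, 0 < x i) (m : ℝ) :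
    ∃ T S s : ℝ, 0 < T ∧ 0 < S ∧ 0 < s ∧ ∀ τ σ : ℝ, 0 < σ → 0 ≤ σ + 2 * τ →
      (∀ i, 0 < 1 + τ * x i) → T ≤ τ ∨ S ≤ σ ∨ σ ≤ s → avgLogLik x τ σ < m := by
  obtain ⟨T, hT, hT'⟩ := exists_forall_ge_log_log_lt ((n : ℝ)⁻¹ * ∑ i, Real.log (x i)) m
  have hg : 0 < avgHazard x T := avgHazard_pos hn hx fun i => by have := hx i; positivity
  obtain ⟨S, hS, hS'⟩ := exists_forall_le_log_sub_lt (half_pos hg) m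
  -- `S` depends on `T`: large `σ` is treated only for `τ < T`, through the hazard at `T`. Small `σ`
  -- is handled by the bound `log σ ≤ m - 1`.
  refine ⟨T, S, Real.exp (m - 1), hT, hS, Real.exp_pos _, fun τ σ hσ hστ hadm h => ?_⟩
  by_cases hTτ : T ≤ τ
  · exact (avgLogLik_le_of_log hn hx (hT.trans_le hTτ) hσ le_rfl (hT' τ hTτ).1).trans_lt
      (hT' τ hTτ).2
  · rcases h with h | h | h
    · exact absurd h hTτ
    · have := avgLogLik_le_of_le (fun i => (hx i).le) hadm (not_le.1 hTτ).le hσ hστ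
      have := hS' σ h
      linarith
    · have := avgLogLik_le_log (fun i => (hx i).le) hadm hσ hστ
      have := Real.log_le_log hσ h
      rw [Real.log_exp] at this
      linarith

end Bounds

/-! ### Continuity of the likelihood and existence of maximizers -/

/-- When `x` is at or beyond the endpoint, `ξ` is negative and the exponent `-1 / ξ - 1` is
positive, so the power of the positive part vanishes continuously there. -/
lemma continuousAt_gpdDensity {θ : GPDParam} (hθ : θ ∈ gpdParamSet) {x : ℝ} (hx : 0 < x) :
    ContinuousAt (fun θ : GPDParam => gpdDensity (θ 0) (θ 1) x) θ := by
  have h0 : ContinuousAt (fun θ : GPDParam => θ 0) θ := Continuous.continuousAt (by fun_prop)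
  have h1 : ContinuousAt (fun θ : GPDParam => θ 1) θ := Continuous.continuousAt (by fun_prop)
  have hβ : 0 < θ 1 := hθ.2
  have hβ' : ∀ᶠ θ' in 𝓝 θ, 0 < (θ' : GPDParam) 1 := h1.eventually_const_lt hβ
  have hu : ContinuousAt (fun θ : GPDParam => 1 + θ 0 * (x / θ 1)) θ :=
    (h0.mul (continuousAt_const.div h1 hβ.ne')).const_add 1
  by_cases h : 0 < 1 + θ 0 * (x / θ 1)
  · have hτ : ContinuousAt (fun θ : GPDParam => θ 0 / θ 1) θ := h0.div h1 hβ.ne'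
    have hσ : ContinuousAt (fun θ : GPDParam => (θ 1)⁻¹) θ := h1.inv₀ hβ.ne'
    have hhaz : ContinuousAt (fun θ : GPDParam => hazard (θ 0 / θ 1) x) θ :=
      ContinuousAt.comp (f := fun θ : GPDParam => θ 0 / θ 1) (g := fun τ => hazard τ x)
        (continuousAt_hazard_left hx.le (one_add_div_mul_pos_iff.2 h)) hτ
    have hexp : ContinuousAt
        (fun θ : GPDParam => Real.exp (logDensity (θ 0 / θ 1) (θ 1)⁻¹ x)) θ :=
      ((hσ.log (inv_pos.2 hβ).ne').sub ((hσ.add hτ).mul hhaz)).rexp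
    refine hexp.congr ?_
    filter_upwards [hβ', hu.eventually_const_lt h] with θ' h1 h2
    exact (gpdDensity_eq_exp h1 hx h2).symm
  · have hξ : θ 0 < 0 := by
      by_contra h'
      push Not at h'
      exact h (by positivity)
    have hξ' : ∀ᶠ θ' in 𝓝 θ, (θ' : GPDParam) 0 < 0 := h0.eventually_lt_const hξ
    have hξ'' : ∀ᶠ θ' in 𝓝 θ, -(1 / 2) < (θ' : GPDParam) 0 := h0.eventually_const_lt hθ.1
    have hpos : ∀ {ξ : ℝ}, -(1 / 2) < ξ → ξ < 0 → 0 < -1 / ξ - 1 := by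
      intro ξ h1 h2
      have : 1 < -1 / ξ := by rw [lt_div_iff_of_neg h2]; linarith
      linarith
    have hc : ContinuousAt (fun θ : GPDParam =>
        (θ 1)⁻¹ * (max 0 (1 + θ 0 * (x / θ 1))) ^ (-1 / θ 0 - 1)) θ := by
      refine (h1.inv₀ hβ.ne').mul (ContinuousAt.rpow (continuousAt_const.max hu)
        ((continuousAt_const.div h0 hξ.ne).sub_const 1) (Or.inr (hpos hθ.1 hξ)))
    refine hc.congr ?_
    filter_upwards [hβ', hξ', hξ''] with θ' h1 h2 h3
    unfold gpdDensity
    by_cases h4 : 0 ≤ 1 + θ' 0 * (x / θ' 1)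
    · rw [if_pos ⟨hx.le, h4⟩, if_neg h2.ne, max_eq_right h4]
    · rw [if_neg (fun h => h4 h.2), max_eq_left (not_le.1 h4).le,
        Real.zero_rpow (hpos h3 h2).ne', mul_zero]

lemma continuousOn_gpdLikelihood {n : ℕ} {x : Fin n → ℝ} (hx : ∀ i, 0 < x i) :
    ContinuousOn (gpdLikelihood x) gpdParamSet := fun _ hθ =>
  (tendsto_finsetProd _ fun i _ => continuousAt_gpdDensity hθ (hx i)).mono_left
    nhdsWithin_le_nhds

lemma exists_isMaxOn_gpdLikelihood {n : ℕ} {x : Fin n → ℝ} (hx : ∀ i, 0 < x i)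
    {K : Set GPDParam} (hK : IsCompact K) (hKs : K ⊆ gpdParamSet) {θ₀ : GPDParam}
    (hθ₀ : θ₀ ∈ gpdParamSet)
    (h : ∀ θ ∈ gpdParamSet, θ ∉ K → gpdLikelihood x θ < gpdLikelihood x θ₀) :
    ∃ θ ∈ gpdParamSet, IsMaxOn (gpdLikelihood x) gpdParamSet θ := by
  have h0 : θ₀ ∈ K := by
    by_contra h0
    exact lt_irrefl _ (h θ₀ hθ₀ h0)
  obtain ⟨θ, hθ, hmax⟩ := hK.exists_isMaxOn ⟨θ₀, h0⟩ ((continuousOn_gpdLikelihood hx).mono hKs)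
  refine ⟨θ, hKs hθ, fun θ' hθ' => ?_⟩
  by_cases h1 : θ' ∈ K
  · exact hmax h1
  · exact (h θ' hθ' h1).le.trans (hmax h0)

lemma isCompact_gpdParam_box (a b c d : ℝ) :
    IsCompact {θ : GPDParam | θ 0 ∈ Set.Icc a b ∧ θ 1 ∈ Set.Icc c d} := by
  have h : IsCompact (Set.pi Set.univ fun i : Fin 2 => ![Set.Icc a b, Set.Icc c d] i) := by
    refine isCompact_univ_pi fun i => ?_
    fin_cases i
    · exact isCompact_Icc
    · exact isCompact_Icc
  have h2 := h.image (PiLp.continuous_toLp 2 (fun _ : Fin 2 => ℝ))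
  convert! h2 using 1
  ext θ
  constructor
  · rintro ⟨h1, h2⟩
    refine ⟨θ.ofLp, ?_, by simp⟩
    intro i _
    fin_cases i
    exacts [h1, h2]
  · rintro ⟨y, hy, rfl⟩
    exact ⟨hy 0 trivial, hy 1 trivial⟩

/-! ### The breakdown point of the maximum likelihood estimator -/

/-- Bernoulli's inequality for `(1 + τ x)` raised to `(σ + τ) / (τ p)`; the last hypothesis says
that this exponent is at least `1`. The bound is a tail estimate of index `p`, uniform as `τ → 0`.
-/
lemma mul_log_one_add_le_hazard {p τ σ x : ℝ} (hp : 1 ≤ p) (hτ : 0 ≤ τ) (hσ : 0 < σ)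
    (hx : 0 ≤ x) (hle : τ * (p - 1) ≤ σ) :
    p * Real.log (1 + σ * x / p) ≤ (σ + τ) * hazard τ x := by
  have hp0 : 0 < p := by linarith
  rcases hτ.eq_or_lt with rfl | hτ
  · rw [hazard_zero_left, add_zero]
    have := Real.log_le_sub_one_of_pos (show 0 < 1 + σ * x / p by positivity)
    calc p * Real.log (1 + σ * x / p) ≤ p * (σ * x / p) :=
          mul_le_mul_of_nonneg_left (by linarith) hp0.le
      _ = σ * x := by field_simp
  · have hu : 0 < 1 + τ * x := by positivity
    have h1 : 1 ≤ (σ + τ) / (τ * p) := by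
      rw [le_div_iff₀ (by positivity)]; linarith
    have h2 := one_add_mul_self_le_rpow_one_add (s := τ * x)
      (by have : 0 ≤ τ * x := by positivity
          linarith) h1
    have h3 : 1 + σ * x / p ≤ 1 + (σ + τ) / (τ * p) * (τ * x) := by
      have : (σ + τ) / (τ * p) * (τ * x) = σ * x / p + τ * x / p := by field_simp
      have : 0 ≤ τ * x / p := by positivity
      linarith
    have h4 : Real.log (1 + σ * x / p) ≤ (σ + τ) / (τ * p) * Real.log (1 + τ * x) := by
      rw [← Real.log_rpow hu]
      exact Real.log_le_log (by positivity) (h3.trans h2)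
    calc p * Real.log (1 + σ * x / p) ≤ p * ((σ + τ) / (τ * p) * Real.log (1 + τ * x)) :=
          mul_le_mul_of_nonneg_left h4 hp0.le
      _ = (σ + τ) * hazard τ x := by rw [← mul_hazard hx hu]; field_simp

lemma half_mul_le_hazard {τ σ x : ℝ} (hτ : τ ≤ 0) (hσ : 0 < σ) (hστ : 0 ≤ σ + 2 * τ)
    (hx : 0 ≤ x) (h : 0 < 1 + τ * x) : σ * x / 2 ≤ (σ + τ) * hazard τ x := by
  have h1 := hazard_anti hx h hτ
  rw [hazard_zero_left] at h1
  have := mul_le_mul (show σ / 2 ≤ σ + τ by linarith) h1 hx (by linarith)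
  linarith

/-- The tangent of the logarithm at `2 p`, chosen so that the slope `1 / 2` matches
`half_mul_le_hazard`. -/
lemma mul_log_le_half_add {p v : ℝ} (hp : 0 < p) (hv : 0 < v) :
    p * Real.log v ≤ v / 2 + p * Real.log (2 * p) - p := by
  have h := Real.log_le_sub_one_of_pos (show 0 < v / (2 * p) by positivity)
  rw [Real.log_div hv.ne' (by positivity)] at h
  have h2 := mul_le_mul_of_nonneg_left h hp.le
  have h3 : p * (v / (2 * p) - 1) = v / 2 - p := by field_simp
  rw [h3] at h2
  linarith

/-- A bound on the density by `1 / x`, uniform in the parameter; it controls the observations that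
are not moved. -/
lemma logDensity_le_neg_log {τ σ x : ℝ} (hσ : 0 < σ) (hστ : 0 ≤ σ + 2 * τ) (hx : 0 < x)
    (h : 0 < 1 + τ * x) : logDensity τ σ x ≤ -Real.log x := by
  have hlog : Real.log σ + Real.log x = Real.log (σ * x) := (Real.log_mul hσ.ne' hx.ne').symm
  have hσx : 0 < σ * x := by positivity
  unfold logDensity
  rcases le_total 0 τ with hτ | hτ
  · have h1 := mul_log_one_add_le_hazard le_rfl hτ hσ hx.le (by simpa using hσ.le)
    have h2 : Real.log (σ * x) ≤ Real.log (1 + σ * x / 1) :=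
      Real.log_le_log hσx (by rw [div_one]; linarith)
    linarith
  · have h1 := half_mul_le_hazard hτ hσ hστ hx.le h
    have h2 := mul_log_le_half_add one_pos hσx
    rw [one_mul, one_mul, mul_one] at h2
    have h3 := Real.log_two_lt_d9
    rw [← hlog] at h2
    linarith

/-- In the original coordinates the hypotheses say `ξ ≤ R` and `β ≤ R`: the density then decays in
`t` at least like a constant times `t ^ (-(1 + 1 / R))`. -/
lemma logDensity_le_of_bounded {R τ σ t : ℝ} (hR : 0 < R) (hσ : 1 / R ≤ σ)
    (hστ : 0 ≤ σ + 2 * τ) (hτ : τ ≤ R * σ) (ht : 0 < t) (h : 0 < 1 + τ * t) :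
    logDensity τ σ t ≤ (1 + 1 / R) * Real.log (2 * (1 + 1 / R)) + 1 / R * Real.log R -
      (1 + 1 / R) * Real.log t := by
  have hσ0 : 0 < σ := lt_of_lt_of_le (by positivity) hσ
  set p := 1 + 1 / R with hp
  have hp1 : 1 ≤ p := by have : 0 < 1 / R := by positivity
                         linarith
  have hp0 : 0 < p := by linarith
  have hv : 0 < σ * t := by positivity
  have hlog : Real.log (σ * t) = Real.log σ + Real.log t := Real.log_mul hσ0.ne' ht.ne'
  have hσR : -Real.log R ≤ Real.log σ := by
    rw [← Real.log_inv, ← one_div]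
    exact Real.log_le_log (by positivity) hσ
  have h1R : (p - 1) * -Real.log R ≤ (p - 1) * Real.log σ :=
    mul_le_mul_of_nonneg_left hσR (by linarith)
  have h1R' : 1 / R * Real.log R = (p - 1) * Real.log R := by rw [hp]; ring
  rw [h1R']
  unfold logDensity
  rcases le_total 0 τ with hτ0 | hτ0
  · have h1 := mul_log_one_add_le_hazard hp1 hτ0 hσ0 ht.le (by
      rw [hp, add_sub_cancel_left, mul_one_div, div_le_iff₀ hR]; linarith)
    have h2 : Real.log (σ * t) - Real.log p ≤ Real.log (1 + σ * t / p) := by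
      rw [← Real.log_div hv.ne' hp0.ne']
      exact Real.log_le_log (by positivity) (by linarith)
    have h3 : Real.log p ≤ Real.log (2 * p) := Real.log_le_log hp0 (by linarith)
    have h4 := mul_le_mul_of_nonneg_left h2 hp0.le
    have h5 := mul_le_mul_of_nonneg_left h3 hp0.le
    rw [hlog] at h4
    nlinarith
  · have h1 := half_mul_le_hazard hτ0 hσ0 hστ ht.le h
    have h2 := mul_log_le_half_add hp0 hv
    rw [hlog] at h2
    nlinarith

section Breakdown

variable {n : ℕ} {x : Fin n → ℝ}

lemma gpdParamSet_coord {θ : GPDParam} (hθ : θ ∈ gpdParamSet) :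
    0 < (θ 1)⁻¹ ∧ 0 < (θ 1)⁻¹ + 2 * (θ 0 / θ 1) := by
  have h1 : 0 < θ 1 := hθ.2
  have h0 : -(1 / 2) < θ 0 := hθ.1
  refine ⟨inv_pos.2 h1, ?_⟩
  have : (θ 1)⁻¹ + 2 * (θ 0 / θ 1) = (1 + 2 * θ 0) / θ 1 := by field_simp
  rw [this]
  exact div_pos (by linarith) h1

/-- The likelihood has a maximizer as soon as its values near the boundary `ξ = -1 / 2` are
dominated. -/
lemma exists_isMaxOn_of_shape_bound (hn : 0 < n) (hx : ∀ i, 0 < x i) {θ₀ : GPDParam}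
    (hθ₀ : θ₀ ∈ gpdParamSet) (hadm : ∀ i, 0 < 1 + θ₀ 0 / θ₀ 1 * x i)
    (h : ∀ θ ∈ gpdParamSet, θ 0 < -(1 / 4) → gpdLikelihood x θ < gpdLikelihood x θ₀) :
    ∃ θ ∈ gpdParamSet, IsMaxOn (gpdLikelihood x) gpdParamSet θ := by
  obtain ⟨T, S, s, hT, hS, hs, hb⟩ :=
    exists_forall_avgLogLik_lt hn hx (avgLogLik x (θ₀ 0 / θ₀ 1) (θ₀ 1)⁻¹)
  refine exists_isMaxOn_gpdLikelihood hx
    -- From `s < σ < S` and `τ < T` one gets `1 / S < β < 1 / s` and `ξ = τ β ≤ T / s`.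
    (isCompact_gpdParam_box (-(1 / 4)) (T / s) S⁻¹ s⁻¹) ?_ hθ₀ fun θ hθ hK => ?_
  · intro θ hθ
    exact ⟨by linarith [hθ.1.1], lt_of_lt_of_le (by positivity) hθ.2.1⟩
  · by_cases h1 : θ 0 < -(1 / 4)
    · exact h θ hθ h1
    · have hc := gpdParamSet_coord hθ
      have hβ : 0 < θ 1 := hθ.2
      rw [gpdLikelihood_eq_exp hn hθ₀.2 hx hadm]
      by_cases hadm' : ∀ i, 0 < 1 + θ 0 / θ 1 * x i
      · rw [gpdLikelihood_eq_exp hn hβ hx hadm', Real.exp_lt_exp]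
        refine mul_lt_mul_of_pos_left (hb _ _ hc.1 hc.2.le hadm' ?_) (by exact_mod_cast hn)
        by_contra hcon
        push Not at hcon h1
        refine hK ⟨⟨h1, ?_⟩, ?_, ?_⟩
        · rw [le_div_iff₀ hs]
          have h2 : θ 0 < T * θ 1 := by rw [div_lt_iff₀ hβ] at hcon; exact hcon.1
          have h3 : s * θ 1 < 1 := by
            have := hcon.2.2
            rwa [← one_div, lt_div_iff₀ hβ] at this
          rcases le_total (θ 0) 0 with h0 | h0
          · have : θ 0 * s ≤ 0 := mul_nonpos_of_nonpos_of_nonneg h0 hs.le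
            linarith
          · nlinarith
        · exact (inv_lt_of_inv_lt₀ hβ hcon.2.1).le
        · exact (lt_inv_of_lt_inv₀ hs hcon.2.2).le
      · rw [gpdLikelihood_eq_zero (by linarith [hθ.1]) hadm']
        exact Real.exp_pos _

lemma exists_forall_ge_sub_mul_log_lt (C D : ℝ) {a b : ℝ} (hab : a < b) :
    ∃ t₀ : ℝ, 1 ≤ t₀ ∧ ∀ t, t₀ ≤ t → C - b * Real.log t < D - a * Real.log t := by
  have h := (Real.tendsto_log_atTop.const_mul_atTop (sub_pos.2 hab)).eventually_gt_atTop (C - D)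
  obtain ⟨t₀, ht₀⟩ := eventually_atTop.1 h
  refine ⟨max t₀ 1, le_max_right _ _, fun t ht => ?_⟩
  have := ht₀ t ((le_max_left _ _).trans ht)
  nlinarith

/-- Moving one observation to a suitable large value makes the likelihood have a maximizer, and
makes the likelihood of every bounded parameter smaller than at some other parameter. -/
lemma exists_update_isMaxOn (hn : 2 ≤ n) (hx : ∀ i, 0 < x i) (i₀ : Fin n) {R : ℝ} (hR : 1 ≤ R) :
    ∃ t : ℝ, (∃ θ ∈ gpdParamSet,
        IsMaxOn (gpdLikelihood (Function.update x i₀ t)) gpdParamSet θ) ∧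
      ∃ θ₀ ∈ gpdParamSet, ∀ θ ∈ gpdParamSet, |θ 0| ≤ R → θ 1 ≤ R →
        gpdLikelihood (Function.update x i₀ t) θ < gpdLikelihood (Function.update x i₀ t) θ₀ := by
  have hR0 : 0 < R := by linarith
  have hn0 : 0 < n := by omega
  -- The competitor is `ξ = β = 2 R`, that is `τ = 1`, `σ = ε`; its density has tail exponent `1 +
  -- ε`, smaller than `1 + 1 / R`.
  set ε : ℝ := (2 * R)⁻¹ with hε
  have hε0 : 0 < ε := by positivity
  have hεR : ε < 1 / R := by
    rw [hε, one_div]; exact inv_strictAnti₀ hR0 (by linarith)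
  have hε1 : ε < 1 := by
    refine hεR.trans_le ?_
    rw [div_le_one hR0]; exact hR
  set A : ℝ := ∑ i ∈ Finset.univ.erase i₀, logDensity 1 ε (x i) with hA
  -- `D - (1 + ε) log t` bounds the log-likelihood of the competitor from below, and `C - (1 + 1 /
  -- R) log t` bounds that of every bounded parameter from above.
  set D : ℝ := A + Real.log ε - (1 + ε) * Real.log 2 with hD
  set C : ℝ := (∑ i ∈ Finset.univ.erase i₀, -Real.log (x i)) +
    ((1 + 1 / R) * Real.log (2 * (1 + 1 / R)) + 1 / R * Real.log R) with hC
  obtain ⟨t₁, ht₁, h₁⟩ := exists_forall_ge_sub_mul_log_lt C D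
    (show 1 + ε < 1 + 1 / R by linarith)
  -- For `ξ < -1/4` the log-likelihood is at most `n log (4 / t)`, which loses because `1 + ε < 2 ≤
  -- n`. This is where two observations are needed.
  obtain ⟨t₂, ht₂, h₂⟩ := exists_forall_ge_sub_mul_log_lt (n * Real.log 4) D
    (show 1 + ε < n by have : (2 : ℝ) ≤ n := by exact_mod_cast hn
                       linarith)
  set t := max t₁ t₂ with htdef
  have ht1 : 1 ≤ t := ht₁.trans (le_max_left _ _)
  have ht0 : 0 < t := by linarith
  set y := Function.update x i₀ t with hy
  have hyi₀ : y i₀ = t := Function.update_self _ _ _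
  have hyne : ∀ i ∈ Finset.univ.erase i₀, y i = x i := fun i hi =>
    Function.update_of_ne (Finset.ne_of_mem_erase hi) _ _
  have hypos : ∀ i, 0 < y i := by
    intro i
    by_cases h : i = i₀
    · rw [h, hyi₀]; exact ht0
    · rw [hyne i (Finset.mem_erase.2 ⟨h, Finset.mem_univ _⟩)]; exact hx i
  have hsplit : ∀ τ σ, (n : ℝ) * avgLogLik y τ σ =
      logDensity τ σ t + ∑ i ∈ Finset.univ.erase i₀, logDensity τ σ (x i) := by
    intro τ σ
    rw [avgLogLik_eq hn0, ← Finset.add_sum_erase _ _ (Finset.mem_univ i₀), hyi₀]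
    congr 1
    exact Finset.sum_congr rfl fun i hi => by rw [hyne i hi]
  set θ₀ : GPDParam := !₂[2 * R, 2 * R] with hθ₀
  have h00 : θ₀ 0 = 2 * R := rfl
  have h01 : θ₀ 1 = 2 * R := rfl
  have hτ₀ : θ₀ 0 / θ₀ 1 = 1 := by rw [h00, h01, div_self (by positivity)]
  have hσ₀ : (θ₀ 1)⁻¹ = ε := rfl
  have hθ₀mem : θ₀ ∈ gpdParamSet :=
    ⟨by rw [h00]; linarith, by rw [h01]; linarith⟩
  have hadm₀ : ∀ i, 0 < 1 + θ₀ 0 / θ₀ 1 * y i := fun i => by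
    rw [hτ₀]; have := hypos i; linarith
  have hlow : D - (1 + ε) * Real.log t ≤ n * avgLogLik y (θ₀ 0 / θ₀ 1) (θ₀ 1)⁻¹ := by
    rw [hτ₀, hσ₀, hsplit]
    have h1 : Real.log (1 + 1 * t) ≤ Real.log 2 + Real.log t := by
      rw [← Real.log_mul (by norm_num) ht0.ne']
      exact Real.log_le_log (by linarith) (by linarith)
    have h2 := mul_hazard (τ := 1) ht0.le (by linarith)
    rw [one_mul] at h2
    simp only [logDensity]
    rw [h2]
    have := mul_le_mul_of_nonneg_left h1 (show 0 ≤ ε + 1 by linarith)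
    simp only [hD, hA, logDensity]
    linarith
  refine ⟨t, exists_isMaxOn_of_shape_bound hn0 hypos hθ₀mem hadm₀ fun θ hθ hξ => ?_,
    θ₀, hθ₀mem, fun θ hθ hξ hβ => ?_⟩
  · rw [gpdLikelihood_eq_exp hn0 hθ₀mem.2 hypos hadm₀]
    by_cases hadm : ∀ i, 0 < 1 + θ 0 / θ 1 * y i
    · rw [gpdLikelihood_eq_exp hn0 hθ.2 hypos hadm, Real.exp_lt_exp]
      refine lt_of_lt_of_le ?_ hlow
      refine lt_of_le_of_lt ?_ (h₂ t (le_max_right _ _))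
      have hc := gpdParamSet_coord hθ
      have h1 := avgLogLik_le_log (fun i => (hypos i).le) hadm hc.1 hc.2.le
      have h2 := hadm i₀
      rw [hyi₀] at h2
      have hβ : 0 < θ 1 := hθ.2
      have h3 : Real.log (θ 1)⁻¹ ≤ Real.log 4 - Real.log t := by
        rw [← Real.log_div (by norm_num) ht0.ne']
        refine Real.log_le_log hc.1 ?_
        rw [shape_div_mul] at h2
        have h4 : 0 < t / θ 1 := by positivity
        -- Admissibility `1 + ξ t / β > 0` together with `ξ < -1/4`.
        have h5 : t / θ 1 < 4 := by nlinarith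
        rw [le_div_iff₀ ht0, inv_mul_eq_div]
        exact h5.le
      have h6 : (0 : ℝ) < n := by exact_mod_cast hn0
      calc (n : ℝ) * avgLogLik y (θ 0 / θ 1) (θ 1)⁻¹ ≤ n * (Real.log 4 - Real.log t) :=
            mul_le_mul_of_nonneg_left (h1.trans h3) h6.le
        _ = _ := by ring
    · rw [gpdLikelihood_eq_zero (by linarith [hθ.1]) hadm]
      exact Real.exp_pos _
  · rw [gpdLikelihood_eq_exp hn0 hθ₀mem.2 hypos hadm₀]
    by_cases hadm : ∀ i, 0 < 1 + θ 0 / θ 1 * y i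
    · rw [gpdLikelihood_eq_exp hn0 hθ.2 hypos hadm, Real.exp_lt_exp]
      refine lt_of_lt_of_le ?_ hlow
      refine lt_of_le_of_lt ?_ (h₁ t (le_max_left _ _))
      have hc := gpdParamSet_coord hθ
      have hβ0 : 0 < θ 1 := hθ.2
      rw [hsplit]
      have h2 := hadm i₀
      rw [hyi₀] at h2
      have h1 := logDensity_le_of_bounded hR0
        (by rw [one_div]; exact inv_anti₀ hβ0 hβ) hc.2.le
        (by rw [← div_eq_mul_inv]; exact div_le_div_of_nonneg_right (le_of_abs_le hξ) hβ0.le)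
        ht0 h2
      have h3 : ∑ i ∈ Finset.univ.erase i₀, logDensity (θ 0 / θ 1) (θ 1)⁻¹ (x i) ≤
          ∑ i ∈ Finset.univ.erase i₀, -Real.log (x i) := by
        refine Finset.sum_le_sum fun i hi => ?_
        have := hadm i
        rw [hyne i hi] at this
        exact logDensity_le_neg_log hc.1 hc.2.le (hx i) this
      simp only [hC]
      linarith
    · rw [gpdLikelihood_eq_zero (by linarith [hθ.1]) hadm]
      exact Real.exp_pos _

lemma abs_apply_le_norm (θ : GPDParam) (i : Fin 2) : |θ i| ≤ ‖θ‖ := PiLp.norm_apply_le θ i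

/-- A bound `M` on the norm would put the estimator among the parameters with `|ξ|, β ≤ max M 1`. On
the sample built above it is a genuine maximizer, yet all of those are beaten. -/
lemma breaksDown_one {T : GPDEstimator} (hT : IsMLE T) (hn : 2 ≤ n) (hx : ∀ i, 0 < x i) :
    BreaksDown (T.toFun n) x 1 := by
  rintro ⟨M, hM⟩
  have i₀ : Fin n := ⟨0, by omega⟩
  obtain ⟨t, hex, θ₀, hθ₀, hlt⟩ := exists_update_isMaxOn hn hx i₀ (le_max_right M 1)
  have hmax := hT n _ hex
  have hle : ‖T.toFun n (Function.update x i₀ t)‖ ≤ max M 1 :=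
    (hM ⟨_, ⟨{i₀}, Finset.card_singleton _, fun i hi => Function.update_of_ne
      (by simpa using hi) _ _⟩, rfl⟩).trans (le_max_left _ _)
  have h := hlt _ hmax.1 ((abs_apply_le_norm _ 0).trans hle)
    ((le_abs_self _).trans ((abs_apply_le_norm _ 1).trans hle))
  exact absurd (hmax.2 hθ₀) (not_le.2 h)

lemma not_breaksDown_zero (S : (Fin n → ℝ) → GPDParam) (x : Fin n → ℝ) : ¬ BreaksDown S x 0 := by
  rw [BreaksDown, not_not]
  refine ⟨‖S x‖, ?_⟩
  rintro _ ⟨z, ⟨J, hJ, hz⟩, rfl⟩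
  rw [Finset.card_eq_zero.1 hJ] at hz
  rw [show z = x from funext fun i => hz i (Finset.notMem_empty i)]

lemma BreaksDown.mono {S : (Fin n → ℝ) → GPDParam} {m k : ℕ} (h : BreaksDown S x m)
    (hmk : m ≤ k) (hk : k ≤ n) : BreaksDown S x k := by
  refine fun hb => h (hb.mono (Set.image_mono ?_))
  rintro z ⟨J, hJ, hz⟩
  obtain ⟨J', hJJ', hJ'⟩ := Finset.exists_superset_card_eq (hJ.le.trans hmk)
    (by simpa using hk)
  exact ⟨J', hJ', fun i hi => hz i fun h => hi (hJJ' h)⟩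

lemma fsbp_eq {T : GPDEstimator} (hT : IsMLE T) (hn : 2 ≤ n) (hx : ∀ i, 0 < x i) :
    fsbp (T.toFun n) x = 1 / (n : ℝ≥0∞) := by
  apply le_antisymm
  · exact (iInf₂_le 1 (breaksDown_one hT hn hx)).trans (by simp)
  · refine le_iInf₂ fun m hm => ENNReal.div_le_div_right ?_ _
    have : m ≠ 0 := by
      rintro rfl
      exact not_breaksDown_zero _ _ hm
    exact_mod_cast Nat.one_le_iff_ne_zero.2 this

lemma isGreatest_not_breaksDown {T : GPDEstimator} (hT : IsMLE T) (hn : 2 ≤ n)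
    (hx : ∀ i, 0 < x i) : IsGreatest {m : ℕ | m ≤ n ∧ ¬ BreaksDown (T.toFun n) x m} 0 := by
  refine ⟨⟨Nat.zero_le _, not_breaksDown_zero _ _⟩, fun m hm => ?_⟩
  by_contra h
  exact hm.2 ((breaksDown_one hT hn hx).mono (by omega) hm.1)

end Breakdown

/-! ### Infinite samples -/

section Sequences

variable {μ : Measure ℝ} [IsProbabilityMeasure μ]

/-- The law of an infinite sequence of independent observations. -/
noncomputable abbrev seqLaw (μ : Measure ℝ) : Measure (ℕ → ℝ) := Measure.infinitePi fun _ => μ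

/-- The sample of the first `n` observations. -/
def firstObs (n : ℕ) (ω : ℕ → ℝ) : Fin n → ℝ := fun i => ω i

@[fun_prop] lemma measurable_firstObs (n : ℕ) : Measurable (firstObs n) := by
  unfold firstObs; fun_prop

/-- Realizes the samples of all sizes on one probability space, so that almost sure statements in
`n` make sense. -/
lemma map_firstObs (n : ℕ) : (seqLaw μ).map (firstObs n) = Measure.pi fun _ : Fin n => μ := by
  rw [← Measure.infinitePi_eq_pi]
  exact Measure.map_infinitePi_infinitePi_of_inj (P := fun _ : ℕ => μ)
    (f := fun i : Fin n => (i : ℕ)) Fin.val_injective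

lemma map_eval_seqLaw (i : ℕ) : (seqLaw μ).map (fun ω => ω i) = μ :=
  Measure.infinitePi_map_eval (fun _ : ℕ => μ) i

lemma ae_seqLaw_of_ae {p : ℝ → Prop} (h : ∀ᵐ x ∂μ, p x) : ∀ᵐ ω ∂(seqLaw μ), ∀ i, p (ω i) := by
  refine ae_all_iff.2 fun i => ?_
  have : ∀ᵐ x ∂((seqLaw μ).map fun ω => ω i), p x := by rwa [map_eval_seqLaw]
  exact ae_of_ae_map (measurable_pi_apply i).aemeasurable this

variable {β' : Type*} [MeasurableSpace β'] {f : ℝ → β'}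

lemma aemeasurable_comp_eval (hf : AEMeasurable f μ) (i : ℕ) :
    AEMeasurable (fun ω : ℕ → ℝ => f (ω i)) (seqLaw μ) :=
  AEMeasurable.comp_aemeasurable (by rwa [map_eval_seqLaw]) (measurable_pi_apply i).aemeasurable

lemma iIndepFun_seqLaw (hf : AEMeasurable f μ) :
    iIndepFun (fun (i : ℕ) (ω : ℕ → ℝ) => f (ω i)) (seqLaw μ) :=
  (iIndepFun_infinitePi (P := fun _ : ℕ => μ) (X := fun _ x => x) (fun _ => measurable_id)).comp₀
    (fun _ => f) (fun i => (measurable_pi_apply i).aemeasurable) fun i => by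
      rw [map_eval_seqLaw]; exact hf

lemma map_comp_eval (hf : AEMeasurable f μ) (i : ℕ) :
    (seqLaw μ).map (fun ω => f (ω i)) = μ.map f := by
  have := AEMeasurable.map_map_of_aemeasurable (μ := seqLaw μ) (g := f) (f := fun ω => ω i)
    (by rwa [map_eval_seqLaw]) (measurable_pi_apply i).aemeasurable
  rw [map_eval_seqLaw] at this
  exact this.symm

lemma identDistrib_seqLaw (hf : AEMeasurable f μ) (i j : ℕ) :
    IdentDistrib (fun ω : ℕ → ℝ => f (ω i)) (fun ω => f (ω j)) (seqLaw μ) (seqLaw μ) :=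
  ⟨aemeasurable_comp_eval hf i, aemeasurable_comp_eval hf j, by
    rw [map_comp_eval hf, map_comp_eval hf]⟩

lemma integral_comp_eval {E : Type*} [NormedAddCommGroup E] [NormedSpace ℝ E] {f : ℝ → E}
    (hf : AEStronglyMeasurable f μ) (i : ℕ) : ∫ ω, f (ω i) ∂(seqLaw μ) = ∫ x, f x ∂μ := by
  have h : AEStronglyMeasurable f ((seqLaw μ).map fun ω => ω i) := by rwa [map_eval_seqLaw]
  rw [← integral_map (φ := fun ω : ℕ → ℝ => ω i) (measurable_pi_apply i).aemeasurable h, map_eval_seqLaw]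

lemma memLp_comp_eval {E : Type*} [NormedAddCommGroup E] {f : ℝ → E} {p : ℝ≥0∞}
    (hf : MemLp f p μ) (i : ℕ) : MemLp (fun ω : ℕ → ℝ => f (ω i)) p (seqLaw μ) := by
  have h : MemLp f p ((seqLaw μ).map fun ω => ω i) := by rwa [map_eval_seqLaw]
  exact h.comp_of_map (measurable_pi_apply i).aemeasurable

/-- The strong law of large numbers for sample means. -/
lemma ae_tendsto_mean {f : ℝ → ℝ} (hf : Integrable f μ) :
    ∀ᵐ ω ∂(seqLaw μ), Tendsto (fun n : ℕ => (n : ℝ)⁻¹ * ∑ i, f (firstObs n ω i)) atTop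
      (𝓝 (∫ x, f x ∂μ)) := by
  have h := strong_law_ae (μ := seqLaw μ) (fun i ω => f (ω i))
    (memLp_one_iff_integrable.1 (memLp_comp_eval (memLp_one_iff_integrable.2 hf) 0))
    (fun i j hij => (iIndepFun_seqLaw hf.1.aemeasurable).indepFun hij)
    (fun i => identDistrib_seqLaw hf.1.aemeasurable i 0)
  rw [integral_comp_eval hf.1] at h
  filter_upwards [h] with ω hω
  refine hω.congr fun n => ?_
  rw [← Fin.sum_univ_eq_sum_range (fun i => f (ω i)) n]
  rfl

/-- The largest of `n` observations of an integrable function is of smaller order than `n`. -/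
lemma ae_eventually_forall_le {f : ℝ → ℝ} (hf : Integrable f μ) :
    ∀ᵐ ω ∂(seqLaw μ), ∀ ε : ℝ, 0 < ε → ∀ᶠ n : ℕ in atTop, ∀ i, f (firstObs n ω i) ≤ ε * n := by
  filter_upwards [ae_tendsto_mean hf] with ω hω ε hε
  -- With `M_n` the mean of the first `n` values, the quotient is `M_{n+1} - M_n n / (n + 1)`.
  -- Finitely many early observations are then absorbed by taking `n` large.
  have h1 : Tendsto (fun n : ℕ => f (ω n) / (n + 1)) atTop (𝓝 0) := by
    have h2 := (hω.comp (tendsto_add_atTop_nat 1)).sub (hω.mul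
      (tendsto_natCast_div_add_atTop (1 : ℝ)))
    rw [mul_one, sub_self] at h2
    refine (h2.congr' ?_)
    filter_upwards [eventually_gt_atTop 0] with n hn
    have : (n : ℝ) ≠ 0 := by positivity
    simp only [Function.comp, Fin.sum_univ_castSucc]
    have h3 : ∀ i : Fin n, firstObs (n + 1) ω i.castSucc = firstObs n ω i := fun i => rfl
    have h4 : firstObs (n + 1) ω (Fin.last n) = ω n := rfl
    simp only [h3, h4]
    push_cast
    field_simp
    ring
  have h2 : ∀ᶠ n : ℕ in atTop, f (ω n) ≤ ε * (n + 1) := by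
    filter_upwards [h1.eventually_lt_const hε] with n hn
    rw [div_lt_iff₀ (by positivity)] at hn
    exact hn.le
  obtain ⟨N, hN⟩ := eventually_atTop.1 h2
  have h3 : ∀ k, ∀ᶠ n : ℕ in atTop, f (ω k) ≤ ε * n := fun k =>
    (tendsto_natCast_atTop_atTop.const_mul_atTop hε).eventually_ge_atTop _
  have h4 : ∀ᶠ n : ℕ in atTop, ∀ k ∈ Finset.range N, f (ω k) ≤ ε * n :=
    (Finset.range N).eventually_all.2 fun k _ => h3 k
  filter_upwards [h4] with n hn i
  by_cases h : (i : ℕ) < N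
  · exact hn i (Finset.mem_range.2 h)
  · refine (hN i (not_lt.1 h)).trans ?_
    have : ((i : ℕ) : ℝ) + 1 ≤ n := by exact_mod_cast i.isLt
    exact mul_le_mul_of_nonneg_left this hε.le

/-- Sample means of centered square integrable functions are of order `1 / √n`. -/
lemma meas_sqrt_mul_mean_ge_le {f : ℝ → ℝ} (hf : MemLp f 2 μ) (h0 : ∫ x, f x ∂μ = 0) {K : ℝ}
    (hK : 0 < K) {n : ℕ} (hn : 0 < n) :
    seqLaw μ {ω | K ≤ √n * |(n : ℝ)⁻¹ * ∑ i, f (firstObs n ω i)|} ≤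
      ENNReal.ofReal ((∫ x, f x ^ 2 ∂μ) / K ^ 2) := by
  have hn' : (0 : ℝ) < n := by exact_mod_cast hn
  set S : (ℕ → ℝ) → ℝ := ∑ i ∈ Finset.range n, fun ω => f (ω i) with hS
  have hmem : ∀ i, MemLp (fun ω : ℕ → ℝ => f (ω i)) 2 (seqLaw μ) := memLp_comp_eval hf
  have hSm : MemLp S 2 (seqLaw μ) := memLp_finsetSum' _ fun i _ => hmem i
  have hvar1 : ∀ i, variance (fun ω : ℕ → ℝ => f (ω i)) (seqLaw μ) = ∫ x, f x ^ 2 ∂μ := by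
    intro i
    rw [variance_eq_integral (hmem i).1.aemeasurable, integral_comp_eval hf.1, h0]
    simp only [sub_zero]
    exact integral_comp_eval (f := fun x => f x ^ 2) (hf.1.pow 2) i
  have hvar : variance S (seqLaw μ) = n * ∫ x, f x ^ 2 ∂μ := by
    rw [hS, IndepFun.variance_sum (fun i _ => hmem i) fun i _ j _ hij =>
      (iIndepFun_seqLaw hf.1.aemeasurable).indepFun hij, Finset.sum_congr rfl fun i _ => hvar1 i]
    simp
  have hmean : ∫ ω, S ω ∂(seqLaw μ) = 0 := by
    simp only [hS, Finset.sum_apply]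
    rw [integral_finsetSum _ fun i _ => (hmem i).integrable one_le_two]
    simp [integral_comp_eval hf.1, h0]
  have hcheb := meas_ge_le_variance_div_sq hSm (c := K * √n) (by positivity)
  rw [hmean, hvar] at hcheb
  simp only [sub_zero] at hcheb
  refine (measure_mono fun ω hω => ?_).trans (hcheb.trans (le_of_eq ?_))
  · simp only [Set.mem_ofPred_eq] at hω ⊢
    have : ∑ i, f (firstObs n ω i) = S ω := by
      rw [hS, Finset.sum_apply, ← Fin.sum_univ_eq_sum_range (fun i => f (ω i)) n]
      rfl
    rw [this, abs_mul, abs_of_pos (inv_pos.2 hn')] at hω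
    have h1 : √(n : ℝ) * √(n : ℝ) = n := Real.mul_self_sqrt hn'.le
    have h2 := mul_le_mul_of_nonneg_right hω (Real.sqrt_nonneg (n : ℝ))
    calc K * √n ≤ √n * ((n : ℝ)⁻¹ * |S ω|) * √n := h2
      _ = (√n * √n) * (n : ℝ)⁻¹ * |S ω| := by ring
      _ = |S ω| := by rw [h1, mul_inv_cancel₀ hn'.ne', one_mul]
  · rw [mul_pow, Real.sq_sqrt hn'.le]
    congr 1
    field_simp

end Sequences

/-! ### The central limit theorem in the plane -/

section CLT

variable {μ : Measure ℝ} [IsProbabilityMeasure μ]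

/-- The matrix of second moments of a plane valued function. -/
noncomputable def secondMoment (μ : Measure ℝ) (ψ : ℝ → GPDParam) : Matrix (Fin 2) (Fin 2) ℝ :=
  Matrix.of fun i j => ∫ x, ψ x i * ψ x j ∂μ

lemma integrable_mul_apply {μ : Measure ℝ} {ψ φ : ℝ → GPDParam} (hψ : MemLp ψ 2 μ) (hφ : MemLp φ 2 μ)
    (i j : Fin 2) : Integrable (fun x => ψ x i * φ x j) μ :=
  (hψ.eval_piLp i).integrable_mul (hφ.eval_piLp j)

lemma dotProduct_secondMoment_mulVec {μ : Measure ℝ} {ψ : ℝ → GPDParam} (hψ : MemLp ψ 2 μ) (t : Fin 2 → ℝ) :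
    t ⬝ᵥ (secondMoment μ ψ).mulVec t = ∫ x, (t 0 * ψ x 0 + t 1 * ψ x 1) ^ 2 ∂μ := by
  have h : ∀ i j, Integrable (fun x => ψ x i * ψ x j) μ := integrable_mul_apply hψ hψ
  have heq : (fun x => (t 0 * ψ x 0 + t 1 * ψ x 1) ^ 2) = fun x =>
      t 0 * t 0 * (ψ x 0 * ψ x 0) + t 0 * t 1 * (ψ x 0 * ψ x 1) +
        t 1 * t 0 * (ψ x 1 * ψ x 0) + t 1 * t 1 * (ψ x 1 * ψ x 1) := by
    ext x; ring
  rw [heq, integral_add (by fun_prop) (by fun_prop), integral_add (by fun_prop) (by fun_prop),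
    integral_add (by fun_prop) (by fun_prop)]
  simp only [integral_const_mul, secondMoment, Matrix.mulVec, dotProduct, Fin.sum_univ_two,
    Matrix.of_apply]
  ring

lemma posSemidef_secondMoment {μ : Measure ℝ} {ψ : ℝ → GPDParam} (hψ : MemLp ψ 2 μ) :
    (secondMoment μ ψ).PosSemidef := by
  refine Matrix.PosSemidef.of_dotProduct_mulVec_nonneg ?_ fun t => ?_
  · ext i j
    simp [secondMoment, Matrix.conjTranspose_apply, mul_comm]
  · rw [star_trivial, dotProduct_secondMoment_mulVec hψ]
    exact integral_nonneg fun x => sq_nonneg _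

lemma charFun_map_eq_charFun_inner {Ω : Type*} [MeasurableSpace Ω] {P : Measure Ω}
    {Z : Ω → GPDParam} (hZ : AEMeasurable Z P) (t : GPDParam) :
    charFun (P.map Z) t = charFun (P.map fun ω => t 0 * Z ω 0 + t 1 * Z ω 1) 1 := by
  rw [charFun_apply, charFun_apply, integral_map hZ (by fun_prop),
    integral_map (by fun_prop) (by fun_prop)]
  congr 1
  ext ω
  simp [PiLp.inner_apply, Fin.sum_univ_two]

/-- The Cramér–Wold device: the characteristic function at `t` is that of the projection on `t`,
evaluated at `1`, to which the scalar central limit theorem applies. -/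
theorem tendstoInDistribution_sqrt_mul_sum {ψ : ℝ → GPDParam} (hψ : MemLp ψ 2 μ)
    (h0 : ∀ i, ∫ x, ψ x i ∂μ = 0) :
    TendstoInDistribution
      (fun (n : ℕ) (ω : ℕ → ℝ) => (√(n : ℝ))⁻¹ • ∑ i ∈ Finset.range n, ψ (ω i)) atTop
      (id : GPDParam → GPDParam) (fun _ => seqLaw μ)
      (multivariateGaussian 0 (secondMoment μ ψ)) where
  forall_aemeasurable n := by
    refine AEMeasurable.fun_const_smul (g := fun ω : ℕ → ℝ => ∑ i ∈ Finset.range n, ψ (ω i)) ?_ _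
    exact Finset.aemeasurable_fun_sum _ fun i _ => aemeasurable_comp_eval hψ.1.aemeasurable i
  tendsto := by
    have hmeas : ∀ n : ℕ, AEMeasurable
        (fun ω : ℕ → ℝ => (√(n : ℝ))⁻¹ • ∑ i ∈ Finset.range n, ψ (ω i)) (seqLaw μ) := fun n =>
      AEMeasurable.fun_const_smul (g := fun ω : ℕ → ℝ => ∑ i ∈ Finset.range n, ψ (ω i))
        (Finset.aemeasurable_fun_sum _ fun i _ =>
          aemeasurable_comp_eval hψ.1.aemeasurable i) _
    refine ProbabilityMeasure.tendsto_iff_tendsto_charFun.2 fun t => ?_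
    set f : ℝ → ℝ := fun x => t 0 * ψ x 0 + t 1 * ψ x 1 with hf
    have hfm : MemLp f 2 μ :=
      ((hψ.eval_piLp 0).const_mul (t 0)).add ((hψ.eval_piLp 1).const_mul (t 1))
    have hf0 : ∫ x, f x ∂μ = 0 := by
      rw [hf, integral_add (((hψ.eval_piLp 0).integrable one_le_two).const_mul _)
        (((hψ.eval_piLp 1).integrable one_le_two).const_mul _), integral_const_mul,
        integral_const_mul, h0, h0]
      simp
    have hmean : ∫ ω, f (ω 0) ∂(seqLaw μ) = 0 := by rw [integral_comp_eval hfm.1, hf0]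
    have hvar : Var[fun ω => f (ω 0); seqLaw μ] = t ⬝ᵥ (secondMoment μ ψ).mulVec t := by
      rw [variance_eq_integral (memLp_comp_eval hfm 0).1.aemeasurable, hmean,
        dotProduct_secondMoment_mulVec hψ]
      simp only [sub_zero]
      exact integral_comp_eval (f := fun x => f x ^ 2) (hfm.1.pow 2) 0
    have hclt := tendstoInDistribution_inv_sqrt_mul_sum_sub (P := seqLaw μ)
      (X := fun i ω => f (ω i)) (Y := id) HasLaw.id (memLp_comp_eval hfm 0)
      (iIndepFun_seqLaw hfm.1.aemeasurable)
      (fun i => identDistrib_seqLaw hfm.1.aemeasurable i 0)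
    have hchar := ProbabilityMeasure.tendsto_iff_tendsto_charFun.1 hclt.tendsto 1
    simp only [ProbabilityMeasure.coe_mk, Measure.map_id, charFun_gaussianReal, hmean, mul_zero,
      sub_zero] at hchar
    simp only [ProbabilityMeasure.coe_mk, Measure.map_id,
      charFun_multivariateGaussian (posSemidef_secondMoment hψ)]
    convert! hchar using 2 with n
    · rw [charFun_map_eq_charFun_inner (hmeas n)]
      congr 2
      ext ω
      simp [hf, Finset.mul_sum, Finset.sum_add_distrib, mul_add]
      congr 1 <;> exact Finset.sum_congr rfl fun i _ => by ring
    · rw [hvar, Real.coe_toNNReal _ (by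
        rw [dotProduct_secondMoment_mulVec hψ]; exact integral_nonneg fun x => sq_nonneg _)]
      simp

end CLT

/-! ### Asymptotic covariance of asymptotically linear estimators -/

section AsVar

variable {ξ β : ℝ}

/-- Slutsky's lemma: the normalized error differs from the normalized sum of `ψ` by a term tending
to `0` in measure. -/
lemma IsALE.hasAsVar (hξ : -(1 / 2) < ξ) (hβ : 0 < β) {S : GPDEstimator} {ψ : ℝ → GPDParam}
    (h : IsALE ξ β S ψ) : HasAsVar ξ β S (ifCov ξ β ψ) := by
  have := isProbabilityMeasure_gpd (show -1 < ξ by linarith) hβ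
  refine ⟨posSemidef_secondMoment h.memLp, fun g => ?_⟩
  set P := seqLaw (gpd ξ β) with hP
  set W : ℕ → (ℕ → ℝ) → GPDParam :=
    fun n ω => √(n : ℝ) • (S.toFun n (firstObs n ω) - !₂[ξ, β]) with hW
  have hWm : ∀ n, Measurable (W n) := fun n =>
    (((S.measurable n).comp (measurable_firstObs n)).sub_const _).fun_const_smul _
  have hclt := tendstoInDistribution_sqrt_mul_sum h.memLp h.centered
  have hdiff : TendstoInMeasure P (W - fun (n : ℕ) (ω : ℕ → ℝ) =>
      (√(n : ℝ))⁻¹ • ∑ i ∈ Finset.range n, ψ (ω i)) atTop 0 := by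
    rw [tendstoInMeasure_iff_norm]
    intro ε hε
    refine tendsto_of_tendsto_of_tendsto_of_le_of_le tendsto_const_nhds (h.remainder ε hε)
      (fun _ => zero_le) fun n => ?_
    dsimp only
    rw [gpdSample, ← map_firstObs]
    -- Since `ψ` is only almost everywhere measurable, the remainder event need not be measurable;
    -- the inequality for the image measure suffices.
    refine le_trans (measure_mono fun ω hω => ?_)
      (Measure.le_map_apply (measurable_firstObs n).aemeasurable _)
    simp only [Set.mem_ofPred_eq, Set.mem_preimage, Pi.sub_apply, Pi.zero_apply, sub_zero] at hω ⊢
    have h1 : √(n : ℝ) • (S.toFun n (firstObs n ω) - !₂[ξ, β] -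
        (n : ℝ)⁻¹ • ∑ i, ψ (firstObs n ω i)) =
        W n ω - (√(n : ℝ))⁻¹ • ∑ i ∈ Finset.range n, ψ (ω i) := by
      rw [smul_sub, smul_smul, ← Fin.sum_univ_eq_sum_range (fun i => ψ (ω i)) n]
      congr 2
      rw [← div_eq_mul_inv, Real.sqrt_div_self]
    rw [← h1, norm_smul, Real.norm_of_nonneg (Real.sqrt_nonneg _)] at hω
    exact hω
  have hlim := (tendstoInDistribution_of_tendstoInMeasure_sub W _ hclt hdiff
    fun n => (hWm n).aemeasurable).tendsto
  have := ProbabilityMeasure.tendsto_iff_forall_integral_tendsto.1 hlim g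
  simp only [ProbabilityMeasure.coe_mk, Measure.map_id] at this
  refine this.congr fun n => ?_
  rw [gpdSample, ← map_firstObs, integral_map (measurable_firstObs n).aemeasurable,
    integral_map (hWm n).aemeasurable g.continuous.aestronglyMeasurable]
  exact (g.continuous.measurable.comp
    (((S.measurable n).sub_const _).fun_const_smul _)).aestronglyMeasurable

lemma memLp_mleIF (hξ : -(1 / 2) < ξ) (hβ : 0 < β) : MemLp (mleIF ξ β) 2 (gpd ξ β) := by
  have hs : ∀ i, MemLp (fun x => gpdScore ξ β x i) 2 (gpd ξ β) := fun i => by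
    rw [memLp_two_iff_integrable_sq (measurable_gpdScore ξ β i).aestronglyMeasurable]
    simpa only [sq] using (integral_gpdScore_mul hξ hβ i i).1
  refine MemLp.of_eval_piLp fun i => ?_
  fin_cases i
  · refine (((hs 0).const_mul ((1 + ξ) * (ξ + 1))).sub ((hs 1).const_mul ((1 + ξ) * β))).ae_eq
      (.of_eq ?_)
    ext x
    refine Eq.trans ?_ (mleIF_apply hξ hβ x).1.symm
    simp only [Pi.sub_apply]; ring
  · refine (((hs 0).const_mul (-((1 + ξ) * β))).add
      ((hs 1).const_mul ((1 + ξ) * (2 * β ^ 2)))).ae_eq (.of_eq ?_)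
    ext x
    refine Eq.trans ?_ (mleIF_apply hξ hβ x).2.symm
    simp only [Pi.add_apply]; ring

lemma mleIF_apply_eq_sum (ξ β x : ℝ) (i : Fin 2) :
    mleIF ξ β x i = (fisherInfo ξ β)⁻¹ i 0 * gpdScore ξ β x 0 +
      (fisherInfo ξ β)⁻¹ i 1 * gpdScore ξ β x 1 := by
  fin_cases i <;> simp [mleIF]

lemma integral_mleIF (hξ : -(1 / 2) < ξ) (hβ : 0 < β) (i : Fin 2) :
    ∫ x, mleIF ξ β x i ∂(gpd ξ β) = 0 := by
  simp only [mleIF_apply_eq_sum]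
  rw [integral_add ((integral_gpdScore hξ hβ 0).1.const_mul _)
    ((integral_gpdScore hξ hβ 1).1.const_mul _), integral_const_mul, integral_const_mul,
    (integral_gpdScore hξ hβ 0).2, (integral_gpdScore hξ hβ 1).2]
  simp

lemma integral_mleIF_mul_gpdScore (hξ : -(1 / 2) < ξ) (hβ : 0 < β) (i j : Fin 2) :
    ∫ x, mleIF ξ β x i * gpdScore ξ β x j ∂(gpd ξ β) =
      (1 : Matrix (Fin 2) (Fin 2) ℝ) i j := by
  rw [← Matrix.nonsing_inv_mul _ (isUnit_det_fisherInfo hξ hβ), Matrix.mul_apply,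
    Fin.sum_univ_two]
  simp only [mleIF_apply_eq_sum, add_mul, mul_assoc]
  rw [integral_add ((integral_gpdScore_mul hξ hβ 0 j).1.const_mul _)
    ((integral_gpdScore_mul hξ hβ 1 j).1.const_mul _), integral_const_mul, integral_const_mul]
  rfl

/-- Linearity and `E ψ Λᵀ = 1` show that the covariance with `I⁻¹ Λ` does not depend on `ψ`. -/
lemma integral_mul_mleIF {ψ : ℝ → GPDParam} (hψ : ∀ i j,
    Integrable (fun x => ψ x i * gpdScore ξ β x j) (gpd ξ β))
    (h : ∀ i j, ∫ x, ψ x i * gpdScore ξ β x j ∂(gpd ξ β) = (1 : Matrix (Fin 2) (Fin 2) ℝ) i j)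
    (i j : Fin 2) : ∫ x, ψ x i * mleIF ξ β x j ∂(gpd ξ β) = (fisherInfo ξ β)⁻¹ j i := by
  simp only [mleIF_apply_eq_sum, mul_add, mul_left_comm _ ((fisherInfo ξ β)⁻¹ _ _)]
  rw [integral_add ((hψ i 0).const_mul _) ((hψ i 1).const_mul _), integral_const_mul,
    integral_const_mul, h, h]
  fin_cases i <;> simp [Matrix.one_apply]

lemma integrable_mul_gpdScore (hξ : -(1 / 2) < ξ) (hβ : 0 < β) {ψ : ℝ → GPDParam}
    (hψ : MemLp ψ 2 (gpd ξ β)) (i j : Fin 2) :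
    Integrable (fun x => ψ x i * gpdScore ξ β x j) (gpd ξ β) := by
  refine (hψ.eval_piLp i).integrable_mul
    ((memLp_two_iff_integrable_sq (measurable_gpdScore ξ β j).aestronglyMeasurable).2 ?_)
  simpa only [sq] using (integral_gpdScore_mul hξ hβ j j).1

lemma fisherInfo_inv_comm (hξ : -(1 / 2) < ξ) (hβ : 0 < β) (i j : Fin 2) :
    (fisherInfo ξ β)⁻¹ i j = (fisherInfo ξ β)⁻¹ j i := by
  rw [fisherInfo_inv hξ hβ]
  fin_cases i <;> fin_cases j <;> simp

lemma ifCov_mleIF (hξ : -(1 / 2) < ξ) (hβ : 0 < β) :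
    ifCov ξ β (mleIF ξ β) = (fisherInfo ξ β)⁻¹ := by
  ext i j
  exact (integral_mul_mleIF (integrable_mul_gpdScore hξ hβ (memLp_mleIF hξ hβ))
    (integral_mleIF_mul_gpdScore hξ hβ) i j).trans (fisherInfo_inv_comm hξ hβ j i)

/-- Pythagoras: the cross moments with `η = I⁻¹ Λ` all equal `I⁻¹`, so the difference is the second
moment matrix of `ψ - η`. -/
lemma posSemidef_ifCov_sub (hξ : -(1 / 2) < ξ) (hβ : 0 < β) {S : GPDEstimator}
    {ψ : ℝ → GPDParam} (h : IsALE ξ β S ψ) :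
    (ifCov ξ β ψ - (fisherInfo ξ β)⁻¹).PosSemidef := by
  have := isProbabilityMeasure_gpd (show -1 < ξ by linarith) hβ
  have hη := memLp_mleIF hξ hβ
  have hψη := integral_mul_mleIF (integrable_mul_gpdScore hξ hβ h.memLp) h.score
  have heq : ifCov ξ β ψ - (fisherInfo ξ β)⁻¹ =
      secondMoment (gpd ξ β) (ψ - mleIF ξ β) := by
    ext i j
    have hηη : ∫ x, mleIF ξ β x i * mleIF ξ β x j ∂(gpd ξ β) = (fisherInfo ξ β)⁻¹ i j :=
      congrFun (congrFun (ifCov_mleIF hξ hβ) i) j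
    have hexp : (fun x => (ψ - mleIF ξ β) x i * (ψ - mleIF ξ β) x j) = fun x =>
        ψ x i * ψ x j - ψ x i * mleIF ξ β x j - ψ x j * mleIF ξ β x i +
          mleIF ξ β x i * mleIF ξ β x j := by
      ext x
      simp only [Pi.sub_apply, PiLp.sub_apply]
      ring
    have i1 := integrable_mul_apply h.memLp h.memLp i j
    have i2 := integrable_mul_apply h.memLp hη i j
    have i3 := integrable_mul_apply h.memLp hη j i
    have i4 := integrable_mul_apply hη hη i j
    simp only [secondMoment, Matrix.of_apply]
    rw [hexp, integral_add (by fun_prop) i4, integral_sub (by fun_prop) i3,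
      integral_sub i1 i2, hψη, hψη, hηη, fisherInfo_inv_comm hξ hβ j i]
    simp [ifCov]
  rw [heq]
  exact posSemidef_secondMoment (h.memLp.sub hη)

end AsVar

/-! ### The Gibbs inequality and identifiability -/

section Gibbs

variable {ξ β τ σ : ℝ}

lemma gpdDensity_coord (hσ : 0 < σ) {x : ℝ} (hx : 0 < x) (h : 0 < 1 + τ * x) :
    gpdDensity (τ / σ) σ⁻¹ x = Real.exp (logDensity τ σ x) := by
  have h1 : τ / σ / σ⁻¹ = τ := by field_simp
  rw [gpdDensity_eq_exp (inv_pos.2 hσ) hx, h1, inv_inv]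
  rw [div_inv_eq_mul]
  have : τ / σ * (x * σ) = τ * x := by field_simp
  rwa [this]

lemma integrable_logDensity (hξ : -(1 / 2) < ξ) (hβ : 0 < β)
    (hint : Integrable (hazard τ) (gpd ξ β)) : Integrable (logDensity τ σ) (gpd ξ β) := by
  have := isProbabilityMeasure_gpd (show -1 < ξ by linarith) hβ
  exact (integrable_const _).sub (hint.const_mul _)

lemma integral_logDensity (hξ : -(1 / 2) < ξ) (hβ : 0 < β)
    (hint : Integrable (hazard τ) (gpd ξ β)) :
    ∫ x, logDensity τ σ x ∂(gpd ξ β) = Real.log σ - (σ + τ) * ∫ x, hazard τ x ∂(gpd ξ β) := by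
  have := isProbabilityMeasure_gpd (show -1 < ξ by linarith) hβ
  simp only [logDensity]
  rw [integral_sub (integrable_const _) (hint.const_mul _), integral_const_mul]
  simp

/-- The mean likelihood ratio is the mass that the other distribution gives to the true support,
possibly less than `1`. -/
lemma lintegral_exp_logDensity_sub_le (hξ : -(1 / 2) < ξ) (hβ : 0 < β) (hσ : 0 < σ)
    (hστ : 0 ≤ σ + 2 * τ) (hadm : ∀ᵐ x ∂(gpd ξ β), 0 < 1 + τ * x) :
    ∫⁻ x, ENNReal.ofReal (Real.exp (logDensity τ σ x - logDensity (ξ / β) β⁻¹ x)) ∂(gpd ξ β)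
      ≤ 1 := by
  have hp : IsProbabilityMeasure (gpd (τ / σ) σ⁻¹) := by
    refine isProbabilityMeasure_gpd ?_ (inv_pos.2 hσ)
    rw [lt_div_iff₀ hσ]
    linarith
  have hm : Measurable fun x => Real.exp (logDensity τ σ x - logDensity (ξ / β) β⁻¹ x) := by
    unfold logDensity; fun_prop
  have h1 : ∫⁻ x, ENNReal.ofReal (gpdDensity (τ / σ) σ⁻¹ x) = 1 := by
    have := hp.measure_univ
    rwa [gpd, withDensity_apply _ MeasurableSet.univ, Measure.restrict_univ] at this
  have hae := (ae_withDensity_iff (μ := volume) (by fun_prop)).1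
    (hadm.and (ae_gpd_pos (ξ := ξ) (by linarith) hβ))
  rw [gpd, lintegral_withDensity_eq_lintegral_mul _ (by fun_prop) (by fun_prop), ← h1]
  refine lintegral_mono_ae ?_
  filter_upwards [hae] with x hx
  rw [Pi.mul_apply]
  by_cases h0 : ENNReal.ofReal (gpdDensity ξ β x) = 0
  · simp [h0]
  · obtain ⟨hx1, hx0, hx2⟩ := hx h0
    rw [← ENNReal.ofReal_mul (gpdDensity_nonneg hβ x), gpdDensity_coord hσ hx0 hx1,
      gpdDensity_eq_exp hβ hx0 hx2, ← Real.exp_add]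
    refine ENNReal.ofReal_le_ofReal (le_of_eq ?_)
    congr 1
    ring

/-- Equality in the Gibbs inequality. -/
lemma logDensity_ae_eq (hξ : -(1 / 2) < ξ) (hβ : 0 < β) (hσ : 0 < σ)
    (hστ : 0 ≤ σ + 2 * τ) (hadm : ∀ᵐ x ∂(gpd ξ β), 0 < 1 + τ * x)
    (hint : Integrable (hazard τ) (gpd ξ β))
    (hle : ∫ x, logDensity (ξ / β) β⁻¹ x ∂(gpd ξ β) ≤ ∫ x, logDensity τ σ x ∂(gpd ξ β)) :
    logDensity τ σ =ᵐ[gpd ξ β] logDensity (ξ / β) β⁻¹ := by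
  have := isProbabilityMeasure_gpd (show -1 < ξ by linarith) hβ
  have i1 := integrable_logDensity (σ := σ) hξ hβ hint
  have i0 := integrable_logDensity (σ := β⁻¹) hξ hβ (integral_hazard hξ hβ).1
  set u : ℝ → ℝ := fun x => logDensity τ σ x - logDensity (ξ / β) β⁻¹ x with hu
  have iu : Integrable u (gpd ξ β) := i1.sub i0
  have hm : Measurable fun x => Real.exp (u x) := by
    simp only [hu]; unfold logDensity; fun_prop
  have hl : ∫⁻ x, ENNReal.ofReal (Real.exp (u x)) ∂(gpd ξ β) ≤ 1 :=
    lintegral_exp_logDensity_sub_le hξ hβ hσ hστ hadm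
  have ie : Integrable (fun x => Real.exp (u x)) (gpd ξ β) :=
    ⟨hm.aestronglyMeasurable, by
      rw [hasFiniteIntegral_iff_ofReal (ae_of_all _ fun x => (Real.exp_pos _).le)]
      exact hl.trans_lt ENNReal.one_lt_top⟩
  have he : ∫ x, Real.exp (u x) ∂(gpd ξ β) ≤ 1 := by
    rw [integral_eq_lintegral_of_nonneg_ae (ae_of_all _ fun x => (Real.exp_pos _).le)
      hm.aestronglyMeasurable]
    exact ENNReal.toReal_le_of_le_ofReal zero_le_one (by simpa using hl)
  have hu0 : 0 ≤ ∫ x, u x ∂(gpd ξ β) := by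
    rw [integral_sub i1 i0]; linarith
  -- Here `E exp u ≤ 1` and `E u ≥ 0`, so this nonnegative function has mean `0` and vanishes almost
  -- everywhere; strict convexity then gives `u = 0`.
  have hv0 : ∀ x, 0 ≤ Real.exp (u x) - (u x + 1) := fun x => by
    linarith [Real.add_one_le_exp (u x)]
  have iu1 : Integrable (fun x => u x + 1) (gpd ξ β) := iu.add (integrable_const 1)
  have hv : ∫ x, (Real.exp (u x) - (u x + 1)) ∂(gpd ξ β) = 0 := by
    refine le_antisymm ?_ (integral_nonneg hv0)
    rw [integral_sub ie iu1, integral_add iu (integrable_const 1)]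
    simp
    linarith
  have hae := (integral_eq_zero_iff_of_nonneg hv0 (ie.sub iu1)).1 hv
  filter_upwards [hae] with x hx
  by_contra hne
  have h1 := Real.add_one_lt_exp (sub_ne_zero.2 hne)
  have h2 : Real.exp (u x) - (u x + 1) = 0 := hx
  simp only [hu] at h2
  linarith

/-- Near `0` both log-densities are differentiable, so almost everywhere equality becomes equality
of the derivatives `-(σ + τ) / (1 + τ x)`. Cross-multiplied, this is affine in `x`, and two points
determine the parameters. -/
lemma eq_of_logDensity_ae_eq (hβ : 0 < β) (hσ : 0 < σ)
    (hστ : 0 ≤ σ + 2 * τ) (h : logDensity τ σ =ᵐ[gpd ξ β] logDensity (ξ / β) β⁻¹) :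
    τ = ξ / β ∧ σ = β⁻¹ := by
  have hσ0 : 0 < β⁻¹ := inv_pos.2 hβ
  set τ₀ := ξ / β with hτ₀
  set σ₀ := β⁻¹ with hσ₀
  have hnear : ∀ t : ℝ, ∀ᶠ x : ℝ in 𝓝 0, 0 < 1 + t * x := fun t => by
    have : ContinuousAt (fun x : ℝ => 1 + t * x) 0 := by fun_prop
    exact this.eventually (lt_mem_nhds (by simp))
  obtain ⟨b, hb, hball⟩ := Metric.eventually_nhds_iff.1 ((hnear τ).and (hnear τ₀))
  have hpos : ∀ x ∈ Set.Ico 0 b, 0 < 1 + τ * x ∧ 0 < 1 + τ₀ * x := fun x hx => by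
    refine hball ?_
    rw [Real.dist_eq, sub_zero, abs_of_nonneg hx.1]
    exact hx.2
  have hderiv : ∀ t s : ℝ, ∀ x, 0 ≤ x → 0 < 1 + t * x →
      HasDerivAt (logDensity t s) (-((s + t) * (1 + t * x)⁻¹)) x := fun t s x hx h1 => by
    have := ((hasDerivAt_hazard hx h1).const_mul (s + t)).const_sub (Real.log s)
    exact this
  have hae : logDensity τ σ =ᵐ[volume.restrict (Set.Ioo 0 b)] logDensity τ₀ σ₀ := by
    have h1 := (ae_withDensity_iff (μ := volume) (by fun_prop)).1 h
    refine (ae_restrict_iff' measurableSet_Ioo).2 ?_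
    filter_upwards [h1] with x hx hxb
    refine hx ?_
    have h2 := (hpos x ⟨hxb.1.le, hxb.2⟩).2
    rw [gpdDensity_eq_exp hβ hxb.1 (one_add_div_mul_pos_iff.1 h2)]
    simp [Real.exp_pos]
  have heq : Set.EqOn (logDensity τ σ) (logDensity τ₀ σ₀) (Set.Ioo 0 b) :=
    Measure.eqOn_Ioo_of_ae_eq volume hae
      (fun x hx => (hderiv τ σ x hx.1.le
        (hpos x ⟨hx.1.le, hx.2⟩).1).continuousAt.continuousWithinAt)
      (fun x hx => (hderiv τ₀ σ₀ x hx.1.le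
        (hpos x ⟨hx.1.le, hx.2⟩).2).continuousAt.continuousWithinAt)
  have h1 : ∀ x ∈ Set.Ioo 0 b, (σ + τ) * (1 + τ₀ * x) = (σ₀ + τ₀) * (1 + τ * x) := by
    intro x hx
    have hx' : x ∈ Set.Ico 0 b := ⟨hx.1.le, hx.2⟩
    have e1 := (hderiv τ σ x hx'.1 (hpos x hx').1)
    have e2 := (hderiv τ₀ σ₀ x hx'.1 (hpos x hx').2).congr_of_eventuallyEq
      (heq.eventuallyEq_of_mem (Ioo_mem_nhds hx.1 hx.2))
    have e3 := neg_injective (e1.unique e2)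
    rwa [← div_eq_mul_inv, ← div_eq_mul_inv,
      div_eq_div_iff (hpos x hx').1.ne' (hpos x hx').2.ne'] at e3
  have h2 := h1 (b / 2) ⟨by linarith, by linarith⟩
  have h3 := h1 (b / 4) ⟨by linarith, by linarith⟩
  have hc : σ + τ = σ₀ + τ₀ := by linarith
  have hcpos : 0 < σ + τ := by linarith
  rw [hc] at h2 hcpos
  have h4 := mul_left_cancel₀ hcpos.ne' h2
  have h5 : τ₀ = τ := mul_right_cancel₀ (show b / 2 ≠ 0 by positivity) (by linarith)
  exact ⟨h5.symm, by linarith⟩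

end Gibbs

/-! ### Truncated hazards -/

section Truncation

variable {ξ β τ σ : ℝ}

/-- A bounded lower bound of the cumulative hazards with parameters at most `τ`. -/
noncomputable def truncHazard (τ k x : ℝ) : ℝ := if 0 < 1 + τ * x then min (hazard τ x) k else k

@[fun_prop] lemma measurable_truncHazard (τ k : ℝ) : Measurable (truncHazard τ k) :=
  Measurable.ite (measurableSet_lt measurable_const (by fun_prop)) (by fun_prop) (by fun_prop)

lemma truncHazard_nonneg {k x : ℝ} (hk : 0 ≤ k) (hx : 0 ≤ x) : 0 ≤ truncHazard τ k x := by
  unfold truncHazard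
  split_ifs with h
  · exact le_min (hazard_nonneg hx h) hk
  · exact hk

lemma truncHazard_le {k x : ℝ} : truncHazard τ k x ≤ k := by
  unfold truncHazard
  split_ifs with h
  · exact min_le_right _ _
  · exact le_rfl

lemma truncHazard_le_hazard {τ' k x : ℝ} (hx : 0 ≤ x) (h : 0 < 1 + τ * x) (hle : τ ≤ τ') :
    truncHazard τ' k x ≤ hazard τ x := by
  rw [truncHazard, if_pos (one_add_mul_pos_of_le_left hx hle h)]
  exact (min_le_left _ _).trans (hazard_anti hx h hle)

lemma integrable_truncHazard (hξ : -(1 / 2) < ξ) (hβ : 0 < β) {k : ℝ} (hk : 0 ≤ k) :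
    Integrable (truncHazard τ k) (gpd ξ β) := by
  have := isProbabilityMeasure_gpd (show -1 < ξ by linarith) hβ
  refine Integrable.of_bound (measurable_truncHazard τ k).aestronglyMeasurable k ?_
  filter_upwards [ae_gpd_pos (ξ := ξ) (by linarith) hβ] with x hx
  rw [Real.norm_of_nonneg (truncHazard_nonneg hk hx.1.le)]
  exact truncHazard_le

/-- The shift `1 / (k + 1)` makes the truncation a lower bound for all parameters near `τ`, not only
at `τ`. The limit is the hazard extended by `∞` off the support. -/
lemma tendsto_ofReal_truncHazard {x : ℝ} (hx : 0 ≤ x) (h : 1 + τ * x ≠ 0) :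
    Tendsto (fun k : ℕ => ENNReal.ofReal (truncHazard (τ + 1 / (k + 1)) k x)) atTop
      (𝓝 (if 0 < 1 + τ * x then ENNReal.ofReal (hazard τ x) else ⊤)) := by
  have ht : Tendsto (fun k : ℕ => τ + 1 / ((k : ℝ) + 1)) atTop (𝓝 τ) := by
    simpa using tendsto_one_div_add_atTop_nhds_zero_nat.const_add τ
  split_ifs with h0
  · refine ENNReal.tendsto_ofReal ?_
    have h1 := (continuousAt_hazard_left hx h0).tendsto.comp ht
    refine h1.congr' ?_
    filter_upwards [h1.eventually_lt_const (show hazard τ x < hazard τ x + 1 by linarith),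
      tendsto_natCast_atTop_atTop.eventually_ge_atTop (hazard τ x + 1)] with k hk1 hk2
    have hk : (0 : ℝ) ≤ 1 / ((k : ℝ) + 1) := by positivity
    rw [truncHazard, if_pos (one_add_mul_pos_of_le_left hx (by linarith) h0)]
    exact (min_eq_left (hk1.le.trans hk2)).symm
  · have hlt : 1 + τ * x < 0 := lt_of_le_of_ne (not_lt.1 h0) h
    have h1 : Tendsto (fun k : ℕ => 1 + (τ + 1 / ((k : ℝ) + 1)) * x) atTop (𝓝 (1 + τ * x)) :=
      (ht.mul_const x).const_add 1
    refine (ENNReal.tendsto_ofReal_nhds_top.2 tendsto_natCast_atTop_atTop).congr' ?_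
    filter_upwards [h1.eventually_lt_const hlt] with k hk
    rw [truncHazard, if_neg (not_lt.2 hk.le)]

/-- The log-likelihood at a wrong parameter is small in the mean, even after truncation. -/
lemma exists_truncHazard_lt (hξ : -(1 / 2) < ξ) (hβ : 0 < β) (hσ : 0 < σ) (hστ : 0 ≤ σ + 2 * τ)
    (hne : ¬ (τ = ξ / β ∧ σ = β⁻¹)) :
    ∃ k : ℕ, Real.log σ - (σ + τ) * ∫ x, truncHazard (τ + 1 / (k + 1)) k x ∂(gpd ξ β) <
      ∫ x, logDensity (ξ / β) β⁻¹ x ∂(gpd ξ β) := by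
  -- Otherwise Fatou's lemma bounds the mean of the extended hazard, so `τ` is admissible almost
  -- surely with integrable hazard. The wrong parameter would then attain equality in the Gibbs
  -- inequality, against identifiability.
  by_contra! hcon
  have := isProbabilityMeasure_gpd (show -1 < ξ by linarith) hβ
  set m := ∫ x, logDensity (ξ / β) β⁻¹ x ∂(gpd ξ β) with hm
  have hc : 0 < σ + τ := by linarith
  have hpos := ae_gpd_pos (ξ := ξ) (by linarith) hβ
  have hx1 : ∀ᵐ x ∂(gpd ξ β), 1 + τ * x ≠ 0 := by
    have h1 : ∀ᵐ x : ℝ, x ≠ -1 / τ := Measure.ae_ne volume _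
    filter_upwards [(withDensity_absolutelyContinuous volume _).ae_le h1] with x hx h0
    have hτ : τ ≠ 0 := fun h => by simp [h] at h0
    exact hx (by field_simp; linarith)
  set C := (Real.log σ - m) / (σ + τ) with hC
  have hbound : ∀ k : ℕ, ∫⁻ x, ENNReal.ofReal (truncHazard (τ + 1 / (k + 1)) k x) ∂(gpd ξ β) ≤
      ENNReal.ofReal C := fun k => by
    rw [← ofReal_integral_eq_lintegral_ofReal (integrable_truncHazard hξ hβ k.cast_nonneg)
      (by filter_upwards [hpos] with x hx using truncHazard_nonneg k.cast_nonneg hx.1.le)]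
    refine ENNReal.ofReal_le_ofReal ?_
    rw [hC, le_div_iff₀ hc]
    linarith [hcon k]
  set h : ℝ → ℝ≥0∞ := fun x => if 0 < 1 + τ * x then ENNReal.ofReal (hazard τ x) else ⊤ with hh
  have hhm : Measurable h :=
    Measurable.ite (measurableSet_lt measurable_const (by fun_prop)) (by fun_prop) (by fun_prop)
  have hfatou : ∫⁻ x, h x ∂(gpd ξ β) ≤ ENNReal.ofReal C := by
    calc ∫⁻ x, h x ∂(gpd ξ β)
        = ∫⁻ x, liminf (fun k : ℕ => ENNReal.ofReal (truncHazard (τ + 1 / (k + 1)) k x)) atTop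
            ∂(gpd ξ β) := by
          refine lintegral_congr_ae ?_
          filter_upwards [hpos, hx1] with x hx hx'
          exact (tendsto_ofReal_truncHazard hx.1.le hx').liminf_eq.symm
      _ ≤ liminf (fun k : ℕ => ∫⁻ x, ENNReal.ofReal (truncHazard (τ + 1 / (k + 1)) k x)
            ∂(gpd ξ β)) atTop := lintegral_liminf_le fun k => by fun_prop
      _ ≤ ENNReal.ofReal C :=
          liminf_le_of_le (by isBoundedDefault) fun b hb => by
            obtain ⟨k, hk⟩ := hb.exists
            exact hk.trans (hbound k)
  have hadm : ∀ᵐ x ∂(gpd ξ β), 0 < 1 + τ * x := by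
    filter_upwards [ae_lt_top hhm (hfatou.trans_lt ENNReal.ofReal_lt_top).ne] with x hx
    by_contra h0
    simp [hh, h0] at hx
  have heq : ∫⁻ x, ENNReal.ofReal (hazard τ x) ∂(gpd ξ β) ≤ ENNReal.ofReal C := by
    refine le_trans (le_of_eq (lintegral_congr_ae ?_)) hfatou
    filter_upwards [hadm] with x hx
    simp [hh, hx]
  have hnn : 0 ≤ᵐ[gpd ξ β] hazard τ := by
    filter_upwards [hadm, hpos] with x hx hx' using hazard_nonneg hx'.1.le hx
  have hint : Integrable (hazard τ) (gpd ξ β) :=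
    ⟨(measurable_hazard τ).aestronglyMeasurable, by
      rw [hasFiniteIntegral_iff_ofReal hnn]
      exact heq.trans_lt ENNReal.ofReal_lt_top⟩
  have hC0 : 0 ≤ C := by
    rw [hC]
    have h1 := hcon 0
    have h2 : 0 ≤ ∫ x, truncHazard (τ + 1 / ((0 : ℕ) + 1)) (0 : ℕ) x ∂(gpd ξ β) :=
      integral_nonneg_of_ae (by
        filter_upwards [hpos] with x hx using truncHazard_nonneg (by simp) hx.1.le)
    have h3 := mul_nonneg hc.le h2
    exact div_nonneg (by linarith) hc.le
  have hE : ∫ x, hazard τ x ∂(gpd ξ β) ≤ C := by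
    rw [integral_eq_lintegral_of_nonneg_ae hnn (measurable_hazard τ).aestronglyMeasurable]
    exact ENNReal.toReal_le_of_le_ofReal hC0 heq
  refine hne (eq_of_logDensity_ae_eq hβ hσ hστ
    (logDensity_ae_eq hξ hβ hσ hστ hadm hint ?_))
  rw [integral_logDensity hξ hβ hint]
  rw [hC, le_div_iff₀ hc] at hE
  linarith

end Truncation

/-! ### Integrability of the logarithm near zero -/

section Log

variable {ξ β : ℝ}

/-- The mean value theorem on `[0, e]`. It reduces the negative part of `log x` to that of `log e`,
up to integrable terms. -/
lemma mul_exp_le_gpdExpTransform (hβ : 0 < β) {e : ℝ} (he : 0 < e) :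
    β * (e * Real.exp (-(|ξ| * e))) ≤ gpdExpTransform ξ β e := by
  obtain ⟨c, hc, hc'⟩ := exists_hasDerivAt_eq_slope (gpdExpTransform ξ β)
    (fun t => β * Real.exp (ξ * t)) he (continuous_gpdExpTransform ξ β).continuousOn
    fun t _ => hasDerivAt_gpdExpTransform ξ β t
  rw [gpdExpTransform_zero, sub_zero, sub_zero, eq_div_iff he.ne'] at hc'
  rw [← hc']
  have h1 : -(|ξ| * e) ≤ ξ * c := by
    have h2 := neg_abs_le (ξ * c)
    rw [abs_mul, abs_of_pos hc.1] at h2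
    have h3 := mul_le_mul_of_nonneg_left hc.2.le (abs_nonneg ξ)
    linarith
  have h2 := Real.exp_le_exp.2 h1
  have h3 := mul_le_mul_of_nonneg_left h2 (mul_pos hβ he).le
  linarith

lemma neg_log_le_rpow {e : ℝ} (he : 0 < e) : -Real.log e ≤ 2 * e ^ (-(1 / 2) : ℝ) := by
  have h := Real.log_le_rpow_div (inv_pos.2 he).le (show (0 : ℝ) < 1 / 2 by norm_num)
  rw [Real.log_inv, Real.inv_rpow he.le, ← Real.rpow_neg he.le] at h
  linarith

lemma integrable_min_log_zero (hξ : -(1 / 2) < ξ) (hβ : 0 < β) :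
    Integrable (fun x => min (Real.log x) 0) (gpd ξ β) := by
  have hm : Measurable fun x : ℝ => min (Real.log x) 0 := Real.measurable_log.min measurable_const
  rw [gpd_eq_map (by linarith) hβ, integrable_map_measure hm.aestronglyMeasurable (by fun_prop)]
  have i1 : Integrable (fun e : ℝ => e ^ (-(1 / 2) : ℝ)) stdExp := by
    rw [integrable_stdExp_iff]
    have := Real.GammaIntegral_convergent (show (0 : ℝ) < 1 / 2 by norm_num)
    norm_num at this ⊢
    exact this
  have i2 : Integrable (fun e : ℝ => e) stdExp := by
    simpa using (stdExp_moment (c := 0) (by norm_num) 1 1).1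
  refine Integrable.mono' (((integrable_const |Real.log β|).add (i1.const_mul 2)).add
    (i2.const_mul |ξ|)) (hm.comp (measurable_gpdExpTransform ξ β)).aestronglyMeasurable ?_
  filter_upwards [ae_stdExp_pos] with e he
  have h1 := Real.log_le_log (by positivity) (mul_exp_le_gpdExpTransform (ξ := ξ) hβ he)
  rw [Real.log_mul hβ.ne' (by positivity), Real.log_mul he.ne' (by positivity), Real.log_exp] at h1
  have h2 := neg_log_le_rpow he
  have h3 := neg_abs_le (Real.log β)
  have h4 := abs_nonneg (Real.log β)
  have h5 : 0 ≤ e ^ (-(1 / 2) : ℝ) := by positivity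
  have h6 : 0 ≤ |ξ| * e := by positivity
  simp only [Function.comp, Pi.add_apply]
  rw [Real.norm_of_nonpos (min_le_right _ _), neg_le, le_min_iff]
  constructor <;> linarith

end Log

/-! ### Strong consistency -/

section Consistency

variable {ξ β : ℝ}

/-- Almost surely the average log-likelihood is eventually at most `m` on the set `s` of parameters
`(τ, σ)`. -/
def EventuallyBelow (μ : Measure ℝ) (s : Set (ℝ × ℝ)) (m : ℝ) : Prop :=
  ∀ᵐ ω ∂(seqLaw μ), ∀ᶠ n in atTop, ∀ p ∈ s, 0 < p.2 → 0 ≤ p.2 + 2 * p.1 →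
    (∀ i, 0 < 1 + p.1 * firstObs n ω i) → avgLogLik (firstObs n ω) p.1 p.2 ≤ m

lemma EventuallyBelow.mono {μ : Measure ℝ} {s t : Set (ℝ × ℝ)} {m m' : ℝ}
    (h : EventuallyBelow μ t m) (hst : s ⊆ t) (hm : m ≤ m') : EventuallyBelow μ s m' := by
  filter_upwards [h] with ω hω
  filter_upwards [hω] with n hn p hp h1 h2 h3
  exact (hn p (hst hp) h1 h2 h3).trans hm

lemma EventuallyBelow.union {μ : Measure ℝ} {s t : Set (ℝ × ℝ)} {m : ℝ}
    (h : EventuallyBelow μ s m) (h' : EventuallyBelow μ t m) : EventuallyBelow μ (s ∪ t) m := by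
  filter_upwards [h, h'] with ω hω hω'
  filter_upwards [hω, hω'] with n hn hn' p hp h1 h2 h3
  exact hp.elim (fun hp => hn p hp h1 h2 h3) fun hp => hn' p hp h1 h2 h3

lemma ae_firstObs_pos (hξ : -(1 / 2) < ξ) (hβ : 0 < β) :
    ∀ᵐ ω ∂(seqLaw (gpd ξ β)), ∀ n i, 0 < firstObs n ω i ∧ 0 < 1 + ξ / β * firstObs n ω i := by
  have := isProbabilityMeasure_gpd (show -1 < ξ by linarith) hβ
  filter_upwards [ae_seqLaw_of_ae (ae_gpd_pos (ξ := ξ) (by linarith) hβ)] with ω hω n i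
  exact ⟨(hω i).1, one_add_div_mul_pos_iff.2 (hω i).2⟩

/-- `avgLogLik_le_of_log` needs a lower bound on the mean of `log x_i`; the law of large numbers for
`min (log x) 0` supplies one. -/
lemma exists_eventuallyBelow_large_tau (hξ : -(1 / 2) < ξ) (hβ : 0 < β) (m : ℝ) :
    ∃ T, EventuallyBelow (gpd ξ β) {p | T ≤ p.1} m := by
  have := isProbabilityMeasure_gpd (show -1 < ξ by linarith) hβ
  obtain ⟨T, hT, hT'⟩ := exists_forall_ge_log_log_lt
    ((∫ x, min (Real.log x) 0 ∂(gpd ξ β)) - 1) m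
  refine ⟨T, ?_⟩
  filter_upwards [ae_tendsto_mean (integrable_min_log_zero hξ hβ), ae_firstObs_pos hξ hβ]
    with ω hω hpos
  filter_upwards [hω.eventually_const_lt (sub_one_lt _), eventually_gt_atTop 0]
    with n hn hn0 p hp hσ _ _
  refine (avgLogLik_le_of_log hn0 (fun i => (hpos n i).1) (hT.trans_le hp) hσ
    (hn.le.trans ?_) (hT' _ hp).1).trans (hT' _ hp).2.le
  exact mul_le_mul_of_nonneg_left (Finset.sum_le_sum fun i _ => min_le_left _ _) (by positivity)

lemma exists_eventuallyBelow_large_sigma (hξ : -(1 / 2) < ξ) (hβ : 0 < β) (T m : ℝ) :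
    ∃ S, EventuallyBelow (gpd ξ β) {p | p.1 ≤ T ∧ S ≤ p.2} m := by
  have := isProbabilityMeasure_gpd (show -1 < ξ by linarith) hβ
  have hpos := ae_gpd_pos (ξ := ξ) (by linarith) hβ
  -- Enlarging `T` beyond the true `τ` makes the hazard at `T'` admissible and dominated by the
  -- integrable true hazard.
  set T' := max T (ξ / β) with hT'
  have hadm : ∀ᵐ x ∂(gpd ξ β), 0 < x ∧ 0 < 1 + T' * x := by
    filter_upwards [hpos] with x hx
    exact ⟨hx.1, one_add_mul_pos_of_le_left hx.1.le (le_max_right _ _)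
      (one_add_div_mul_pos_iff.2 hx.2)⟩
  have hint : Integrable (hazard T') (gpd ξ β) := by
    refine (integral_hazard hξ hβ).1.mono' (measurable_hazard T').aestronglyMeasurable ?_
    filter_upwards [hpos, hadm] with x hx hx'
    rw [Real.norm_of_nonneg (hazard_nonneg hx'.1.le hx'.2)]
    exact hazard_anti hx.1.le (one_add_div_mul_pos_iff.2 hx.2) (le_max_right _ _)
  have hg : 0 < ∫ x, hazard T' x ∂(gpd ξ β) := by
    rw [integral_pos_iff_support_of_nonneg_ae (by
      filter_upwards [hadm] with x hx using hazard_nonneg hx.1.le hx.2) hint]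
    have : Function.support (hazard T') =ᵐ[gpd ξ β] Set.univ := by
      rw [eventuallyEq_univ]
      filter_upwards [hadm] with x hx using (hazard_pos hx.1 hx.2).ne'
    rw [measure_congr this]
    simp
  set g := ∫ x, hazard T' x ∂(gpd ξ β) with hg'
  obtain ⟨S, -, hS⟩ := exists_forall_le_log_sub_lt (show 0 < g / 4 by positivity) m
  refine ⟨S, ?_⟩
  filter_upwards [ae_tendsto_mean hint, ae_firstObs_pos hξ hβ] with ω hω hpos
  filter_upwards [hω.eventually_const_lt (half_lt_self hg)] with n hn p hp hσ h2 h3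
  have h4 := avgLogLik_le_of_le (T := T') (fun i => (hpos n i).1.le) h3 (hp.1.trans (le_max_left _ _)) hσ h2
  have h5 := hS p.2 hp.2
  have h6 : g / 2 < avgHazard (firstObs n ω) T' := hn
  have h7 := mul_lt_mul_of_pos_left h6 (half_pos hσ)
  linarith

lemma exists_eventuallyBelow_small_sigma (hξ : -(1 / 2) < ξ) (hβ : 0 < β) (m : ℝ) :
    ∃ s > 0, EventuallyBelow (gpd ξ β) {p | p.2 ≤ s} m := by
  refine ⟨Real.exp m, Real.exp_pos m, ?_⟩
  filter_upwards [ae_firstObs_pos hξ hβ] with ω hpos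
  refine Eventually.of_forall fun n p hp hσ h2 h3 => ?_
  refine (avgLogLik_le_log (fun i => (hpos n i).1.le) h3 hσ h2).trans ?_
  exact (Real.log_le_log hσ hp).trans_eq (Real.log_exp m)

/-- Wald's local step: one law of large numbers, for the truncated hazard slightly to the right of
`p.1`, bounds the likelihood on a whole ball. -/
lemma exists_eventuallyBelow_nhds (hξ : -(1 / 2) < ξ) (hβ : 0 < β) {p : ℝ × ℝ} (hσ : 0 < p.2)
    (hστ : 0 ≤ p.2 + 2 * p.1) (hne : p ≠ (ξ / β, β⁻¹)) :
    ∃ t ∈ 𝓝 p, ∃ m < ∫ x, logDensity (ξ / β) β⁻¹ x ∂(gpd ξ β), EventuallyBelow (gpd ξ β) t m := by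
  have := isProbabilityMeasure_gpd (show -1 < ξ by linarith) hβ
  obtain ⟨k, hk⟩ := exists_truncHazard_lt hξ hβ hσ hστ fun h => hne (Prod.ext h.1 h.2)
  set g := ∫ x, truncHazard (p.1 + 1 / (k + 1)) k x ∂(gpd ξ β) with hg
  obtain ⟨m, hm1, hm2⟩ := exists_between hk
  have hlim : Tendsto (fun r : ℝ => Real.log (p.2 + r) - (p.2 + p.1 - 2 * r) * (g - r)) (𝓝[>] 0)
      (𝓝 (Real.log p.2 - (p.2 + p.1) * g)) := by
    have : ContinuousAt (fun r : ℝ => Real.log (p.2 + r) - (p.2 + p.1 - 2 * r) * (g - r)) 0 :=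
      ((continuousAt_const.add continuousAt_id).log (by simpa using hσ.ne')).sub (by fun_prop)
    simpa using this.tendsto.mono_left nhdsWithin_le_nhds
  have hk1 : (0 : ℝ) < 1 / (k + 1) := by positivity
  have hc : 0 < (p.2 + p.1) / 2 := by linarith
  have hnear : ∀ {b : ℝ}, 0 < b → ∀ᶠ r : ℝ in 𝓝[>] 0, r < b := fun hb =>
    mem_nhdsWithin_of_mem_nhds (Iio_mem_nhds hb)
  obtain ⟨r, ⟨hr1, hr2, hr3⟩, hr0⟩ := ((hlim.eventually_lt_const hm1).and
    ((hnear hk1).and (hnear hc))).and self_mem_nhdsWithin |>.exists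
  have hr0 : 0 < r := hr0
  refine ⟨Metric.ball p r, Metric.ball_mem_nhds p hr0, m, hm2, ?_⟩
  filter_upwards [ae_tendsto_mean (integrable_truncHazard (τ := p.1 + 1 / (k + 1)) hξ hβ
    k.cast_nonneg), ae_firstObs_pos hξ hβ] with ω hω hpos
  filter_upwards [hω.eventually_const_lt (sub_lt_self _ hr0)] with n hn q hq h1 h2 h3
  rw [Metric.mem_ball, Prod.dist_eq, max_lt_iff, Real.dist_eq, Real.dist_eq, abs_lt, abs_lt] at hq
  obtain ⟨⟨hq1, hq2⟩, hq3, hq4⟩ := hq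
  have hH : (n : ℝ)⁻¹ * ∑ i, truncHazard (p.1 + 1 / (k + 1)) k (firstObs n ω i) ≤
      avgHazard (firstObs n ω) q.1 :=
    mul_le_mul_of_nonneg_left (Finset.sum_le_sum fun i _ => truncHazard_le_hazard (hpos n i).1.le
      (h3 i) (by linarith)) (by positivity)
  have hH0 := avgHazard_nonneg (fun i => (hpos n i).1.le) h3
  have e1 := Real.log_le_log h1 (show q.2 ≤ p.2 + r by linarith)
  have e2 : (p.2 + p.1 - 2 * r) * (g - r) ≤ (q.2 + q.1) * avgHazard (firstObs n ω) q.1 :=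
    (mul_le_mul_of_nonneg_left (hn.le.trans hH) (by linarith)).trans
      (mul_le_mul_of_nonneg_right (by linarith) hH0)
  unfold avgLogLik
  linarith

/-- Away from the true parameter, the average log-likelihood is eventually below its value there. -/
theorem exists_eventuallyBelow_compl_ball (hξ : -(1 / 2) < ξ) (hβ : 0 < β) {δ : ℝ} (hδ : 0 < δ) :
    ∃ m < ∫ x, logDensity (ξ / β) β⁻¹ x ∂(gpd ξ β),
      EventuallyBelow (gpd ξ β) (Metric.ball (ξ / β, β⁻¹) δ)ᶜ m := by
  set m₀ := ∫ x, logDensity (ξ / β) β⁻¹ x ∂(gpd ξ β) with hm₀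
  obtain ⟨T, hT⟩ := exists_eventuallyBelow_large_tau hξ hβ (m₀ - 1)
  obtain ⟨S, hS⟩ := exists_eventuallyBelow_large_sigma hξ hβ T (m₀ - 1)
  obtain ⟨s, hs0, hs⟩ := exists_eventuallyBelow_small_sigma hξ hβ (m₀ - 1)
  -- What the three far regions leave over. The lower bound on `τ` comes from `τ ≥ -σ / 2` with `σ <
  -- S`.
  set K : Set (ℝ × ℝ) := (Set.Icc (-S) T ×ˢ Set.Icc s S ∩ {p | 0 ≤ p.2 + 2 * p.1}) ∩
    (Metric.ball (ξ / β, β⁻¹) δ)ᶜ with hK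
  have hKc : IsCompact K :=
    ((isCompact_Icc.prod isCompact_Icc).inter_right
      (isClosed_le continuous_const (by fun_prop))).inter_right Metric.isOpen_ball.isClosed_compl
  have hKm : ∃ m < m₀, EventuallyBelow (gpd ξ β) K m := by
    refine hKc.induction_on (p := fun t => ∃ m < m₀, EventuallyBelow (gpd ξ β) t m)
      ⟨m₀ - 1, sub_one_lt _, ?_⟩ ?_ ?_ ?_
    · exact ae_of_all _ fun ω => Eventually.of_forall fun n p hp => absurd hp (Set.notMem_empty p)
    · rintro a b hab ⟨m, hm, hb⟩
      exact ⟨m, hm, hb.mono hab le_rfl⟩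
    · rintro a b ⟨m, hm, ha⟩ ⟨m', hm', hb⟩
      exact ⟨max m m', max_lt hm hm', (ha.mono subset_rfl (le_max_left _ _)).union
        (hb.mono subset_rfl (le_max_right _ _))⟩
    · intro p hp
      obtain ⟨t, ht, h⟩ := exists_eventuallyBelow_nhds hξ hβ (hs0.trans_le hp.1.1.2.1) hp.1.2
        fun h => hp.2 (by rw [h]; exact Metric.mem_ball_self hδ)
      exact ⟨t, mem_nhdsWithin_of_mem_nhds ht, h⟩
  obtain ⟨m, hm, hKm⟩ := hKm
  refine ⟨max m (m₀ - 1), max_lt hm (sub_one_lt _), ?_⟩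
  have hall := ((hKm.mono subset_rfl (le_max_left m (m₀ - 1))).union
    (hT.mono subset_rfl (le_max_right _ _))).union
    ((hS.mono subset_rfl (le_max_right m _)).union (hs.mono subset_rfl (le_max_right _ _)))
  filter_upwards [hall] with ω hω
  filter_upwards [hω] with n hn p hp h1 h2 h3
  refine hn p ?_ h1 h2 h3
  by_cases c1 : T ≤ p.1
  · exact Or.inl (Or.inr c1)
  by_cases c2 : S ≤ p.2
  · exact Or.inr (Or.inl ⟨(not_le.1 c1).le, c2⟩)
  by_cases c3 : p.2 ≤ s
  · exact Or.inr (Or.inr c3)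
  push Not at c1 c2 c3
  exact Or.inl (Or.inl ⟨⟨⟨⟨by linarith, c1.le⟩, ⟨c3.le, c2.le⟩⟩, h2⟩, hp⟩)

lemma ae_tendsto_avgLogLik (hξ : -(1 / 2) < ξ) (hβ : 0 < β) :
    ∀ᵐ ω ∂(seqLaw (gpd ξ β)), Tendsto (fun n => avgLogLik (firstObs n ω) (ξ / β) β⁻¹) atTop
      (𝓝 (∫ x, logDensity (ξ / β) β⁻¹ x ∂(gpd ξ β))) := by
  have := isProbabilityMeasure_gpd (show -1 < ξ by linarith) hβ
  have hint := (integral_hazard hξ hβ).1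
  rw [integral_logDensity hξ hβ hint]
  filter_upwards [ae_tendsto_mean hint] with ω hω
  exact (hω.const_mul _).const_sub _

/-- Strong consistency. -/
theorem ae_eventually_mem_ball (hξ : -(1 / 2) < ξ) (hβ : 0 < β) {δ : ℝ} (hδ : 0 < δ) :
    ∀ᵐ ω ∂(seqLaw (gpd ξ β)), ∀ᶠ n in atTop, ∀ τ σ : ℝ, 0 < σ → 0 ≤ σ + 2 * τ →
      (∀ i, 0 < 1 + τ * firstObs n ω i) →
      avgLogLik (firstObs n ω) (ξ / β) β⁻¹ ≤ avgLogLik (firstObs n ω) τ σ →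
      |τ - ξ / β| < δ ∧ |σ - β⁻¹| < δ := by
  obtain ⟨m, hm, h⟩ := exists_eventuallyBelow_compl_ball hξ hβ hδ
  filter_upwards [h, ae_tendsto_avgLogLik hξ hβ] with ω hω hω'
  filter_upwards [hω, hω'.eventually_const_lt hm] with n hn hn' τ σ h1 h2 h3 h4
  by_contra hcon
  refine absurd (hn (τ, σ) ?_ h1 h2 h3) (not_le.2 (hn'.trans_le h4))
  rwa [Set.mem_compl_iff, Metric.mem_ball, Prod.dist_eq, max_lt_iff, Real.dist_eq, Real.dist_eq]

end Consistency

/-! ### Expansion of the log-likelihood at the true parameter -/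

section Expansion

/-- The mean of a function over a sample. -/
noncomputable def sampleMean {n : ℕ} (f : ℝ → ℝ) (x : Fin n → ℝ) : ℝ :=
  (n : ℝ)⁻¹ * ∑ i, f (x i)

lemma sampleMean_mono {n : ℕ} {f g : ℝ → ℝ} {x : Fin n → ℝ} (h : ∀ i, f (x i) ≤ g (x i)) :
    sampleMean f x ≤ sampleMean g x :=
  mul_le_mul_of_nonneg_left (Finset.sum_le_sum fun i _ => h i) (by positivity)

/-- Exact, with the score means as linear part; the only remaining nonlinearities are the logarithm
in `b` and the nonnegative means of `hazardRem`. -/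
lemma avgLogLik_add {n : ℕ} {x : Fin n → ℝ} {τ σ a b : ℝ} (hn : 0 < n) (hx : ∀ i, 0 ≤ x i)
    (h : ∀ i, 0 < 1 + τ * x i) (ha : ∀ i, 0 < 1 + (τ + a) * x i) :
    avgLogLik x (τ + a) (σ + b) - avgLogLik x τ σ =
      (Real.log (σ + b) - Real.log σ - b / σ) +
        (sampleMean (scoreTau τ σ) x * a + sampleMean (scoreSigma τ σ) x * b) -
        (a ^ 2 + a * b) * sampleMean (hazardDeriv τ) x -
        (σ + τ + a + b) * sampleMean (hazardRem τ a) x * a ^ 2 := by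
  have hn' : (n : ℝ) ≠ 0 := by positivity
  have h1 : avgHazard x (τ + a) = avgHazard x τ + a * sampleMean (hazardDeriv τ) x +
      a ^ 2 * sampleMean (hazardRem τ a) x := by
    simp only [avgHazard, sampleMean]
    rw [Finset.sum_congr rfl fun i _ => hazard_add (hx i) (h i) (ha i)]
    simp only [Finset.sum_add_distrib, ← Finset.mul_sum]
    ring
  have h2 : sampleMean (scoreTau τ σ) x =
      -avgHazard x τ - (σ + τ) * sampleMean (hazardDeriv τ) x := by
    simp only [avgHazard, sampleMean, scoreTau, Finset.sum_sub_distrib, Finset.sum_neg_distrib,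
      ← Finset.mul_sum]
    ring
  have h3 : sampleMean (scoreSigma τ σ) x = σ⁻¹ - avgHazard x τ := by
    simp only [avgHazard, sampleMean, scoreSigma, Finset.sum_sub_distrib]
    simp
    field_simp
  rw [h2, h3]
  simp only [avgLogLik, h1]
  ring

lemma exists_abs_log_add_sub_le {σ ε : ℝ} (hσ : 0 < σ) (hε : 0 < ε) :
    ∃ δ > 0, ∀ b, |b| ≤ δ →
      |Real.log (σ + b) - Real.log σ - b / σ + b ^ 2 / (2 * σ ^ 2)| ≤ ε * b ^ 2 := by
  -- For `|b| ≤ σ / 2` the third order Taylor error is at most `2 |b / σ| ^ 3`; the second bound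
  -- turns this into `ε b ^ 2`.
  refine ⟨min (σ / 2) (ε * σ ^ 3 / 2), by positivity, fun b hb => ?_⟩
  have hb1 : |b| ≤ σ / 2 := hb.trans (min_le_left _ _)
  have hb2 : |b| ≤ ε * σ ^ 3 / 2 := hb.trans (min_le_right _ _)
  have ht : |-(b / σ)| ≤ 1 / 2 := by
    rw [abs_neg, abs_div, abs_of_pos hσ, div_le_iff₀ hσ]; linarith
  have h := Real.abs_log_sub_add_sum_range_le (x := -(b / σ)) (ht.trans_lt (by norm_num)) 2
  have hlog : Real.log (σ + b) - Real.log σ = Real.log (1 - -(b / σ)) := by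
    rw [← Real.log_div _ hσ.ne']
    · congr 1; field_simp; ring
    · have := neg_abs_le b
      intro h0
      linarith
  have heq : Real.log (σ + b) - Real.log σ - b / σ + b ^ 2 / (2 * σ ^ 2) =
      (∑ i ∈ Finset.range 2, (-(b / σ)) ^ (i + 1) / ((i : ℝ) + 1)) + Real.log (1 - -(b / σ)) := by
    rw [hlog]
    simp [Finset.sum_range_succ]
    field_simp
    ring
  rw [heq]
  refine h.trans ?_
  rw [div_le_iff₀ (by linarith)]
  have h3 : |-(b / σ)| ^ (2 + 1) = |b| * b ^ 2 / σ ^ 3 := by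
    rw [abs_neg, abs_div, abs_of_pos hσ, ← sq_abs b]; ring
  rw [h3, div_le_iff₀ (by positivity)]
  have h4 := mul_le_mul_of_nonneg_right hb2 (sq_nonneg b)
  have h5 : (1 : ℝ) / 2 ≤ 1 - |-(b / σ)| := by linarith
  have h6 := mul_le_mul_of_nonneg_left h5 (show 0 ≤ ε * b ^ 2 * σ ^ 3 by positivity)
  calc |b| * b ^ 2 ≤ ε * σ ^ 3 / 2 * b ^ 2 := h4
    _ = ε * b ^ 2 * σ ^ 3 * (1 / 2) := by ring
    _ ≤ ε * b ^ 2 * σ ^ 3 * (1 - |-(b / σ)|) := h6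
    _ = _ := by ring

variable {ξ β : ℝ}

lemma ae_tendsto_sampleMean (hξ : -(1 / 2) < ξ) (hβ : 0 < β) {f : ℝ → ℝ}
    (hf : Integrable f (gpd ξ β)) :
    ∀ᵐ ω ∂(seqLaw (gpd ξ β)), Tendsto (fun n => sampleMean f (firstObs n ω)) atTop
      (𝓝 (∫ x, f x ∂(gpd ξ β))) := by
  have := isProbabilityMeasure_gpd (show -1 < ξ by linarith) hβ
  exact ae_tendsto_mean hf

/-- Damping the remainder of the hazard changes its mean only slightly. -/
lemma tendsto_integral_hazardRem_div (hξ : -(1 / 2) < ξ) (hβ : 0 < β) :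
    (∀ k : ℕ, Integrable (fun x => hazardRem (ξ / β) 0 x /
      (1 + 1 / ((k : ℝ) + 1) * (x / (1 + ξ / β * x)))) (gpd ξ β)) ∧
    Tendsto (fun k : ℕ => ∫ x, hazardRem (ξ / β) 0 x /
      (1 + 1 / ((k : ℝ) + 1) * (x / (1 + ξ / β * x))) ∂(gpd ξ β)) atTop
      (𝓝 (∫ x, hazardRem (ξ / β) 0 x ∂(gpd ξ β))) := by
  have hm : ∀ k : ℕ, AEStronglyMeasurable (fun x => hazardRem (ξ / β) 0 x /
      (1 + 1 / ((k : ℝ) + 1) * (x / (1 + ξ / β * x)))) (gpd ξ β) := fun k =>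
    Measurable.aestronglyMeasurable (by fun_prop)
  have hpos : ∀ᵐ x ∂(gpd ξ β), 0 < x ∧ 0 < 1 + ξ / β * x := by
    filter_upwards [ae_gpd_pos (ξ := ξ) (by linarith) hβ] with x hx
    exact ⟨hx.1, one_add_div_mul_pos_iff.2 hx.2⟩
  have hb : ∀ k : ℕ, ∀ᵐ x ∂(gpd ξ β), ‖hazardRem (ξ / β) 0 x /
      (1 + 1 / ((k : ℝ) + 1) * (x / (1 + ξ / β * x)))‖ ≤ hazardRem (ξ / β) 0 x := fun k => by
    filter_upwards [hpos] with x hx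
    have h1 := hazardRem_nonneg hx.1.le hx.2 (a := 0) (by simpa using hx.2)
    have h2 : 0 ≤ 1 / ((k : ℝ) + 1) * (x / (1 + ξ / β * x)) :=
      mul_nonneg (by positivity) (div_nonneg hx.1.le hx.2.le)
    rw [Real.norm_of_nonneg (by positivity)]
    exact div_le_self h1 (by linarith)
  refine ⟨fun k => (integral_hazardRem hξ hβ).1.mono' (hm k) (hb k),
    tendsto_integral_of_dominated_convergence _ hm (integral_hazardRem hξ hβ).1 hb
      (ae_of_all _ fun x => ?_)⟩
  have h1 : Tendsto (fun k : ℕ => 1 + 1 / ((k : ℝ) + 1) * (x / (1 + ξ / β * x))) atTop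
      (𝓝 (1 + 0 * (x / (1 + ξ / β * x)))) :=
    (tendsto_one_div_add_atTop_nhds_zero_nat.mul_const _).const_add 1
  rw [zero_mul, add_zero] at h1
  have h2 : Tendsto (fun k : ℕ => hazardRem (ξ / β) 0 x /
      (1 + 1 / ((k : ℝ) + 1) * (x / (1 + ξ / β * x)))) atTop (𝓝 (hazardRem (ξ / β) 0 x / 1)) :=
    tendsto_const_nhds.div h1 one_ne_zero
  rwa [div_one] at h2

/-- The quadratic part of the expansion of the log-likelihood. -/
noncomputable def logLikQuad (ξ β a b : ℝ) : ℝ :=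
  b ^ 2 / (2 * β⁻¹ ^ 2) + (a ^ 2 + a * b) * ∫ x, hazardDeriv (ξ / β) x ∂(gpd ξ β) +
    (β⁻¹ + ξ / β) * (∫ x, hazardRem (ξ / β) 0 x ∂(gpd ξ β)) * a ^ 2

/-- The linear part of the expansion of the log-likelihood. -/
noncomputable def logLikLin (ξ β : ℝ) {n : ℕ} (x : Fin n → ℝ) (a b : ℝ) : ℝ :=
  sampleMean (scoreTau (ξ / β) β⁻¹) x * a + sampleMean (scoreSigma (ξ / β) β⁻¹) x * b

lemma abs_cross_le {d e a b : ℝ} (h : |d| ≤ e) :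
    |(a ^ 2 + a * b) * d| ≤ 3 / 2 * e * (a ^ 2 + b ^ 2) := by
  rw [abs_mul]
  have h1 : |a ^ 2 + a * b| ≤ 3 / 2 * (a ^ 2 + b ^ 2) := by
    rw [abs_le]
    constructor <;> nlinarith [sq_nonneg (a - b), sq_nonneg (a + b), sq_nonneg a, sq_nonneg b]
  calc |a ^ 2 + a * b| * |d| ≤ 3 / 2 * (a ^ 2 + b ^ 2) * e :=
        mul_le_mul h1 h (abs_nonneg _) (by positivity)
    _ = _ := by ring

/-- The remainder is subtracted, so only a lower bound on it is needed, and `hazardRem_div_le` gives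
one uniformly over all admissible `a ≤ δ`. Proximity to the edge of the support only lowers the
likelihood. -/
theorem ae_eventually_avgLogLik_le (hξ : -(1 / 2) < ξ) (hβ : 0 < β) {ε : ℝ} (hε : 0 < ε) :
    ∃ δ > 0, ∀ᵐ ω ∂(seqLaw (gpd ξ β)), ∀ᶠ n in atTop, ∀ a b : ℝ, |a| ≤ δ → |b| ≤ δ →
      (∀ i, 0 < 1 + (ξ / β + a) * firstObs n ω i) →
      avgLogLik (firstObs n ω) (ξ / β + a) (β⁻¹ + b) - avgLogLik (firstObs n ω) (ξ / β) β⁻¹ ≤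
        logLikLin ξ β (firstObs n ω) a b - logLikQuad ξ β a b + ε * (a ^ 2 + b ^ 2) := by
  have hσ : 0 < β⁻¹ := inv_pos.2 hβ
  have hc : 0 < β⁻¹ + ξ / β := by
    rw [inv_eq_one_div, ← add_div]; exact div_pos (by linarith) hβ
  obtain ⟨δ₁, hδ₁, hlog⟩ := exists_abs_log_add_sub_le hσ (show 0 < ε / 3 by positivity)
  obtain ⟨hint, hlim⟩ := tendsto_integral_hazardRem_div hξ hβ
  set ρ := ∫ x, hazardRem (ξ / β) 0 x ∂(gpd ξ β) with hρ
  set g := ∫ x, hazardDeriv (ξ / β) x ∂(gpd ξ β) with hg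
  set c := β⁻¹ + ξ / β with hc'
  have h0 := tendsto_one_div_add_atTop_nhds_zero_nat (𝕜 := ℝ)
  have hlim2 := ((h0.const_mul 2).const_sub c).mul (hlim.sub h0)
  have hlim3 := (h0.const_mul 2).const_sub c
  rw [mul_zero, sub_zero, sub_zero] at hlim2
  rw [mul_zero, sub_zero] at hlim3
  -- `δ = 1 / (k + 1)` serves at once as damping parameter, box size and margin in the law of large
  -- numbers.
  obtain ⟨k, hk1, hk2, hk3⟩ := ((hlim2.eventually_const_lt
    (show c * ρ - ε / 3 < c * ρ by linarith)).and ((hlim3.eventually_const_lt hc).and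
    (h0.eventually_lt_const hδ₁))).exists
  set δ : ℝ := 1 / ((k : ℝ) + 1) with hδ
  have hδ0 : 0 < δ := by positivity
  refine ⟨δ, hδ0, ?_⟩
  filter_upwards [ae_firstObs_pos hξ hβ, ae_tendsto_sampleMean hξ hβ (hint k),
    ae_tendsto_sampleMean hξ hβ (integral_hazardDeriv hξ hβ).1] with ω hpos hω1 hω2
  have hω2' := (hω2.sub_const g).abs
  rw [sub_self, abs_zero] at hω2'
  filter_upwards [hω1.eventually_const_lt (sub_lt_self _ hδ0),
    hω2'.eventually_lt_const (show 0 < ε / 6 by positivity), eventually_gt_atTop 0]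
    with n hn1 hn2 hn0 a b ha hb hadm
  rw [avgLogLik_add hn0 (fun i => (hpos n i).1.le) (fun i => (hpos n i).2) hadm]
  have hR : sampleMean (fun x => hazardRem (ξ / β) 0 x /
      (1 + δ * (x / (1 + ξ / β * x)))) (firstObs n ω) ≤
      sampleMean (hazardRem (ξ / β) a) (firstObs n ω) :=
    sampleMean_mono fun i => hazardRem_div_le (hpos n i).1.le (hpos n i).2 (hadm i) hδ0.le
      ((le_abs_self a).trans ha)
  have hR0 : 0 ≤ sampleMean (hazardRem (ξ / β) a) (firstObs n ω) :=
    mul_nonneg (by positivity) (Finset.sum_nonneg fun i _ =>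
      hazardRem_nonneg (hpos n i).1.le (hpos n i).2 (hadm i))
  set R := sampleMean (hazardRem (ξ / β) a) (firstObs n ω)
  set D := sampleMean (hazardDeriv (ξ / β)) (firstObs n ω)
  have e1 : c * ρ - ε / 3 ≤ (c + a + b) * R :=
    (hk1.le.trans (mul_le_mul_of_nonneg_left (hn1.le.trans hR) hk2.le)).trans
      (mul_le_mul_of_nonneg_right (by linarith [(abs_le.1 ha).1, (abs_le.1 hb).1]) hR0)
  have e2 := mul_le_mul_of_nonneg_right e1 (sq_nonneg a)
  have e3 := (abs_le.1 (abs_cross_le (a := a) (b := b) hn2.le)).1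
  have e4 := (abs_le.1 (hlog b (hb.trans hk3.le))).2
  have e5 := mul_nonneg hε.le (sq_nonneg a)
  have e6 := mul_nonneg hε.le (sq_nonneg b)
  simp only [logLikLin, logLikQuad, ← hρ, ← hg, ← hc']
  linarith

/-- Here the remainder must be bounded above, which fails near the edge of the support; the extra
condition linking `a` to the sample keeps away from it. -/
theorem ae_eventually_le_avgLogLik (hξ : -(1 / 2) < ξ) (hβ : 0 < β) {ε : ℝ} (hε : 0 < ε) :
    ∃ η > 0, ∀ᵐ ω ∂(seqLaw (gpd ξ β)), ∀ᶠ n in atTop, ∀ a b : ℝ, |a| ≤ η → |b| ≤ η →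
      (∀ i, |a| * (firstObs n ω i / (1 + ξ / β * firstObs n ω i)) ≤ η) →
      (∀ i, 0 < 1 + (ξ / β + a) * firstObs n ω i) ∧
      logLikLin ξ β (firstObs n ω) a b - logLikQuad ξ β a b - ε * (a ^ 2 + b ^ 2) ≤
        avgLogLik (firstObs n ω) (ξ / β + a) (β⁻¹ + b) - avgLogLik (firstObs n ω) (ξ / β) β⁻¹ := by
  have hσ : 0 < β⁻¹ := inv_pos.2 hβ
  have hc : 0 < β⁻¹ + ξ / β := by
    rw [inv_eq_one_div, ← add_div]; exact div_pos (by linarith) hβ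
  obtain ⟨δ₁, hδ₁, hlog⟩ := exists_abs_log_add_sub_le hσ (show 0 < ε / 3 by positivity)
  set ρ := ∫ x, hazardRem (ξ / β) 0 x ∂(gpd ξ β) with hρ
  set g := ∫ x, hazardDeriv (ξ / β) x ∂(gpd ξ β) with hg
  set c := β⁻¹ + ξ / β with hc'
  have hcont : ContinuousAt (fun η : ℝ => (c + 2 * η) * ((ρ + η) / (1 - η))) 0 :=
    ContinuousAt.mul (by fun_prop) (ContinuousAt.div (by fun_prop) (by fun_prop) (by simp))
  have hlim := hcont.tendsto.mono_left (nhdsWithin_le_nhds (s := Set.Ioi 0))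
  simp only [mul_zero, add_zero, sub_zero, div_one] at hlim
  have hnear : ∀ {b : ℝ}, 0 < b → ∀ᶠ r : ℝ in 𝓝[>] 0, r < b := fun hb =>
    mem_nhdsWithin_of_mem_nhds (Iio_mem_nhds hb)
  obtain ⟨η, ⟨hη1, hη2, hη3⟩, hη0⟩ := ((hlim.eventually_lt_const
    (show c * ρ < c * ρ + ε / 3 by linarith)).and
    ((hnear hδ₁).and (hnear one_pos))).and self_mem_nhdsWithin |>.exists
  have hη0 : 0 < η := hη0
  refine ⟨η, hη0, ?_⟩
  filter_upwards [ae_firstObs_pos hξ hβ, ae_tendsto_sampleMean hξ hβ (integral_hazardRem hξ hβ).1,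
    ae_tendsto_sampleMean hξ hβ (integral_hazardDeriv hξ hβ).1] with ω hpos hω1 hω2
  have hω2' := (hω2.sub_const g).abs
  rw [sub_self, abs_zero] at hω2'
  filter_upwards [hω1.eventually_lt_const (lt_add_of_pos_right _ hη0),
    hω2'.eventually_lt_const (show 0 < ε / 6 by positivity), eventually_gt_atTop 0]
    with n hn1 hn2 hn0 a b ha hb hadm'
  have hrem := fun i => hazardRem_le_div (hpos n i).1.le (hpos n i).2 hη3 (hadm' i)
  refine ⟨fun i => (hrem i).1, ?_⟩
  rw [avgLogLik_add hn0 (fun i => (hpos n i).1.le) (fun i => (hpos n i).2) fun i => (hrem i).1]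
  have hR : sampleMean (hazardRem (ξ / β) a) (firstObs n ω) ≤
      sampleMean (hazardRem (ξ / β) 0) (firstObs n ω) / (1 - η) := by
    refine (sampleMean_mono (g := fun x => hazardRem (ξ / β) 0 x / (1 - η))
      fun i => (hrem i).2).trans_eq ?_
    simp only [sampleMean, ← Finset.sum_div]
    ring
  have hR0 : 0 ≤ sampleMean (hazardRem (ξ / β) a) (firstObs n ω) :=
    mul_nonneg (by positivity) (Finset.sum_nonneg fun i _ =>
      hazardRem_nonneg (hpos n i).1.le (hpos n i).2 (hrem i).1)
  have hR1 := hR.trans (div_le_div_of_nonneg_right hn1.le (by linarith))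
  set R := sampleMean (hazardRem (ξ / β) a) (firstObs n ω)
  set D := sampleMean (hazardDeriv (ξ / β)) (firstObs n ω)
  have e1 : (c + a + b) * R ≤ c * ρ + ε / 3 :=
    ((mul_le_mul_of_nonneg_right (by linarith [(abs_le.1 ha).2, (abs_le.1 hb).2]) hR0).trans
      (mul_le_mul_of_nonneg_left hR1 (by positivity))).trans hη1.le
  have e2 := mul_le_mul_of_nonneg_right e1 (sq_nonneg a)
  have e3 := (abs_le.1 (abs_cross_le (a := a) (b := b) hn2.le)).2
  have e4 := (abs_le.1 (hlog b (hb.trans hη2.le))).1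
  have e5 := mul_nonneg hε.le (sq_nonneg a)
  have e6 := mul_nonneg hε.le (sq_nonneg b)
  simp only [logLikLin, logLikQuad, ← hρ, ← hg, ← hc']
  linarith

end Expansion

/-! ### Comparison of quadratic maximizers -/

lemma exists_pos_mul_sq_le_quadratic {A B C : ℝ} (hA : 0 < A) (hdet : B ^ 2 < 4 * A * C) :
    ∃ κ > 0, ∀ u v : ℝ, κ * (u ^ 2 + v ^ 2) ≤ A * u ^ 2 + B * (u * v) + C * v ^ 2 := by
  have hC : 0 < C := by
    by_contra h
    nlinarith [sq_nonneg B]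
  -- Determinant over trace, a lower bound for the smaller eigenvalue of the form.
  set κ := (A * C - B ^ 2 / 4) / (A + C) with hκ
  have h1 : κ * (A + C) = A * C - B ^ 2 / 4 := div_mul_cancel₀ _ (by positivity)
  have hκ0 : 0 < κ := div_pos (by linarith) (by positivity)
  refine ⟨κ, hκ0, fun u v => ?_⟩
  have h2 : 0 < A - κ := by
    have : 0 < (A - κ) * (A + C) := by nlinarith [sq_nonneg B]
    exact (pos_iff_pos_of_mul_pos this).2 (by positivity)
  have h3 : 0 ≤ (A - κ) * (A * u ^ 2 + B * (u * v) + C * v ^ 2 - κ * (u ^ 2 + v ^ 2)) := by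
    have : (A - κ) * (A * u ^ 2 + B * (u * v) + C * v ^ 2 - κ * (u ^ 2 + v ^ 2)) =
        ((A - κ) * u + B / 2 * v) ^ 2 + (κ * v) ^ 2 := by linear_combination (-v ^ 2) * h1
    rw [this]
    positivity
  have h4 := nonneg_of_mul_nonneg_right h3 h2
  linarith

/-- A point which does at least as well as the maximizer `(a', b')` of a quadratic function
approximating the objective is close to it. -/
lemma sq_dist_le_of_quadratic_approx {A B C κ ε a b a' b' s t F F' : ℝ}
    (hq : ∀ u v : ℝ, κ * (u ^ 2 + v ^ 2) ≤ A * u ^ 2 + B * (u * v) + C * v ^ 2)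
    (hs : s = 2 * A * a' + B * b') (ht : t = B * a' + 2 * C * b')
    (hF : F ≤ s * a + t * b - (A * a ^ 2 + B * (a * b) + C * b ^ 2) + ε * (a ^ 2 + b ^ 2))
    (hF' : s * a' + t * b' - (A * a' ^ 2 + B * (a' * b') + C * b' ^ 2) -
      ε * (a' ^ 2 + b' ^ 2) ≤ F') (hle : F' ≤ F) (hε : 0 ≤ ε) (hκ : 4 * ε ≤ κ) :
    κ * ((a - a') ^ 2 + (b - b') ^ 2) ≤ 6 * ε * (a' ^ 2 + b' ^ 2) := by
  have h1 := hq (a - a') (b - b')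
  -- `(s, t)` is the gradient of the form at `(a', b')`, so completing the square leaves the form at
  -- the difference. The term in `(a, b)` is then absorbed using `4 ε ≤ κ`.
  have h2 : κ * ((a - a') ^ 2 + (b - b') ^ 2) ≤ ε * (a ^ 2 + b ^ 2) + ε * (a' ^ 2 + b' ^ 2) := by
    rw [hs, ht] at hF hF'
    linarith
  have h3 : a ^ 2 + b ^ 2 ≤ 2 * ((a - a') ^ 2 + (b - b') ^ 2) + 2 * (a' ^ 2 + b' ^ 2) := by
    nlinarith [sq_nonneg (a - 2 * a'), sq_nonneg (b - 2 * b')]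
  have h4 := mul_le_mul_of_nonneg_left h3 hε
  have h5 := mul_le_mul_of_nonneg_right hκ (show 0 ≤ (a - a') ^ 2 + (b - b') ^ 2 by positivity)
  linarith

/-! ### The maximum likelihood estimator is asymptotically linear -/

section AsymptoticLinearity

variable {ξ β : ℝ}

lemma gpdParam_coord_pos (hξ : -(1 / 2) < ξ) (hβ : 0 < β) : 0 < β⁻¹ + 2 * (ξ / β) := by
  have : β⁻¹ + 2 * (ξ / β) = (1 + 2 * ξ) / β := by field_simp
  rw [this]
  exact div_pos (by linarith) hβ

/-- Almost surely the likelihood eventually has a maximizer. -/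
lemma ae_eventually_exists_isMaxOn (hξ : -(1 / 2) < ξ) (hβ : 0 < β) :
    ∀ᵐ ω ∂(seqLaw (gpd ξ β)), ∀ᶠ n in atTop, ∃ θ ∈ gpdParamSet,
      IsMaxOn (gpdLikelihood (firstObs n ω)) gpdParamSet θ := by
  have hd := gpdParam_coord_pos hξ hβ
  have hσ : 0 < β⁻¹ := inv_pos.2 hβ
  set τ₀ := ξ / β with hτ₀
  set σ₀ := β⁻¹ with hσ₀
  set d := σ₀ + 2 * τ₀ with hd'
  have hδ : 0 < min σ₀ d / 6 := by positivity
  filter_upwards [ae_eventually_mem_ball hξ hβ hδ, ae_firstObs_pos hξ hβ] with ω hω hpos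
  filter_upwards [hω, eventually_gt_atTop 0] with n hn hn0
  set θ₀ : GPDParam := !₂[ξ, β] with hθ₀
  have e0 : θ₀ 0 = ξ := rfl
  have e1 : θ₀ 1 = β := rfl
  have hadm₀ : ∀ i, 0 < 1 + θ₀ 0 / θ₀ 1 * firstObs n ω i := fun i => (hpos n i).2
  refine exists_isMaxOn_gpdLikelihood (fun i => (hpos n i).1) (θ₀ := θ₀)
    -- Consistency gives `σ + 2 τ > d / 2` and `σ₀ / 2 < σ < 2 σ₀`, so `ξ + 1/2 = (σ + 2 τ) / (2 σ)`
    -- is at least `d / (8 σ₀)`.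
    (isCompact_gpdParam_box (-(1 / 2) + d / (8 * σ₀)) ((|τ₀| + d) / (σ₀ / 2)) (1 / (2 * σ₀))
      (2 / σ₀)) (fun θ hθ => ?_) ⟨hξ, hβ⟩ fun θ hθ hK => ?_
  · have h1 : 0 < d / (8 * σ₀) := by positivity
    exact ⟨by linarith [hθ.1.1], lt_of_lt_of_le (by positivity) hθ.2.1⟩
  · by_contra hle
    rw [not_lt] at hle
    have hc := gpdParamSet_coord hθ
    have hθ1 : 0 < θ 1 := hθ.2
    rw [gpdLikelihood_eq_exp hn0 hβ (fun i => (hpos n i).1) hadm₀] at hle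
    have hadm : ∀ i, 0 < 1 + θ 0 / θ 1 * firstObs n ω i := by
      by_contra h
      rw [gpdLikelihood_eq_zero (by linarith [hθ.1]) h] at hle
      exact absurd hle (not_le.2 (Real.exp_pos _))
    rw [gpdLikelihood_eq_exp hn0 hθ1 (fun i => (hpos n i).1) hadm, Real.exp_le_exp] at hle
    obtain ⟨h1, h2⟩ := hn _ _ hc.1 hc.2.le hadm
      (le_of_mul_le_mul_left hle (by exact_mod_cast hn0))
    have hm1 := min_le_left σ₀ d
    have hm2 := min_le_right σ₀ d
    rw [abs_lt] at h1 h2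
    have h3 := le_abs_self τ₀
    have e2 : θ 0 = θ 0 / θ 1 / (θ 1)⁻¹ := by field_simp
    have e3 : θ 1 = 1 / (θ 1)⁻¹ := by field_simp
    refine hK ⟨⟨?_, ?_⟩, ?_, ?_⟩
    · rw [e2, le_div_iff₀ hc.1]
      have h4 : d / (8 * σ₀) * (θ 1)⁻¹ ≤ d / (8 * σ₀) * (2 * σ₀) :=
        mul_le_mul_of_nonneg_left (by linarith) (by positivity)
      have h5 : d / (8 * σ₀) * (2 * σ₀) = d / 4 := by field_simp; norm_num
      linarith
    · rw [e2]
      exact div_le_div₀ (by positivity) (by linarith) (by positivity) (by linarith)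
    · rw [e3]
      exact one_div_le_one_div_of_le hc.1 (by linarith)
    · rw [e3, div_le_div_iff₀ hc.1 hσ]
      linarith

/-- Carries the maximizing property to the coordinates `(τ, σ)`. The estimate is admissible because
the likelihood at the true parameter is positive. -/
lemma ae_eventually_isMLE (hξ : -(1 / 2) < ξ) (hβ : 0 < β) {T : GPDEstimator} (hT : IsMLE T) :
    ∀ᵐ ω ∂(seqLaw (gpd ξ β)), ∀ᶠ n in atTop, 0 < T.toFun n (firstObs n ω) 1 ∧
      0 < (T.toFun n (firstObs n ω) 1)⁻¹ +
        2 * (T.toFun n (firstObs n ω) 0 / T.toFun n (firstObs n ω) 1) ∧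
      (∀ i, 0 < 1 + T.toFun n (firstObs n ω) 0 / T.toFun n (firstObs n ω) 1 * firstObs n ω i) ∧
      ∀ τ σ : ℝ, 0 < σ → 0 < σ + 2 * τ → (∀ i, 0 < 1 + τ * firstObs n ω i) →
        avgLogLik (firstObs n ω) τ σ ≤ avgLogLik (firstObs n ω)
          (T.toFun n (firstObs n ω) 0 / T.toFun n (firstObs n ω) 1)
          (T.toFun n (firstObs n ω) 1)⁻¹ := by
  filter_upwards [ae_eventually_exists_isMaxOn hξ hβ, ae_firstObs_pos hξ hβ] with ω hω hpos
  filter_upwards [hω, eventually_gt_atTop 0] with n hn hn0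
  obtain ⟨hmem, hmax⟩ := hT n _ hn
  set θ := T.toFun n (firstObs n ω)
  have hx : ∀ i, 0 < firstObs n ω i := fun i => (hpos n i).1
  have hθ1 : 0 < θ 1 := hmem.2
  have key : ∀ τ σ : ℝ, 0 < σ → 0 < σ + 2 * τ → (∀ i, 0 < 1 + τ * firstObs n ω i) →
      Real.exp (n * avgLogLik (firstObs n ω) τ σ) ≤ gpdLikelihood (firstObs n ω) θ := by
    intro τ σ hσ hστ hadm
    set θ' : GPDParam := !₂[τ / σ, σ⁻¹] with hθ'
    have e0 : θ' 0 = τ / σ := rfl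
    have e1 : θ' 1 = σ⁻¹ := rfl
    have e2 : θ' 0 / θ' 1 = τ := by rw [e0, e1]; field_simp
    have hmem' : θ' ∈ gpdParamSet := by
      refine ⟨?_, ?_⟩
      · rw [e0, lt_div_iff₀ hσ]; linarith
      · rw [e1]; exact inv_pos.2 hσ
    have := hmax hmem'
    rw [Set.mem_ofPred_eq, gpdLikelihood_eq_exp hn0 hmem'.2 hx (by rwa [e2]), e2, e1,
      inv_inv] at this
    exact this
  have hadm : ∀ i, 0 < 1 + θ 0 / θ 1 * firstObs n ω i := by
    by_contra h
    have := key (ξ / β) β⁻¹ (inv_pos.2 hβ) (gpdParam_coord_pos hξ hβ) fun i => (hpos n i).2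
    rw [gpdLikelihood_eq_zero (by linarith [hmem.1]) h] at this
    exact absurd this (not_le.2 (Real.exp_pos _))
  refine ⟨hθ1, (gpdParamSet_coord hmem).2, hadm, fun τ σ hσ hστ h => ?_⟩
  have := key τ σ hσ hστ h
  rw [gpdLikelihood_eq_exp hn0 hθ1 hx hadm, Real.exp_le_exp] at this
  exact le_of_mul_le_mul_left this (by exact_mod_cast hn0)

lemma logLikQuad_eq (hξ : -(1 / 2) < ξ) (hβ : 0 < β) (a b : ℝ) :
    logLikQuad ξ β a b = β ^ 2 / ((1 + ξ) * (1 + 2 * ξ)) * a ^ 2 +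
      -(β ^ 2 / (1 + ξ)) * (a * b) + β ^ 2 / 2 * b ^ 2 := by
  have h1 : 1 + ξ ≠ 0 := by linarith
  have h2 : 1 + 2 * ξ ≠ 0 := by linarith
  rw [logLikQuad, (integral_hazardDeriv hξ hβ).2, (integral_hazardRem hξ hβ).2]
  field_simp
  ring

/-- The discriminant gap is `β ^ 4 / ((1 + ξ) ^ 2 (1 + 2 ξ))`, positive again by `ξ > -1/2`. -/
lemma exists_logLikQuad_bound (hξ : -(1 / 2) < ξ) (hβ : 0 < β) :
    ∃ κ > 0, ∀ u v : ℝ, κ * (u ^ 2 + v ^ 2) ≤ β ^ 2 / ((1 + ξ) * (1 + 2 * ξ)) * u ^ 2 +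
      -(β ^ 2 / (1 + ξ)) * (u * v) + β ^ 2 / 2 * v ^ 2 := by
  have h1 : 0 < 1 + ξ := by linarith
  have h2 : 0 < 1 + 2 * ξ := by linarith
  refine exists_pos_mul_sq_le_quadratic (by positivity) ?_
  have h3 : 4 * (β ^ 2 / ((1 + ξ) * (1 + 2 * ξ))) * (β ^ 2 / 2) - (-(β ^ 2 / (1 + ξ))) ^ 2 =
      β ^ 4 / ((1 + ξ) ^ 2 * (1 + 2 * ξ)) := by
    have h2' : 1 + ξ * 2 ≠ 0 := by linarith
    field_simp
    ring
  have h4 : 0 < β ^ 4 / ((1 + ξ) ^ 2 * (1 + 2 * ξ)) := by positivity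
  linarith

/-- The error of the linearization of `(τ, σ) ↦ (τ / σ, 1 / σ)`. -/
lemma exists_linearization_bound (τ : ℝ) {σ : ℝ} (hσ : 0 < σ) :
    ∃ M > 0, ∀ a b a' b' : ℝ, |b| ≤ σ / 2 →
      |(τ + a) / (σ + b) - τ / σ - (a' * σ - b' * τ) / σ ^ 2| ≤
        M * (|a - a'| + |b - b'| + |b| * (|a'| + |b'|)) ∧
      |1 / (σ + b) - 1 / σ + b' / σ ^ 2| ≤
        M * (|a - a'| + |b - b'| + |b| * (|a'| + |b'|)) := by
  set L := (σ + |τ|) * (σ + 1) + 1 with hL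
  have hτ := abs_nonneg τ
  refine ⟨L / (σ ^ 3 / 2), by positivity, fun a b a' b' hb => ?_⟩
  have hb1 : σ / 2 ≤ σ + b := by linarith [neg_abs_le b]
  have hσb : 0 < σ + b := by linarith
  have hden : σ ^ 3 / 2 ≤ σ ^ 2 * (σ + b) := by nlinarith [sq_nonneg σ]
  have h1 := abs_nonneg (a - a')
  have h2 := abs_nonneg (b - b')
  have h3 := abs_nonneg a'
  have h4 := abs_nonneg b'
  have h5 := abs_nonneg b
  have hbound : ∀ N : ℝ, |N| ≤ L * (|a - a'| + |b - b'| + |b| * (|a'| + |b'|)) →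
      |N / (σ ^ 2 * (σ + b))| ≤
        L / (σ ^ 3 / 2) * (|a - a'| + |b - b'| + |b| * (|a'| + |b'|)) := by
    intro N hN
    rw [abs_div, abs_of_pos (show 0 < σ ^ 2 * (σ + b) by positivity), div_mul_eq_mul_div]
    exact div_le_div₀ (by positivity) hN (by positivity) hden
  have hA := mul_nonneg h5 h3
  have hB := mul_nonneg h5 h4
  have hL1 : σ * (σ + |τ|) ≤ L := by nlinarith
  have hL2 : σ + |τ| ≤ L := by nlinarith
  have hL3 : σ ≤ L := by nlinarith
  have hL4 : 1 ≤ L := by nlinarith [mul_nonneg (add_nonneg hσ.le hτ) (by linarith : 0 ≤ σ + 1)]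
  constructor
  · have heq : (τ + a) / (σ + b) - τ / σ - (a' * σ - b' * τ) / σ ^ 2 =
        (((a - a') * σ - (b - b') * τ) * σ - b * (a' * σ - b' * τ)) / (σ ^ 2 * (σ + b)) := by
      field_simp
      ring
    rw [heq]
    refine hbound _ ?_
    have k1 : |((a - a') * σ - (b - b') * τ) * σ| ≤ σ * (σ + |τ|) * (|a - a'| + |b - b'|) := by
      rw [abs_mul, abs_of_pos hσ]
      have : |(a - a') * σ - (b - b') * τ| ≤ |a - a'| * σ + |b - b'| * |τ| := by
        refine (abs_sub _ _).trans_eq ?_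
        rw [abs_mul, abs_mul, abs_of_pos hσ]
      have := mul_le_mul_of_nonneg_right this hσ.le
      nlinarith [mul_nonneg (mul_nonneg h1 hτ) hσ.le, mul_nonneg (mul_nonneg h2 hσ.le) hσ.le]
    have k2 : |b * (a' * σ - b' * τ)| ≤ (σ + |τ|) * (|b| * (|a'| + |b'|)) := by
      rw [abs_mul]
      have : |a' * σ - b' * τ| ≤ |a'| * σ + |b'| * |τ| := by
        refine (abs_sub _ _).trans_eq ?_
        rw [abs_mul, abs_mul, abs_of_pos hσ]
      have := mul_le_mul_of_nonneg_left this h5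
      nlinarith [mul_nonneg hA hτ, mul_nonneg hB hσ.le]
    refine (abs_sub _ _).trans ?_
    have k3 := mul_le_mul_of_nonneg_right hL1 (add_nonneg h1 h2)
    have k4 := mul_le_mul_of_nonneg_right hL2 (mul_nonneg h5 (add_nonneg h3 h4))
    linarith
  · have heq : 1 / (σ + b) - 1 / σ + b' / σ ^ 2 =
        (-(b - b') * σ + b * b') / (σ ^ 2 * (σ + b)) := by
      field_simp
      ring
    rw [heq]
    refine hbound _ ?_
    refine (abs_add_le _ _).trans ?_
    rw [abs_mul, abs_mul, abs_neg, abs_of_pos hσ]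
    have k1 := mul_le_mul_of_nonneg_right hL3 h2
    have k2 := mul_le_mul_of_nonneg_right hL4 hB
    have k3 := mul_nonneg (zero_le_one.trans hL4) h1
    have k4 := mul_nonneg (zero_le_one.trans hL4) hA
    linarith

lemma norm_gpdParam_le (v : GPDParam) : ‖v‖ ≤ |v 0| + |v 1| := by
  rw [EuclideanSpace.norm_eq, Fin.sum_univ_two]
  refine Real.sqrt_le_iff.2 ⟨by positivity, ?_⟩
  rw [Real.norm_eq_abs, Real.norm_eq_abs]
  nlinarith [mul_nonneg (abs_nonneg (v 0)) (abs_nonneg (v 1))]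

end AsymptoticLinearity

/-! ### The remainder of the linear expansion and asymptotic linearity. -/

section Remainder

variable {ξ β : ℝ}

lemma sampleMean_mleIF (hξ : -(1 / 2) < ξ) (hβ : 0 < β) {n : ℕ} {x : Fin n → ℝ}
    (hx : ∀ i, 0 < x i ∧ 0 < 1 + ξ / β * x i) :
    sampleMean (fun y => mleIF ξ β y 0) x = (1 + ξ) / β *
        ((1 + 2 * ξ) * sampleMean (scoreTau (ξ / β) β⁻¹) x +
          sampleMean (scoreSigma (ξ / β) β⁻¹) x) ∧
      sampleMean (fun y => mleIF ξ β y 1) x =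
        -((1 + ξ) * ((1 + 2 * ξ) * sampleMean (scoreTau (ξ / β) β⁻¹) x +
          2 * sampleMean (scoreSigma (ξ / β) β⁻¹) x)) := by
  have h := fun i => mleIF_eq_score hξ hβ (hx i).1.le (one_add_div_mul_pos_iff.1 (hx i).2)
  simp only [sampleMean]
  rw [Finset.sum_congr rfl fun i _ => (h i).1, Finset.sum_congr rfl fun i _ => (h i).2]
  simp only [Finset.sum_neg_distrib, ← Finset.mul_sum, Finset.sum_add_distrib]
  constructor <;> ring

lemma norm_sub_smul_sum_le (ψ : ℝ → GPDParam) {n : ℕ} (x : Fin n → ℝ) (θ : GPDParam) :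
    ‖θ - !₂[ξ, β] - (n : ℝ)⁻¹ • ∑ i, ψ (x i)‖ ≤
      |θ 0 - ξ - sampleMean (fun y => ψ y 0) x| + |θ 1 - β - sampleMean (fun y => ψ y 1) x| := by
  refine (norm_gpdParam_le _).trans_eq ?_
  simp [sampleMean]

lemma abs_add_abs_sub_le_of_sq {κ γ a b a' b' : ℝ} (hκ : 0 < κ) (hγ : 0 < γ)
    (h : κ * ((a - a') ^ 2 + (b - b') ^ 2) ≤ 6 * (κ * γ ^ 2 / 12) * (a' ^ 2 + b' ^ 2)) :
    |a - a'| + |b - b'| ≤ γ * (|a'| + |b'|) := by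
  refine abs_le_of_sq_le_sq' ?_ (by positivity) |>.2
  have k1 : κ * ((a - a') ^ 2 + (b - b') ^ 2) ≤ κ * (γ ^ 2 / 2 * (a' ^ 2 + b' ^ 2)) :=
    h.trans_eq (by ring)
  have k2 := le_of_mul_le_mul_left k1 hκ
  rw [← sq_abs (a - a'), ← sq_abs (b - b'), ← sq_abs a', ← sq_abs b'] at k2
  have k3 : (|a - a'| + |b - b'|) ^ 2 ≤ 2 * (|a - a'| ^ 2 + |b - b'| ^ 2) := by
    nlinarith [sq_nonneg (|a - a'| - |b - b'|)]
  have k4 : γ ^ 2 * (|a'| ^ 2 + |b'| ^ 2) ≤ γ ^ 2 * (|a'| + |b'|) ^ 2 := by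
    refine mul_le_mul_of_nonneg_left ?_ (by positivity)
    nlinarith [mul_nonneg (abs_nonneg a') (abs_nonneg b')]
  rw [mul_pow]
  linarith

/-- The maximizer of the quadratic approximation in terms of the means `p₀`, `p₁` of the influence
function. -/
lemma score_eq_of_mleIF (hξ : -(1 / 2) < ξ) (hβ : 0 < β) {p₀ p₁ s t : ℝ}
    (h0 : p₀ = (1 + ξ) / β * ((1 + 2 * ξ) * s + t))
    (h1 : p₁ = -((1 + ξ) * ((1 + 2 * ξ) * s + 2 * t))) :
    s = 2 * (β ^ 2 / ((1 + ξ) * (1 + 2 * ξ))) * (p₀ / β - ξ / β ^ 2 * p₁) +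
        -(β ^ 2 / (1 + ξ)) * -(p₁ / β ^ 2) ∧
      t = -(β ^ 2 / (1 + ξ)) * (p₀ / β - ξ / β ^ 2 * p₁) +
        2 * (β ^ 2 / 2) * -(p₁ / β ^ 2) := by
  have n1 : 1 + ξ ≠ 0 := by linarith
  have n2 : 1 + 2 * ξ ≠ 0 := by linarith
  have n3 : 1 + ξ * 2 ≠ 0 := by linarith
  subst h0 h1
  constructor <;> field_simp <;> ring

lemma mul_abs_add_abs_le (hβ : 0 < β) {p₀ p₁ r K : ℝ} (hr : 0 ≤ r) (h0 : r * |p₀| ≤ K)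
    (h1 : r * |p₁| ≤ K) :
    r * (|p₀ / β - ξ / β ^ 2 * p₁| + |-(p₁ / β ^ 2)|) ≤
      (β⁻¹ + |ξ| / β ^ 2 + 1 / β ^ 2) * K := by
  have k2 : |p₀ / β - ξ / β ^ 2 * p₁| ≤ β⁻¹ * |p₀| + |ξ| / β ^ 2 * |p₁| := by
    refine (abs_sub _ _).trans_eq ?_
    rw [abs_div, abs_mul, abs_div, abs_of_pos hβ, abs_of_pos (show 0 < β ^ 2 by positivity)]
    ring
  have k3 : |-(p₁ / β ^ 2)| = 1 / β ^ 2 * |p₁| := by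
    rw [abs_neg, abs_div, abs_of_pos (show 0 < β ^ 2 by positivity)]
    ring
  rw [k3]
  calc r * (|p₀ / β - ξ / β ^ 2 * p₁| + 1 / β ^ 2 * |p₁|)
      ≤ r * (β⁻¹ * |p₀| + |ξ| / β ^ 2 * |p₁| + 1 / β ^ 2 * |p₁|) := by gcongr
    _ = β⁻¹ * (r * |p₀|) + |ξ| / β ^ 2 * (r * |p₁|) + 1 / β ^ 2 * (r * |p₁|) := by ring
    _ ≤ β⁻¹ * K + |ξ| / β ^ 2 * K + 1 / β ^ 2 * K := by gcongr
    _ = _ := by ring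

/-- The remainder of the linear expansion, given the error `M D` of the linearization of
`(τ, σ) ↦ (τ / σ, 1 / σ)`. -/
lemma norm_remainder_le (hβ : 0 < β) (ψ : ℝ → GPDParam) {n : ℕ} (x : Fin n → ℝ) {θ : GPDParam}
    (hθ : 0 < θ 1) {p₀ p₁ D : ℝ} (h0 : p₀ = sampleMean (fun y => ψ y 0) x)
    (h1 : p₁ = sampleMean (fun y => ψ y 1) x)
    (hD0 : |θ 0 / θ 1 / (θ 1)⁻¹ - ξ / β / β⁻¹ - ((p₀ / β - ξ / β ^ 2 * p₁) * β⁻¹ -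
      -(p₁ / β ^ 2) * (ξ / β)) / β⁻¹ ^ 2| ≤ D)
    (hD1 : |1 / (θ 1)⁻¹ - 1 / β⁻¹ + -(p₁ / β ^ 2) / β⁻¹ ^ 2| ≤ D) :
    ‖θ - !₂[ξ, β] - (n : ℝ)⁻¹ • ∑ i, ψ (x i)‖ ≤ 2 * D := by
  have hc0 : θ 0 - ξ - p₀ = θ 0 / θ 1 / (θ 1)⁻¹ - ξ / β / β⁻¹ -
      ((p₀ / β - ξ / β ^ 2 * p₁) * β⁻¹ - -(p₁ / β ^ 2) * (ξ / β)) / β⁻¹ ^ 2 := by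
    field_simp
    ring
  have hc1 : θ 1 - β - p₁ = 1 / (θ 1)⁻¹ - 1 / β⁻¹ + -(p₁ / β ^ 2) / β⁻¹ ^ 2 := by
    field_simp
    ring
  have hnorm := norm_sub_smul_sum_le (ξ := ξ) (β := β) ψ x θ
  rw [← h0, ← h1, hc0, hc1] at hnorm
  linarith

/-- Almost surely the remainder of the linear expansion of the maximum likelihood estimator is
eventually small when the linear term is of order `1 / √n`. -/
theorem ae_eventually_remainder_lt (hξ : -(1 / 2) < ξ) (hβ : 0 < β) {T : GPDEstimator}
    (hT : IsMLE T) {K ε : ℝ} (hK : 0 < K) (hε : 0 < ε) :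
    ∀ᵐ ω ∂(seqLaw (gpd ξ β)), ∀ᶠ n : ℕ in atTop,
      (∀ j : Fin 2, √(n : ℝ) * |sampleMean (fun y => mleIF ξ β y j) (firstObs n ω)| ≤ K) →
      √(n : ℝ) * ‖T.toFun n (firstObs n ω) - !₂[ξ, β] -
        (n : ℝ)⁻¹ • ∑ i, mleIF ξ β (firstObs n ω i)‖ < ε := by
  have := isProbabilityMeasure_gpd (show -1 < ξ by linarith) hβ
  have hd := gpdParam_coord_pos hξ hβ
  have hσ : 0 < β⁻¹ := inv_pos.2 hβ
  obtain ⟨κ, hκ, hq⟩ := exists_logLikQuad_bound hξ hβ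
  obtain ⟨M, hM, hlin⟩ := exists_linearization_bound (ξ / β) hσ
  set K₁ := (β⁻¹ + |ξ| / β ^ 2 + 1 / β ^ 2) * K with hK₁
  have hK₁0 : 0 < K₁ := by positivity
  -- The final bound on the scaled remainder is `4 M γ K₁`, hence at most `ε / 2`.
  set γ := min 1 (ε / (8 * M * K₁)) with hγ
  have hγ0 : 0 < γ := by positivity
  have hγ1 : γ ≤ 1 := min_le_left _ _
  have hγ2 : 8 * M * K₁ * γ ≤ ε := by
    have := mul_le_mul_of_nonneg_left (min_le_right 1 (ε / (8 * M * K₁)))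
      (show 0 ≤ 8 * M * K₁ by positivity)
    rwa [mul_div_cancel₀ _ (by positivity)] at this
  -- With this accuracy the comparison of quadratics gives `|a - a'| + |b - b'| ≤ γ (|a'| + |b'|)`.
  set ε₁ := κ * γ ^ 2 / 12 with hε₁
  have hε₁0 : 0 < ε₁ := by positivity
  have hε₁κ : 4 * ε₁ ≤ κ := by
    have : γ ^ 2 ≤ 1 := by nlinarith
    rw [hε₁]
    nlinarith
  obtain ⟨δ, hδ, hupper⟩ := ae_eventually_avgLogLik_le hξ hβ hε₁0
  obtain ⟨η, hη, hlower⟩ := ae_eventually_le_avgLogLik hξ hβ hε₁0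
  set δ' := min δ (min γ (β⁻¹ / 2)) with hδ'
  have hδ'0 : 0 < δ' := by positivity
  -- Keeps `(a', b')` within reach of the lower bound and its shifted parameter inside the parameter
  -- set.
  set ζ := min η (min β⁻¹ (β⁻¹ + 2 * (ξ / β)) / 6) with hζ
  have hζ0 : 0 < ζ := by positivity
  have hsqrt : Tendsto (fun n : ℕ => √(n : ℝ)) atTop atTop :=
    Real.tendsto_sqrt_atTop.comp tendsto_natCast_atTop_atTop
  filter_upwards [hupper, hlower, ae_eventually_mem_ball hξ hβ hδ'0, ae_eventually_isMLE hξ hβ hT,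
    ae_firstObs_pos hξ hβ, ae_eventually_forall_le (integrable_div_one_add_sq hξ hβ)]
    with ω hω1 hω2 hω3 hω4 hpos hω5
  filter_upwards [hω1, hω2, hω3, hω4, hω5 ((η / K₁) ^ 2) (by positivity),
    hsqrt.eventually_ge_atTop (K₁ / ζ), hsqrt.eventually_gt_atTop 0] with n h1 h2 h3 h4 h5 h6 hs hψ
  obtain ⟨hθ1, hθ2, hadm, hmax⟩ := h4
  set θ := T.toFun n (firstObs n ω)
  have hball := h3 _ _ (inv_pos.2 hθ1) hθ2.le hadm (hmax _ _ hσ hd fun i => (hpos n i).2)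
  set s := √(n : ℝ) with hs'
  set a := θ 0 / θ 1 - ξ / β with ha
  set b := (θ 1)⁻¹ - β⁻¹ with hb
  have hτa : θ 0 / θ 1 = ξ / β + a := by rw [ha]; ring
  have hσb : (θ 1)⁻¹ = β⁻¹ + b := by rw [hb]; ring
  obtain ⟨hψ0, hψ1⟩ := sampleMean_mleIF hξ hβ (hpos n)
  set p₀ := sampleMean (fun y => mleIF ξ β y 0) (firstObs n ω) with hp₀
  set p₁ := sampleMean (fun y => mleIF ξ β y 1) (firstObs n ω) with hp₁
  -- The derivative of `(ξ, β) ↦ (ξ / β, 1 / β)` applied to the mean influence function; by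
  -- `score_eq_of_mleIF` it is also the maximizer of the quadratic approximation.
  set a' := p₀ / β - ξ / β ^ 2 * p₁ with ha'
  set b' := -(p₁ / β ^ 2) with hb'
  have hK' : s * (|a'| + |b'|) ≤ K₁ := mul_abs_add_abs_le hβ hs.le (hψ 0) (hψ 1)
  have hKs : |a'| + |b'| ≤ K₁ / s := by rw [le_div_iff₀ hs]; linarith
  have hsmall : |a'| + |b'| ≤ ζ := by
    refine hKs.trans ?_
    rw [div_le_iff₀ hζ0] at h6
    rw [div_le_iff₀ hs]
    linarith
  have hα := abs_nonneg a'
  have hα' := abs_nonneg b'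
  have hζ1 : ζ ≤ η := min_le_left _ _
  have hζ2 : ζ ≤ min β⁻¹ (β⁻¹ + 2 * (ξ / β)) / 6 := min_le_right _ _
  have hm1 := min_le_left β⁻¹ (β⁻¹ + 2 * (ξ / β))
  have hm2 := min_le_right β⁻¹ (β⁻¹ + 2 * (ξ / β))
  -- `|a'| ≤ K₁ / √n`, while each `x / (1 + τ x)` in the sample is eventually at most `(η / K₁) √n`.
  obtain ⟨hadm', hF'⟩ := h2 a' b' (by linarith) (by linarith) fun i => by
    have k1 : 0 ≤ firstObs n ω i / (1 + ξ / β * firstObs n ω i) :=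
      div_nonneg (hpos n i).1.le (hpos n i).2.le
    have k2 : (firstObs n ω i / (1 + ξ / β * firstObs n ω i)) ≤ η / K₁ * s := by
      refine (pow_le_pow_iff_left₀ k1 (by positivity) two_ne_zero).1 ?_
      rw [mul_pow, hs', Real.sq_sqrt n.cast_nonneg]
      exact h5 i
    have k3 : |a'| ≤ K₁ / s := by linarith
    calc |a'| * (firstObs n ω i / (1 + ξ / β * firstObs n ω i))
        ≤ K₁ / s * (η / K₁ * s) := by gcongr
      _ = η := by field_simp
  have hba' := abs_le.1 (show |a'| ≤ ζ by linarith)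
  have hbb' := abs_le.1 (show |b'| ≤ ζ by linarith)
  have hle := hmax (ξ / β + a') (β⁻¹ + b') (by linarith) (by linarith) hadm'
  rw [hτa, hσb] at hle
  have hF := h1 a b (hball.1.le.trans (min_le_left _ _)) (hball.2.le.trans (min_le_left _ _))
    (by rwa [hτa] at hadm)
  have hbγ : |b| ≤ γ := hball.2.le.trans ((min_le_right _ _).trans (min_le_left _ _))
  have hbσ : |b| ≤ β⁻¹ / 2 := hball.2.le.trans ((min_le_right _ _).trans (min_le_right _ _))
  obtain ⟨hs1, hs2⟩ := score_eq_of_mleIF hξ hβ hψ0 hψ1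
  rw [logLikQuad_eq hξ hβ, logLikLin] at hF hF'
  have hdist : |a - a'| + |b - b'| ≤ γ * (|a'| + |b'|) :=
    abs_add_abs_sub_le_of_sq hκ hγ0
      (sq_dist_le_of_quadratic_approx hq hs1 hs2 hF hF' (by linarith) hε₁0.le hε₁κ)
  have htotal : |a - a'| + |b - b'| + |b| * (|a'| + |b'|) ≤ 2 * γ * (|a'| + |b'|) := by
    have := mul_le_mul_of_nonneg_right hbγ (add_nonneg hα hα')
    linarith
  obtain ⟨hr0, hr1⟩ := hlin a b a' b' hbσ
  rw [← hτa, ← hσb] at hr0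
  rw [← hσb] at hr1
  have hnorm := norm_remainder_le hβ (mleIF ξ β) (firstObs n ω) hθ1 hp₀ hp₁ hr0 hr1
  have hnorm' : ‖θ - !₂[ξ, β] - (n : ℝ)⁻¹ • ∑ i, mleIF ξ β (firstObs n ω i)‖ ≤
      4 * M * γ * (|a'| + |b'|) := by
    have := mul_le_mul_of_nonneg_left htotal hM.le
    linarith
  calc s * ‖θ - !₂[ξ, β] - (n : ℝ)⁻¹ • ∑ i, mleIF ξ β (firstObs n ω i)‖
      ≤ s * (4 * M * γ * (|a'| + |b'|)) := mul_le_mul_of_nonneg_left hnorm' hs.le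
    _ = 4 * M * γ * (s * (|a'| + |b'|)) := by ring
    _ ≤ 4 * M * γ * K₁ := mul_le_mul_of_nonneg_left hK' (by positivity)
    _ < ε := by
        have : 0 < 8 * M * K₁ * γ := by positivity
        linarith

/-- Probabilities of events which almost surely fail eventually. -/
lemma tendsto_measure_zero_of_ae_eventually {Ω : Type*} [MeasurableSpace Ω] {P : Measure Ω}
    [IsFiniteMeasure P] {A : ℕ → Set Ω} (hA : ∀ n, MeasurableSet (A n))
    (h : ∀ᵐ ω ∂P, ∀ᶠ n in atTop, ω ∉ A n) : Tendsto (fun n => P (A n)) atTop (𝓝 0) := by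
  have := tendsto_measure_of_ae_tendsto_indicator_of_isFiniteMeasure (μ := P) atTop
    MeasurableSet.empty hA (by
      filter_upwards [h] with ω hω
      filter_upwards [hω] with n hn
      simpa using hn)
  simpa using this

@[fun_prop] lemma measurable_mleIF_apply (ξ β : ℝ) (j : Fin 2) :
    Measurable fun y => mleIF ξ β y j := by
  simp only [mleIF_apply_eq_sum]
  fun_prop

lemma measurable_mleIF (ξ β : ℝ) : Measurable (mleIF ξ β) :=
  (WithLp.measurable_toLp 2 _).comp (measurable_pi_iff.2 fun j => measurable_mleIF_apply ξ β j)

lemma measurable_sampleMean {f : ℝ → ℝ} (hf : Measurable f) (n : ℕ) :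
    Measurable fun x : Fin n → ℝ => sampleMean f x :=
  (Finset.measurable_fun_sum _ fun i _ => hf.comp (measurable_pi_apply i)).const_mul _

lemma measurable_norm_remainder (T : GPDEstimator) (ξ β : ℝ) (n : ℕ) :
    Measurable fun x : Fin n → ℝ => √(n : ℝ) *
      ‖T.toFun n x - !₂[ξ, β] - (n : ℝ)⁻¹ • ∑ i, mleIF ξ β (x i)‖ := by
  have h1 := T.measurable n
  have h2 : Measurable fun x : Fin n → ℝ => ∑ i, mleIF ξ β (x i) :=
    Finset.measurable_fun_sum _ fun i _ => (measurable_mleIF ξ β).comp (measurable_pi_apply i)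
  have h3 : Measurable fun x : Fin n → ℝ => T.toFun n x - !₂[ξ, β] := h1.sub_const _
  have h4 : Measurable fun x : Fin n → ℝ => (n : ℝ)⁻¹ • ∑ i, mleIF ξ β (x i) :=
    h2.fun_const_smul _
  have h5 : Measurable fun x : Fin n → ℝ =>
      T.toFun n x - !₂[ξ, β] - (n : ℝ)⁻¹ • ∑ i, mleIF ξ β (x i) := h3.fun_sub h4
  exact h5.norm.const_mul _

lemma exists_ofReal_add_add_le {e : ℝ≥0∞} (he : 0 < e) :
    ∃ c : ℝ, 0 < c ∧ ENNReal.ofReal c + ENNReal.ofReal c + ENNReal.ofReal c ≤ e := by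
  by_cases htop : e = ⊤
  · exact ⟨1, one_pos, by simp [htop]⟩
  · have he' := ENNReal.toReal_pos he.ne' htop
    refine ⟨e.toReal / 3, by positivity, ?_⟩
    rw [← ENNReal.ofReal_add (by positivity) (by positivity),
      ← ENNReal.ofReal_add (by positivity) (by positivity)]
    exact (ENNReal.ofReal_le_iff_le_toReal htop).2 (by linarith)

/-- Sample means of the influence function are of order `1 / √n` in probability. -/
lemma exists_meas_sqrt_mul_sampleMean_le (hξ : -(1 / 2) < ξ) (hβ : 0 < β) {c : ℝ} (hc : 0 < c) :
    ∃ K > 0, ∀ (j : Fin 2) (n : ℕ), 0 < n → seqLaw (gpd ξ β) {ω | K ≤ √(n : ℝ) *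
      |sampleMean (fun y => mleIF ξ β y j) (firstObs n ω)|} ≤ ENNReal.ofReal c := by
  have := isProbabilityMeasure_gpd (show -1 < ξ by linarith) hβ
  set V : Fin 2 → ℝ := fun j => ∫ x, mleIF ξ β x j ^ 2 ∂(gpd ξ β) with hV
  have hV0 : ∀ j, 0 ≤ V j := fun j => integral_nonneg fun x => sq_nonneg _
  have hW : 0 < V 0 + V 1 + 1 := by linarith [hV0 0, hV0 1]
  have hVW : ∀ j, V j ≤ V 0 + V 1 + 1 := by
    refine Fin.forall_fin_two.2 ⟨?_, ?_⟩ <;> linarith [hV0 0, hV0 1]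
  refine ⟨√((V 0 + V 1 + 1) / c), Real.sqrt_pos.2 (by positivity), fun j n hn => ?_⟩
  refine (meas_sqrt_mul_mean_ge_le ((memLp_mleIF hξ hβ).eval_piLp j) (integral_mleIF hξ hβ j)
    (Real.sqrt_pos.2 (by positivity)) hn).trans (ENNReal.ofReal_le_ofReal ?_)
  rw [Real.sq_sqrt (by positivity), div_div_eq_mul_div, div_le_iff₀ hW, mul_comm]
  exact mul_le_mul_of_nonneg_left (hVW j) hc.le

/-- For the remainder, the event is split according to whether both scaled means of the influence
function are at most `K`. If so, it almost surely fails eventually; otherwise Chebyshev's inequality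
applies to one of the two components. -/
theorem isALE_of_isMLE (hξ : -(1 / 2) < ξ) (hβ : 0 < β) {T : GPDEstimator} (hT : IsMLE T) :
    IsALE ξ β T (mleIF ξ β) where
  memLp := memLp_mleIF hξ hβ
  centered := integral_mleIF hξ hβ
  score := integral_mleIF_mul_gpdScore hξ hβ
  remainder ε hε := by
    have := isProbabilityMeasure_gpd (show -1 < ξ by linarith) hβ
    set P := seqLaw (gpd ξ β) with hP
    rw [ENNReal.tendsto_nhds_zero]
    intro e he
    obtain ⟨c, hc0, hce⟩ := exists_ofReal_add_add_le he
    obtain ⟨K, hK0, hB⟩ := exists_meas_sqrt_mul_sampleMean_le hξ hβ hc0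
    set A : ℕ → Set (ℕ → ℝ) := fun n => {ω | (∀ j : Fin 2, √(n : ℝ) *
        |sampleMean (fun y => mleIF ξ β y j) (firstObs n ω)| ≤ K) ∧ ε ≤ √(n : ℝ) *
        ‖T.toFun n (firstObs n ω) - !₂[ξ, β] -
          (n : ℝ)⁻¹ • ∑ i, mleIF ξ β (firstObs n ω i)‖} with hA
    have hRm := measurable_norm_remainder T ξ β
    have hAm : ∀ n, MeasurableSet (A n) := fun n => by
      have h1 := fun j => (measurable_sampleMean (measurable_mleIF_apply ξ β j) n).comp
        (measurable_firstObs n)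
      have h2 := (hRm n).comp (measurable_firstObs n)
      refine MeasurableSet.inter (MeasurableSet.congr (MeasurableSet.iInter fun j =>
        measurableSet_le ((h1 j).abs.const_mul √(n : ℝ)) (measurable_const (a := K))) ?_)
        (measurableSet_le measurable_const h2)
      ext ω
      simp only [Set.mem_iInter, Set.mem_ofPred_eq]
      rfl
    have hA0 := tendsto_measure_zero_of_ae_eventually (P := P) hAm (by
      filter_upwards [ae_eventually_remainder_lt hξ hβ hT hK0 hε] with ω hω
      filter_upwards [hω] with n hn hmem
      exact absurd (hn hmem.1) (not_lt.2 hmem.2))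
    have hc0' : (0 : ℝ≥0∞) < ENNReal.ofReal c := ENNReal.ofReal_pos.2 hc0
    filter_upwards [(ENNReal.tendsto_nhds_zero.1 hA0) _ hc0', eventually_gt_atTop 0]
      with n hn hn0
    rw [gpdSample, ← map_firstObs, Measure.map_apply (measurable_firstObs n)
      (measurableSet_le measurable_const (hRm n))]
    refine le_trans (measure_mono fun ω hω => ?_) (((measure_union_le _ _).trans
      (add_le_add ((measure_union_le _ _).trans (add_le_add (hB 0 n hn0) (hB 1 n hn0))) hn)).trans hce)
    by_cases h : ∀ j : Fin 2, √(n : ℝ) *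
        |sampleMean (fun y => mleIF ξ β y j) (firstObs n ω)| ≤ K
    · exact Or.inr ⟨h, hω⟩
    · push Not at h
      obtain ⟨j, hj⟩ := h
      fin_cases j
      · exact Or.inl (Or.inl hj.le)
      · exact Or.inl (Or.inr hj.le)

end Remainder

theorem propositionA1 (ξ β : ℝ) (hξ : -(1 / 2) < ξ) (hβ : 0 < β)
    (T : GPDEstimator) (hT : IsMLE T) :
    -- influence function, and its quantile-type representation
    (IsALE ξ β T (mleIF ξ β) ∧
      (ξ ≠ 0 → ∀ x : ℝ, 0 ≤ x → 0 < 1 + ξ * (x / β) →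
        mleIF ξ β x = !₂[gpdPsiTilde ξ (gpdQuantileArg ξ (x / β)) 0,
          β * gpdPsiTilde ξ (gpdQuantileArg ξ (x / β)) 1])) ∧
    -- asymptotic variance, and its minimality among all ALEs
    (HasAsVar ξ β T (fisherInfo ξ β)⁻¹ ∧
      IsUnit (fisherInfo ξ β).det ∧
      (fisherInfo ξ β)⁻¹ = (1 + ξ) • !![ξ + 1, -β; -β, 2 * β ^ 2] ∧
      ∀ (S : GPDEstimator) (ψ : ℝ → GPDParam), IsALE ξ β S ψ →
        HasAsVar ξ β S (ifCov ξ β ψ) ∧ (ifCov ξ β ψ - (fisherInfo ξ β)⁻¹).PosSemidef) ∧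
    -- both components of the influence function are unbounded, with logarithmic growth
    (∀ i : Fin 2,
      ¬ BddAbove ((fun x => |mleIF ξ β x i|) '' {x | 0 ≤ x ∧ 0 < 1 + ξ * (x / β)}) ∧
      (0 < ξ → (fun x => |mleIF ξ β x i|) =Θ[atTop] Real.log)) ∧
    -- finite sample breakdown point
    (∀ (n : ℕ) (x : Fin n → ℝ), 2 ≤ n → (∀ i, 0 < x i) →
      fsbp (T.toFun n) x = 1 / (n : ℝ≥0∞) ∧
      IsGreatest {m : ℕ | m ≤ n ∧ ¬ BreaksDown (T.toFun n) x m} 0) := by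
  have hale := isALE_of_isMLE hξ hβ hT
  refine ⟨⟨hale, fun h x _ h1 => mleIF_eq_gpdPsiTilde hξ hβ h h1⟩, ⟨?_,
    isUnit_det_fisherInfo hξ hβ, fisherInfo_inv hξ hβ,
    fun S ψ h => ⟨h.hasAsVar hξ hβ, posSemidef_ifCov_sub hξ hβ h⟩⟩,
    fun i => ⟨not_bddAbove_mleIF hξ hβ i, fun h => mleIF_isTheta_log h hβ i⟩,
    fun n x hn hx => ⟨fsbp_eq hT hn hx, isGreatest_not_breaksDown hT hn hx⟩⟩
  rw [← ifCov_mleIF hξ hβ]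
  exact hale.hasAsVar hξ hβ
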